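/- **Setting.** Let $n\ge 1$, let $G=Sp_{2n}(\mathbb C)$ be the simply connected group of type $C_n$ with index set $I=\{1,\dots,n\}$, Cartan matrix $a_{i,j}=\alpha_j(h_i)$ ($a_{i,i}=2$, $a_{n-1,n}=-2$, $a_{i,j}=-1$ for the other $|i-j|=1$, and $0$ otherwise) and fundamental weights $\Lambda_i$. On the vector representation with basis $v_1,\dots,v_n,v_{\bar n},\dots,v_{\bar 1}$ put $f_iv_i=v_{i+1}$, $f_iv_{\overline{i+1}}=v_{\bar i}$ ($i<n$), $f_nv_n=v_{\bar n}$, all other $f_iv=0$, and $e_i={}^tf_i$. Put $x_i(t)=\exp(te_i)$, $y_i(t)=\exp(tf_i)$, $\alpha_i^\vee(t)=t^{h_i}$, $\bar s_i=x_i(-1)y_i(1)x_i(-1)$ and $\bar u=\bar s_{i_1}\cdots\bar s_{i_r}$ for a reduced word $i_1\cdots i_r$ of $u\in W$. For $g\in G$ let $\Delta_{u\Lambda_k,v\Lambda_k}(g)=\Delta_{\Lambda_k}(\bar u^{-1}g\bar v)$, where $\Delta_{\Lambda_k}$ is the regular function with $\Delta_{\Lambda_k}(u^-tu^+)=\Lambda_k(t)$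 for $u^\pm\in U^\pm$, $t\in T$ (the leading $k\times k$ minor in the vector representation). Let $w_0$ be the longest element of $W$, $\mathbf i_0=(1\,2\cdots n)^n$, and for $c=(c_i^{(p)})_{1\le i,p\le n}\in(\mathbb C^\times)^{n^2}$ $$\Theta^-_{\mathbf i_0}(c)=\prod_{p=1}^{n}\Bigl(\prod_{i=1}^{n}y_i(c_i^{(p)})\,\alpha_i^\vee\bigl((c_i^{(p)})^{-1}\bigr)\Bigr),$$ with factors in increasing order of $p$ and then of $i$. **Columns.** Let $\mathcal B$ be the set of all words $[u_1,\dots,u_m,\bar l_k,\dots,\bar l_1]$ with $m+k=n$, $1\le u_1<\dots<u_m\le n$, $1\le l_1<\dots<l_k\le n$. Let $B(\Lambda_n)\subset\mathcal B$ consist of the words for which $u_a=l_b=i$ implies $a+b\le i$, with its crystal structure as a subcrystal of $B(\Lambda_1)^{\otimes n}$ (columns read from top to bottom, with Kashiwara's tensor product rule) and highest weight vector $u_{\Lambda_n}=[1,2,\dots,n]$. **Rectification.** For a word $v=[u_1,\dots,u_m,\bar l_k,\dots,\bar l_1]$ say that $(u_a,\bar l_b)=(i,\bar i)$ is in $(+1)$-configuration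 if $a+b=i+1$. If such pairs exist, take the smallest such $i$ and a pair $(u_a,\bar l_b)$ with this $i$; let $i,i+1,\dots,j$ and $\bar k,\dots,\overline{i+1},\bar i$ be the maximal consecutive segments of $v$ starting at $u_a$ and ending at $\bar l_b$, respectively; replace the first by $k+1,\dots,k+j-i+1$ and the second by $\overline{k+j-i+1},\dots,\overline{j+1}$. If there are two such pairs for this $i$, the one with the larger $a$ is treated first, and then the other one. Repeating this, every $v\in\mathcal B$ is transformed into a unique element $\mathrm{Rect}(v)\in B(\Lambda_n)$. Put $n(b)=\#\{v\in\mathcal B\mid \mathrm{Rect}(v)=b\}$. **Monomials.** Let $\mathcal Y(p)$ be the crystal of Laurent monomials $Y=\prod Y_{m,i}^{l_{m,i}}$ ($m\in\mathbb Z$, $i\in I$) with $p_{i,j}=1$ for $i<j$ and $p_{i,j}=0$ for $i>j$, $A_{m,i}=Y_{m,i}Y_{m+1,i}\prod_{j\ne i}Y_{m+p_{j,i},j}^{a_{j,i}}$, $\mathrm{wt}(Y)=\sum l_{m,i}\Lambda_i$, $\varphi_i(Y)=\max_m\sum_{k\le m}l_{k,i}$, $\varepsilon_i(Y)=\varphi_i(Y)-\mathrm{wt}(Y)(h_i)$;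 $\tilde f_iY=A_{m,i}^{-1}Y$ with $m$ minimal such that $\varphi_i(Y)=\sum_{k\le m}l_{k,i}$ if $\varphi_i(Y)>0$, and $\tilde f_iY=0$ otherwise; $\tilde e_iY=A_{m,i}Y$ with $m$ maximal such that $\varphi_i(Y)=\sum_{k\le m}l_{k,i}$ if $\varepsilon_i(Y)>0$, and $\tilde e_iY=0$ otherwise. Let $m_n^{(0)}:B(\Lambda_n)\hookrightarrow\mathcal Y(p)$ be the unique embedding of crystals with $u_{\Lambda_n}\mapsto Y_{0,n}$. Write $c_i^{(m)}$ for $Y_{m,i}$. **Theorem.** $\mathrm{Rect}$ and $m_n^{(0)}$ are well defined, and for every $c\in(\mathbb C^\times)^{n^2}$ $$\Delta_{w_0s_n\Lambda_n,\Lambda_n}\bigl(\Theta^-_{\mathbf i_0}(c)\bigr)=\sum_{b\in B(\Lambda_n)\setminus\{u_{\Lambda_n}\}}n(b)\cdot m_n^{(0)}(b),$$ where the monomials on the right are evaluated at $c$. -/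

import Mathlib

namespace TypeC

/-! ### Root datum of type `C_n`

Simple roots, coroots and fundamental weights are indexed by `I = Fin n`; the element `i : Fin n`
stands for the index `i.val + 1` of `{1, …, n}`. -/

/-- The Cartan matrix `a_{i,j} = α_j(h_i)` of type `C_n` (`α_n` is the long root). -/
def cartan (n : ℕ) (i j : Fin n) : ℤ :=
  if i = j then 2
  else if i.val + 1 = j.val ∧ j.val + 1 = n then -2
  else if i.val + 1 = j.val ∨ j.val + 1 = i.val then -1
  else 0

/-- The last index `n` of `{1, …, n}`. -/
def lastIdx (n : ℕ) (hn : 0 < n) : Fin n := ⟨n - 1, by omega⟩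

/-- The simple reflection `s_i` on the weight lattice. A weight `lam` is given by its coordinates
`lam j = ⟨h_j, lam⟩` with respect to the fundamental weights;
`s_i lam = lam - ⟨h_i, lam⟩ α_i`. -/
def simpleReflection (n : ℕ) (i : Fin n) (lam : Fin n → ℤ) : Fin n → ℤ :=
  fun j => lam j - lam i * cartan n j i

/-- The Weyl group element `s_{i_1} ⋯ s_{i_r}` of a word `i_1 ⋯ i_r`, as an operator on the weight
lattice (on which the Weyl group acts faithfully). -/
def weylOf (n : ℕ) (w : List (Fin n)) : (Fin n → ℤ) → (Fin n → ℤ) :=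
  fun lam => w.foldr (simpleReflection n) lam

/-- A word is reduced if no shorter word represents the same Weyl group element. -/
def IsReducedWord (n : ℕ) (w : List (Fin n)) : Prop :=
  ∀ w' : List (Fin n), weylOf n w' = weylOf n w → w.length ≤ w'.length

/-- The reduced word `(1 2 ⋯ n)^n` of the longest Weyl group element `w_0`. -/
def longestWord (n : ℕ) : List (Fin n) :=
  (List.finRange n).flatMap fun _ => List.finRange n

/-! ### The group of type `C_n` in the vector representation

The simply connected group is `Sp_{2n}(ℂ)`, realised faithfully on the vector representation
`V(Λ_1)` with basis `v_1, …, v_n, v_{\bar 1}, …, v_{\bar n}`. -/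

/-- Index set of the basis of `V(Λ_1)`: `inl i` is `v_{i+1}` and `inr i` is `v_{\overline{i+1}}`. -/
abbrev BasisIdx (n : ℕ) := Fin n ⊕ Fin n

/-- The Chevalley generator `f_i` on `V(Λ_1)`: for `i < n` it maps `v_i ↦ v_{i+1}` and
`v_{\overline{i+1}} ↦ v_{\bar i}`, and `f_n` maps `v_n ↦ v_{\bar n}`; all other basis vectors go
to zero. Columns are sources and rows are targets. -/
def fMat (n : ℕ) (i : Fin n) : Matrix (BasisIdx n) (BasisIdx n) ℂ :=
  Matrix.of fun r s =>
    match r, s with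
    | .inl a, .inl b => if b = i ∧ a.val = i.val + 1 then 1 else 0
    | .inr a, .inr b => if a = i ∧ b.val = i.val + 1 then 1 else 0
    | .inr a, .inl b => if a = i ∧ b = i ∧ i.val + 1 = n then 1 else 0
    | .inl _, .inr _ => 0

/-- The Chevalley generator `e_i` on `V(Λ_1)`: for `i < n` it maps `v_{i+1} ↦ v_i` and
`v_{\bar i} ↦ v_{\overline{i+1}}`, and `e_n` maps `v_{\bar n} ↦ v_n`; all other basis vectors go
to zero. -/
def eMat (n : ℕ) (i : Fin n) : Matrix (BasisIdx n) (BasisIdx n) ℂ := (fMat n i).transpose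

theorem fMat_mul_self (n : ℕ) (i : Fin n) : fMat n i * fMat n i = 0 := by
  ext r s
  simp only [Matrix.mul_apply, Fintype.sum_sum_type, Matrix.zero_apply]
  have h : ∀ t, fMat n i r t * fMat n i t s = 0 := by
    intro t
    rcases r with a | a <;> rcases s with b | b <;> rcases t with d | d <;>
      simp only [fMat, Matrix.of_apply, mul_ite, mul_one, mul_zero] <;>
      grind
  simp [h]

/-- `x_i(t) = exp(t e_i)`, which is `1 + t e_i` since `e_i ^ 2 = 0` on `V(Λ_1)`. -/
def xMat (n : ℕ) (i : Fin n) (t : ℂ) : Matrix (BasisIdx n) (BasisIdx n) ℂ := 1 + t • eMat n i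

/-- `y_i(t) = exp(t f_i)`, which is `1 + t f_i` since `f_i ^ 2 = 0` on `V(Λ_1)`. -/
def yMat (n : ℕ) (i : Fin n) (t : ℂ) : Matrix (BasisIdx n) (BasisIdx n) ℂ := 1 + t • fMat n i

/-- `α_i^∨(t) = t^{h_i}`: a weight vector `v` of `V(Λ_1)` is scaled by `t^{⟨h_i, wt v⟩}`, where
`wt v_j = Λ_j - Λ_{j-1} = - wt v_{\bar j}`. -/
noncomputable def corootMat (n : ℕ) (i : Fin n) (t : ℂ) : Matrix (BasisIdx n) (BasisIdx n) ℂ :=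
  Matrix.diagonal fun s =>
    match s with
    | .inl a => if a = i then t else if a.val = i.val + 1 then t⁻¹ else 1
    | .inr a => if a = i then t⁻¹ else if a.val = i.val + 1 then t else 1

/-- The representative `x_i(-1) y_i(1) x_i(-1)` of the simple reflection `s_i`. -/
def sBar (n : ℕ) (i : Fin n) : Matrix (BasisIdx n) (BasisIdx n) ℂ :=
  xMat n i (-1) * yMat n i 1 * xMat n i (-1)

/-- The representative `\bar s_{i_1} ⋯ \bar s_{i_r}` of the Weyl group element with reduced word
`i_1 ⋯ i_r`. -/
def weylLift (n : ℕ) (w : List (Fin n)) : Matrix (BasisIdx n) (BasisIdx n) ℂ :=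
  (w.map (sBar n)).prod

/-- `y_i(t) α_i^∨(t⁻¹)`. -/
noncomputable def boldY (n : ℕ) (i : Fin n) (t : ℂ) : Matrix (BasisIdx n) (BasisIdx n) ℂ :=
  yMat n i t * corootMat n i t⁻¹

/-- `Θ^-_{i_0}(c)` for the word `i_0 = (1 2 ⋯ n)^n`. The parameter `c_i^{(p)}` is `c i p`
(with the index shift of `Fin n` for `i`), and the parameters are taken in the order
`c_1^{(1)}, …, c_n^{(1)}, c_1^{(2)}, …, c_n^{(2)}, …, c_1^{(n)}, …, c_n^{(n)}`. Only the values
`c i p` with `1 ≤ p ≤ n` are used. -/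
noncomputable def thetaMinus (n : ℕ) (c : Fin n → ℤ → ℂ) :
    Matrix (BasisIdx n) (BasisIdx n) ℂ :=
  ((List.finRange n).flatMap fun p =>
    (List.finRange n).map fun i => boldY n i (c i ((p.val : ℤ) + 1))).prod

/-- The principal minor `Δ_{Λ_k}` on the group: the leading `k × k` minor in the vector
representation, i.e. the matrix coefficient of `v_1 ∧ ⋯ ∧ v_k`. It is a polynomial function
satisfying `Δ_{Λ_k}(u⁻ t u⁺) = Λ_k(t)`, see `principalMinor_gauss`. -/
def principalMinor (n : ℕ) (k : Fin n) (g : Matrix (BasisIdx n) (BasisIdx n) ℂ) : ℂ :=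
  (g.submatrix (fun a : {a : Fin n // a ≤ k} => Sum.inl a.val)
    (fun a : {a : Fin n // a ≤ k} => Sum.inl a.val)).det

/-- The generalized minor `Δ_{uΛ_k, vΛ_k}(g) = Δ_{Λ_k}(\bar u⁻¹ g \bar v)`, for Weyl group elements
`u`, `v` given by reduced words. -/
noncomputable def generalizedMinor (n : ℕ) (k : Fin n) (u v : List (Fin n))
    (g : Matrix (BasisIdx n) (BasisIdx n) ℂ) : ℂ :=
  principalMinor n k ((weylLift n u)⁻¹ * g * weylLift n v)

/-- The unipotent group `U⁻`, generated by the `y_i(t)`. -/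
def lowerUnipotent (n : ℕ) : Submonoid (Matrix (BasisIdx n) (BasisIdx n) ℂ) :=
  Submonoid.closure {g | ∃ i t, g = yMat n i t}

/-- The unipotent group `U⁺`, generated by the `x_i(t)`. -/
def upperUnipotent (n : ℕ) : Submonoid (Matrix (BasisIdx n) (BasisIdx n) ℂ) :=
  Submonoid.closure {g | ∃ i t, g = xMat n i t}

theorem lowerUnipotent_shape {n : ℕ} {g : Matrix (BasisIdx n) (BasisIdx n) ℂ}
    (hg : g ∈ lowerUnipotent n) :
    (∀ a b, g (.inl a) (.inr b) = 0) ∧ (∀ a b, a < b → g (.inl a) (.inl b) = 0) ∧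
      ∀ a, g (.inl a) (.inl a) = 1 := by
  induction hg using Submonoid.closure_induction with
  | mem g h =>
    obtain ⟨i, t, rfl⟩ := h
    refine ⟨fun a b => ?_, fun a b hab => ?_, fun a => ?_⟩
    · simp [yMat, fMat]
    · have h1 : ¬ (b = i ∧ a.val = i.val + 1) := by
        rintro ⟨rfl, h⟩
        have := Fin.lt_def.1 hab
        omega
      simp [yMat, fMat, hab.ne, h1]
    · have h1 : ¬ (a = i ∧ a.val = i.val + 1) := by
        rintro ⟨rfl, h⟩
        omega
      simp [yMat, fMat, h1]
  | one => exact ⟨by simp, fun a b hab => by simp [hab.ne], by simp⟩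
  | mul x y _ _ hx hy =>
    obtain ⟨x1, x2, x3⟩ := hx
    obtain ⟨y1, y2, y3⟩ := hy
    refine ⟨fun a b => ?_, fun a b hab => ?_, fun a => ?_⟩
    · simp [Matrix.mul_apply, x1, y1]
    · simp only [Matrix.mul_apply, Fintype.sum_sum_type, x1, zero_mul, Finset.sum_const_zero,
        add_zero]
      refine Finset.sum_eq_zero fun d _ => ?_
      rcases lt_or_ge a d with h | h
      · simp [x2 a d h]
      · simp [y2 d b (lt_of_le_of_lt h hab)]
    · simp only [Matrix.mul_apply, Fintype.sum_sum_type, x1, zero_mul, Finset.sum_const_zero,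
        add_zero]
      rw [Finset.sum_eq_single a]
      · simp [x3, y3]
      · intro d _ hd
        rcases lt_or_gt_of_ne hd with h | h
        · simp [y2 d a h]
        · simp [x2 a d h]
      · simp

theorem transpose_mem_lowerUnipotent {n : ℕ} {g : Matrix (BasisIdx n) (BasisIdx n) ℂ}
    (hg : g ∈ upperUnipotent n) : g.transpose ∈ lowerUnipotent n := by
  induction hg using Submonoid.closure_induction with
  | mem g h =>
    obtain ⟨i, t, rfl⟩ := h
    exact Submonoid.subset_closure ⟨i, t, by simp [xMat, yMat, eMat]⟩
  | one =>
    rw [Matrix.transpose_one]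
    exact (lowerUnipotent n).one_mem
  | mul x y _ _ hx hy => simpa using (lowerUnipotent n).mul_mem hy hx

theorem prod_corootMat {n : ℕ} (k : Fin n) (z : Fin n → ℂ) (hz : ∀ i, z i ≠ 0)
    (l : List (Fin n)) (hl : l.Nodup) :
    ∃ d : BasisIdx n → ℂ, (l.map fun i => corootMat n i (z i)).prod = Matrix.diagonal d ∧
      ∏ a : {a : Fin n // a ≤ k}, d (.inl a.val) = if k ∈ l then z k else 1 := by
  induction l with
  | nil => exact ⟨fun _ => 1, by simp, by simp⟩
  | cons i l ih =>
    obtain ⟨hi, hl⟩ := List.nodup_cons.1 hl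
    obtain ⟨d, h1, h2⟩ := ih hl
    refine ⟨_, by
      rw [List.map_cons, List.prod_cons, h1, corootMat, Matrix.diagonal_mul_diagonal], ?_⟩
    rw [Finset.prod_mul_distrib, h2]
    have key : ∏ a : {a : Fin n // a ≤ k},
        (if a.val = i then z i else if a.val.val = i.val + 1 then (z i)⁻¹ else 1) =
          if k = i then z i else 1 := by
      have hsplit : ∀ a : Fin n,
          (if a = i then z i else if a.val = i.val + 1 then (z i)⁻¹ else 1) =
            (if a = i then z i else 1) * (if a.val = i.val + 1 then (z i)⁻¹ else 1) := by
        intro a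
        by_cases h : a = i
        · have h' : ¬ a.val = i.val + 1 := by
            rw [h]
            omega
          simp [h]
        · simp [h]
      simp only [hsplit]
      rw [Finset.prod_mul_distrib]
      have e1 : ∏ a : {a : Fin n // a ≤ k}, (if a.val = i then z i else 1) =
          if i ≤ k then z i else 1 := by
        by_cases h : i ≤ k
        · rw [Finset.prod_eq_single (⟨i, h⟩ : {a : Fin n // a ≤ k})]
          · simp [h]
          · rintro ⟨b, hb⟩ _ hne
            have : b ≠ i := fun e => hne (Subtype.ext e)
            simp [this]
          · simp
        · rw [if_neg h]
          refine Finset.prod_eq_one fun a _ => ?_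
          have : a.val ≠ i := fun e => h (e ▸ a.2)
          simp [this]
      have e2 : ∏ a : {a : Fin n // a ≤ k}, (if a.val.val = i.val + 1 then (z i)⁻¹ else 1) =
          if i < k then (z i)⁻¹ else 1 := by
        by_cases h : i < k
        · have h' := Fin.lt_def.1 h
          rw [Finset.prod_eq_single
            (⟨⟨i.val + 1, by omega⟩, Fin.le_def.2 (by simpa using h')⟩ : {a : Fin n // a ≤ k})]
          · simp [h]
          · rintro ⟨b, hb⟩ _ hne
            have : b.val ≠ i.val + 1 := fun e => hne (Subtype.ext (Fin.ext e))
            simp [this]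
          · simp
        · rw [if_neg h]
          refine Finset.prod_eq_one fun a _ => ?_
          have : a.val.val ≠ i.val + 1 := fun e => h (Fin.lt_def.2 (by
            have := Fin.le_def.1 a.2
            omega))
          simp [this]
      rw [e1, e2]
      rcases lt_trichotomy i k with h | h | h
      · simp [h, h.le, h.ne', hz i]
      · simp [h]
      · simp [h.not_ge, h.not_gt, h.ne]
    rw [key]
    by_cases h : k = i
    · subst h
      simp [hi]
    · simp [h]

/-- The defining property of the principal minor: `Δ_{Λ_k}(u⁻ t u⁺) = Λ_k(t)` for `u^± ∈ U^±` and
`t = ∏_i α_i^∨(z_i)` in the maximal torus, where `Λ_k(t) = z_k`. -/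
theorem principalMinor_gauss (n : ℕ) (k : Fin n) (z : Fin n → ℂ) (hz : ∀ i, z i ≠ 0)
    {x y : Matrix (BasisIdx n) (BasisIdx n) ℂ}
    (hx : x ∈ lowerUnipotent n) (hy : y ∈ upperUnipotent n) :
    principalMinor n k (x * ((List.finRange n).map fun i => corootMat n i (z i)).prod * y) =
      z k := by
  obtain ⟨d, h1, h2⟩ := prod_corootMat k z hz (List.finRange n) (List.nodup_finRange n)
  obtain ⟨x1, x2, x3⟩ := lowerUnipotent_shape hx
  obtain ⟨-, y2, y3⟩ := lowerUnipotent_shape (transpose_mem_lowerUnipotent hy)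
  simp only [Matrix.transpose_apply] at y2 y3
  rw [h1]
  have hsub : (x * Matrix.diagonal d * y).submatrix
      (fun a : {a : Fin n // a ≤ k} => Sum.inl a.val)
      (fun a : {a : Fin n // a ≤ k} => Sum.inl a.val) =
      (x.submatrix (fun a : {a : Fin n // a ≤ k} => Sum.inl a.val)
        (fun a : {a : Fin n // a ≤ k} => Sum.inl a.val)) *
      Matrix.diagonal (fun a : {a : Fin n // a ≤ k} => d (.inl a.val)) *
      (y.submatrix (fun a : {a : Fin n // a ≤ k} => Sum.inl a.val)
        (fun a : {a : Fin n // a ≤ k} => Sum.inl a.val)) := by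
    ext a b
    rw [Matrix.submatrix_apply, Matrix.mul_apply, Matrix.mul_apply]
    simp only [Matrix.submatrix_apply, Matrix.mul_diagonal,
      Fintype.sum_sum_type, x1, zero_mul, Finset.sum_const_zero, add_zero]
    rw [Finset.sum_congr_set {c : Fin n | c ≤ k}
      (fun c => x (.inl a.val) (.inl c) * d (.inl c) * y (.inl c) (.inl b.val))
      (fun c : {c : Fin n // c ≤ k} =>
        x (.inl a.val) (.inl c.val) * d (.inl c.val) * y (.inl c.val) (.inl b.val))
      (fun _ _ => rfl)]
    · rfl
    · intro c hc
      have : a.val < c := lt_of_le_of_lt a.2 (not_le.1 hc)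
      simp [x2 _ _ this]
  rw [principalMinor, hsub, Matrix.det_mul, Matrix.det_mul, Matrix.det_diagonal, h2]
  have l1 : (x.submatrix (fun a : {a : Fin n // a ≤ k} => Sum.inl a.val)
        (fun a : {a : Fin n // a ≤ k} => Sum.inl a.val)).det = 1 := by
    rw [Matrix.det_of_isLowerTriangular]
    · simp [x3]
    · intro a b hab
      exact x2 _ _ hab
  have l2 : (y.submatrix (fun a : {a : Fin n // a ≤ k} => Sum.inl a.val)
        (fun a : {a : Fin n // a ≤ k} => Sum.inl a.val)).det = 1 := by
    rw [Matrix.det_of_isUpperTriangular]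
    · simp [y3]
    · intro a b hab
      exact y2 _ _ hab
  rw [l1, l2]
  simp

/-! ### Crystals -/

/-- The data of a crystal with index set `I` on a set `B`: weights (in coordinates with respect to
the fundamental weights), the functions `ε_i`, `φ_i` and the Kashiwara operators `ẽ_i`, `f̃_i`,
where `none` plays the role of `0`. -/
structure CrystalData (I B : Type*) where
  wt : B → I → ℤ
  eps : I → B → ℤ
  phi : I → B → ℤ
  e : I → B → Option B
  f : I → B → Option B

/-- Embeddings of crystals: injective maps that preserve weights, `ε_i` and `φ_i` and commute with
all `ẽ_i` and `f̃_i`. -/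
structure IsCrystalEmbedding {I B B' : Type*} (C : CrystalData I B) (C' : CrystalData I B')
    (m : B → B') : Prop where
  injective : Function.Injective m
  wt_eq : ∀ b, C'.wt (m b) = C.wt b
  eps_eq : ∀ i b, C'.eps i (m b) = C.eps i b
  phi_eq : ∀ i b, C'.phi i (m b) = C.phi i b
  e_eq : ∀ i b, C'.e i (m b) = (C.e i b).map m
  f_eq : ∀ i b, C'.f i (m b) = (C.f i b).map m

/-! ### Monomial realization -/

/-- Laurent monomials `∏ Y_{m,i}^{l_{m,i}}`, given by their exponents `l_{m,i}`; multiplication of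
monomials is addition of exponents. The variable `Y_{m,i}` is also written `c_i^{(m)}`. -/
abbrev LaurentMonomial (n : ℕ) := (ℤ × Fin n) →₀ ℤ

/-- The variable `Y_{m,i}`. -/
noncomputable def monoVar (n : ℕ) (m : ℤ) (i : Fin n) : LaurentMonomial n := Finsupp.single (m, i) 1

/-- The sign `p_{i,j}` attached to the cyclic sequence `⋯ (1 2 ⋯ n)(1 2 ⋯ n) ⋯`. -/
def signP (n : ℕ) (i j : Fin n) : ℤ := if i < j then 1 else 0

/-- The monomial `A_{m,i} = Y_{m,i} Y_{m+1,i} ∏_{j ≠ i} Y_{m+p_{j,i}, j}^{a_{j,i}}`. -/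
noncomputable def monoA (n : ℕ) (m : ℤ) (i : Fin n) : LaurentMonomial n :=
  monoVar n m i + monoVar n (m + 1) i +
    ∑ j ∈ Finset.univ.erase i, cartan n j i • monoVar n (m + signP n j i) j

/-- The partial sum `∑_{k ≤ m} l_{k,i}`. -/
def partialSum {n : ℕ} (Y : LaurentMonomial n) (i : Fin n) (m : ℤ) : ℤ :=
  ∑ q ∈ Y.support.filter (fun q => q.2 = i ∧ q.1 ≤ m), Y q

/-- `⟨h_i, wt(Y)⟩ = ∑_m l_{m,i}`. -/
def monoWt {n : ℕ} (Y : LaurentMonomial n) (i : Fin n) : ℤ :=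
  ∑ q ∈ Y.support.filter (fun q => q.2 = i), Y q

/-- `φ_i(Y) = max_m ∑_{k ≤ m} l_{k,i}`. -/
noncomputable def monoPhi {n : ℕ} (i : Fin n) (Y : LaurentMonomial n) : ℤ :=
  sSup (Set.range (partialSum Y i))

/-- `ε_i(Y) = φ_i(Y) - ⟨h_i, wt(Y)⟩`. -/
noncomputable def monoEps {n : ℕ} (i : Fin n) (Y : LaurentMonomial n) : ℤ :=
  monoPhi i Y - monoWt Y i

/-- `n_f^{(i)}(Y) = min {m | φ_i(Y) = ∑_{k ≤ m} l_{k,i}}`, used only if `φ_i(Y) > 0`. -/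
noncomputable def monoNf {n : ℕ} (i : Fin n) (Y : LaurentMonomial n) : ℤ :=
  sInf {m | monoPhi i Y = partialSum Y i m}

/-- `n_e^{(i)}(Y) = max {m | φ_i(Y) = ∑_{k ≤ m} l_{k,i}}`, used only if `ε_i(Y) > 0`. -/
noncomputable def monoNe {n : ℕ} (i : Fin n) (Y : LaurentMonomial n) : ℤ :=
  sSup {m | monoPhi i Y = partialSum Y i m}

/-- The crystal of monomials `𝒴(p)` for the cyclic sequence `⋯ (1 2 ⋯ n)(1 2 ⋯ n) ⋯`. -/
noncomputable def monomialCrystal (n : ℕ) : CrystalData (Fin n) (LaurentMonomial n) where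
  wt := monoWt
  eps := monoEps
  phi := monoPhi
  e i Y := if 0 < monoEps i Y then some (Y + monoA n (monoNe i Y) i) else none
  f i Y := if 0 < monoPhi i Y then some (Y - monoA n (monoNf i Y) i) else none

/-- The value of a Laurent monomial at `Y_{m,i} = c_i^{(m)}`. -/
noncomputable def evalMono {n : ℕ} (c : Fin n → ℤ → ℂ) (Y : LaurentMonomial n) : ℂ :=
  Y.prod fun q l => c q.2 q.1 ^ l

/-! ### Columns and the crystal `B(Λ_n)` -/

/-- The letters `1, 2, …` and `\bar 1, \bar 2, …`. -/
inductive Letter where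
  | pos (j : ℕ)
  | neg (j : ℕ)

/-- The coefficient `⟨h_r, wt(v_j)⟩`, where `wt(v_j) = Λ_j - Λ_{j-1} = - wt(v_{\bar j})`. -/
def letterWt (r : ℕ) : Letter → ℤ
  | .pos j => (if j = r then 1 else 0) - (if j = r + 1 then 1 else 0)
  | .neg j => (if j = r + 1 then 1 else 0) - (if j = r then 1 else 0)

/-- `f̃_r` on the crystal `B(Λ_1)` of the vector representation. -/
def letterF (n r : ℕ) : Letter → Option Letter
  | .pos j => if j = r then (if r < n then some (.pos (r + 1)) else some (.neg n)) else none
  | .neg j => if j = r + 1 ∧ r < n then some (.neg r) else none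

/-- `ẽ_r` on the crystal `B(Λ_1)` of the vector representation. -/
def letterE (n r : ℕ) : Letter → Option Letter
  | .pos j => if j = r + 1 ∧ r < n then some (.pos r) else none
  | .neg j => if j = r then (if r < n then some (.neg (r + 1)) else some (.pos n)) else none

/-- `φ_r` on `B(Λ_1)`. -/
def letterPhi (n r : ℕ) (x : Letter) : ℕ := if (letterF n r x).isSome then 1 else 0

/-- `ε_r` on `B(Λ_1)`. -/
def letterEps (n r : ℕ) (x : Letter) : ℕ := if (letterE n r x).isSome then 1 else 0

/-- The weight of `x_1 ⊗ ⋯ ⊗ x_k`. -/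
def wordWt (r : ℕ) (w : List Letter) : ℤ := (w.map (letterWt r)).sum

/-- `ε_r` on the tensor product `B(Λ_1)^{⊗ k}`: `ε(x ⊗ w) = ε(x) + max(0, ε(w) - φ(x))`
(the subtraction is truncated). -/
def wordEps (n r : ℕ) : List Letter → ℕ
  | [] => 0
  | x :: w => letterEps n r x + (wordEps n r w - letterPhi n r x)

/-- `φ_r` on the tensor product `B(Λ_1)^{⊗ k}`: `φ(x ⊗ w) = φ(w) + max(0, φ(x) - ε(w))`
(the subtraction is truncated). -/
def wordPhi (n r : ℕ) : List Letter → ℕ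
  | [] => 0
  | x :: w => wordPhi n r w + (letterPhi n r x - wordEps n r w)

/-- `f̃_r` on `B(Λ_1)^{⊗ k}` by the tensor product rule:
`f̃(x ⊗ w) = f̃ x ⊗ w` if `φ(x) > ε(w)`, and `x ⊗ f̃ w` otherwise. -/
def wordF (n r : ℕ) : List Letter → Option (List Letter)
  | [] => none
  | x :: w =>
    if wordEps n r w < letterPhi n r x then (letterF n r x).map (fun y => y :: w)
    else (wordF n r w).map (fun w' => x :: w')

/-- `ẽ_r` on `B(Λ_1)^{⊗ k}` by the tensor product rule:
`ẽ(x ⊗ w) = ẽ x ⊗ w` if `φ(x) ≥ ε(w)`, and `x ⊗ ẽ w` otherwise. -/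
def wordE (n r : ℕ) : List Letter → Option (List Letter)
  | [] => none
  | x :: w =>
    if wordEps n r w ≤ letterPhi n r x then (letterE n r x).map (fun y => y :: w)
    else (wordE n r w).map (fun w' => x :: w')

/-- A word `[u_1, …, u_m, \bar l_k, …, \bar l_1]`, given by the lists `u = (u_1, …, u_m)` and
`l = (l_1, …, l_k)`; note that `l` lists the barred letters from the last one backwards. -/
@[ext]
structure Column where
  u : List ℕ
  l : List ℕ
deriving DecidableEq

/-- The underlying word `[u_1, …, u_m, \bar l_k, …, \bar l_1]`. -/
def Column.word (v : Column) : List Letter :=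
  v.u.map Letter.pos ++ (v.l.map Letter.neg).reverse

/-- The inverse of `Column.word`. -/
def Column.ofWord (w : List Letter) : Column where
  u := w.filterMap fun x => match x with
    | .pos j => some j
    | .neg _ => none
  l := (w.filterMap fun x => match x with
    | .pos _ => none
    | .neg j => some j).reverse

/-- The set `𝓑` of all columns `[j_1, …, j_n]` of length `n` with
`1 ≤ j_1 < ⋯ < j_n ≤ \bar 1`, in the order `1 < ⋯ < n < \bar n < ⋯ < \bar 1`. -/
def IsColumn (n : ℕ) (v : Column) : Prop :=
  v.u.Pairwise (· < ·) ∧ v.l.Pairwise (· < ·) ∧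
  (∀ x ∈ v.u, 1 ≤ x ∧ x ≤ n) ∧ (∀ x ∈ v.l, 1 ≤ x ∧ x ≤ n) ∧
  v.u.length + v.l.length = n

/-- The columns in `B(Λ_n)`: those for which `u_a = l_b = i` implies `a + b ≤ i`.
(List positions are counted from `0`.) -/
def IsAdmissible (n : ℕ) (v : Column) : Prop :=
  IsColumn n v ∧
  ∀ a b i : ℕ, v.u[a]? = some i → v.l[b]? = some i → (a + 1) + (b + 1) ≤ i

/-- The underlying set of the crystal `B(Λ_n)`. -/
abbrev AdmissibleColumn (n : ℕ) := {v : Column // IsAdmissible n v}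

theorem finite_isColumn (n : ℕ) : {v : Column | IsColumn n v}.Finite := by
  refine Set.Finite.subset (Set.Finite.image
    (fun p : Finset ℕ × Finset ℕ => (⟨p.1.sort (· ≤ ·), p.2.sort (· ≤ ·)⟩ : Column))
    (Finset.finite_toSet ((Finset.Icc 1 n).powerset ×ˢ (Finset.Icc 1 n).powerset))) ?_
  rintro v ⟨h1, h2, h3, h4, -⟩
  refine ⟨(v.u.toFinset, v.l.toFinset), ?_, ?_⟩
  · simp only [Finset.coe_product, Finset.coe_powerset, Set.mem_prod, Set.mem_preimage,
      Set.mem_powerset_iff, Finset.coe_subset]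
    constructor
    · intro x hx
      simpa using h3 x (by simpa using hx)
    · intro x hx
      simpa using h4 x (by simpa using hx)
  · have key : ∀ s : List ℕ, s.Pairwise (· < ·) → s.toFinset.sort (· ≤ ·) = s := fun s hs =>
      (List.toFinset_sort (· ≤ ·) (hs.imp (fun h => ne_of_lt h))).2 (hs.imp (fun h => le_of_lt h))
    simp only [key _ h1, key _ h2]

instance (n : ℕ) : Finite (AdmissibleColumn n) :=
  ((finite_isColumn n).subset (fun _ h => h.1) : {v : Column | IsAdmissible n v}.Finite).to_subtype

noncomputable instance (n : ℕ) : Fintype (AdmissibleColumn n) := Fintype.ofFinite _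

/-- A word as an element of `B(Λ_n)`, if it is one. -/
noncomputable def toAdmissible (n : ℕ) (w : List Letter) : Option (AdmissibleColumn n) :=
  open Classical in
  if h : IsAdmissible n (Column.ofWord w) then some ⟨Column.ofWord w, h⟩ else none

/-- The crystal `B(Λ_n)`, as a subcrystal of `B(Λ_1)^{⊗ n}` by reading a column from top to
bottom. -/
noncomputable def columnCrystal (n : ℕ) : CrystalData (Fin n) (AdmissibleColumn n) where
  wt b i := wordWt (i.val + 1) b.val.word
  eps i b := wordEps n (i.val + 1) b.val.word
  phi i b := wordPhi n (i.val + 1) b.val.word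
  e i b := (wordE n (i.val + 1) b.val.word).bind (toAdmissible n)
  f i b := (wordF n (i.val + 1) b.val.word).bind (toAdmissible n)

/-- The highest weight vector `u_{Λ_n} = [1, 2, …, n]` of `B(Λ_n)`. -/
def highestColumn (n : ℕ) : AdmissibleColumn n :=
  ⟨⟨List.range' 1 n, []⟩, by
    refine ⟨⟨List.pairwise_lt_range', by simp, ?_, by simp, by simp⟩, by simp⟩
    intro x hx
    simp only [List.mem_range'_1] at hx
    omega⟩

/-! ### Rectification -/

/-- The length of the maximal consecutive run `x, x + 1, x + 2, …` at the head of a list. -/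
def runLength : List ℕ → ℕ
  | [] => 0
  | [_] => 1
  | x :: y :: t => if y = x + 1 then runLength (y :: t) + 1 else 1

/-- The pair `(u_a, \bar l_b)` equals `(i, \bar i)` and is in `(+1)`-configuration:
`a + b = i + 1`. (List positions are counted from `0`.) -/
def IsPlusOnePair (v : Column) (a b i : ℕ) : Prop :=
  v.u[a]? = some i ∧ v.l[b]? = some i ∧ (a + 1) + (b + 1) = i + 1

/-- Let `i = u_a = l_b`, and let `i, i + 1, …, j` and `\bar k, …, \overline{i+1}, \bar i` be the
maximal segments of `v` starting at `u_a`, respectively at `\bar l_b`. Replace the first segment by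
`k + 1, …, k + j - i + 1` and the second one by
`\overline{k + j - i + 1}, …, \overline{j + 2}, \overline{j + 1}`.
Here `p = j - i + 1` and `q = k - i + 1` are the lengths of the segments. -/
def Column.move (v : Column) (a b i : ℕ) : Column :=
  let p := runLength (v.u.drop a)
  let q := runLength (v.l.drop b)
  { u := v.u.take a ++ List.range' (i + q) p ++ v.u.drop (a + p)
    l := v.l.take b ++ List.range' (i + p) q ++ v.l.drop (b + q) }

/-- One elementary step of the transformations `τ_i`: take the smallest `i` such that some pair
`(i, \bar i)` of `v` is in `(+1)`-configuration, and move the segments of such a pair. If there are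
two such pairs for this `i`, then the pair whose unbarred letter stands further to the right is
moved first (and the other one in the next step), so that `τ_i` is the composition of two
elementary steps. -/
def TauStep (v w : Column) : Prop :=
  ∃ a b i : ℕ, IsPlusOnePair v a b i ∧
    (∀ a' b' i', IsPlusOnePair v a' b' i' → i < i' ∨ (i = i' ∧ a' ≤ a)) ∧
    w = v.move a b i

/-- `Rect(v) = b`: the element `b` of `B(Λ_n)` is obtained from `v` by applying the
transformations `τ_i`. -/
def IsRect {n : ℕ} (v : Column) (b : AdmissibleColumn n) : Prop :=
  Relation.ReflTransGen TauStep v b.val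

/-- The multiplicity `n(b) = #{v ∈ 𝓑 | Rect(v) = b}`. -/
noncomputable def rectMultiplicity {n : ℕ} (b : AdmissibleColumn n) : ℕ :=
  {v : Column | IsColumn n v ∧ IsRect v b}.ncard

end TypeC

namespace TypeC

/-! ### Rectification terminates -/

/-! Both sides are identified with the sum of `colMono n v` over all columns `v` with at least one
barred letter, where `colMono` is a product of one box monomial per letter, depending on the letter
and its position.

Crystal side. On admissible columns `colMono` is the embedding `m_n^{(0)}`. For each color `i` a
column consists of neutral words and at most two active letters, and the partial sums of its
monomial have the matching steps (`word_table`, `mono_table`). Admissibility puts the two steps in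
the order required by the tensor product rule. Every admissible column other than the highest one
can be raised, which gives both injectivity and uniqueness. Rectification preserves `colMono`. With
`m` unbarred and `k` barred letters, view `v` as two diagrams in an `m × k` rectangle: the cell `(a,
b)` lies in the row diagram if `u_a ≥ a + b + 2` and in the column diagram if `l_b ≥ a + b + 2`,
positions counted from `0`. A move adds one rectangle of cells, free of both diagrams, to both of
them. Each cell divides the monomial once through an unbarred letter and multiplies it by the same
factor once through a barred letter. The number of free cells drops, so the process stops; when no
cell is free the column is admissible. Hence `∑ n(b) m(b)` is the sum over all columns
(`sum_rectMultiplicity`).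

Minor side. In coordinates with respect to `ε_1, …, ε_n` the Weyl group acts by signed permutations,
and `w_0 s_n` negates the first `n - 1` coordinates. The generalized minor is therefore, up to an
explicit sign, the determinant of the rows `\bar 1, …, \overline{n-1}, n` of the first `n` columns
of `Θ^-`. A count of inversions shows that in a reduced word no `s_n` meets a negative last
coordinate, so no further sign occurs. Let `A` and `C` be the upper and lower halves of these
columns and `D` the diagonal of alternating signs. The pairing `Aᵀ D C` is unchanged by the factors
with `i < n`, and each factor with `i = n` adds a rank one term. This gives a Gram identity `Aᵀ D C
= Tᵀ W T` with `T` unitriangular and `W` diagonal. Replacing the last row of `C` by the last row `y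
= x T` of `A` multiplies `det C` by `∑ W_q⁻¹ x_q²`. The coordinates of `x` are, up to sign, sums
`E_r` over `r`-subsets of `{1, …, n}`, so the minor is `∑_r c_n^{(r)} E_r²`. Expanding the square
gives a sum over pairs `(U, L)` of `r`-subsets: `L` is the set of barred letters of a column and `U`
is the complement of its set of unbarred letters. -/

theorem runLength_spec (x : ℕ) (t : List ℕ) :
    1 ≤ runLength (x :: t) ∧ runLength (x :: t) ≤ (x :: t).length ∧
      (x :: t).take (runLength (x :: t)) = List.range' x (runLength (x :: t)) := by
  induction t generalizing x with
  | nil => simp [runLength]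
  | cons y t ih =>
    obtain ⟨h1, h2, h3⟩ := ih y
    by_cases h : y = x + 1
    · subst h
      have e : runLength (x :: (x + 1) :: t) = runLength ((x + 1) :: t) + 1 := by
        simp [runLength]
      rw [e]
      refine ⟨by omega, by simpa using h2, ?_⟩
      rw [List.take_succ_cons, h3, List.range'_succ]
    · simp [runLength, h]

/-- Replace the run of length `p` at position `a` by `x, x + 1, …`. -/
def replaceRun (s : List ℕ) (a p x : ℕ) : List ℕ :=
  s.take a ++ List.range' x p ++ s.drop (a + p)

theorem Column.move_eq (v : Column) (a b i : ℕ) :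
    v.move a b i =
      ⟨replaceRun v.u a (runLength (v.u.drop a)) (i + runLength (v.l.drop b)),
        replaceRun v.l b (runLength (v.l.drop b)) (i + runLength (v.u.drop a))⟩ := rfl

theorem run_of_getElem? {s : List ℕ} {a i : ℕ} (h : s[a]? = some i) :
    1 ≤ runLength (s.drop a) ∧ a + runLength (s.drop a) ≤ s.length ∧
      replaceRun s a (runLength (s.drop a)) i = s := by
  obtain ⟨ha, rfl⟩ := List.getElem?_eq_some_iff.1 h
  have e : s.drop a = s[a] :: s.drop (a + 1) := List.drop_eq_getElem_cons ha
  obtain ⟨h1, h2, h3⟩ := runLength_spec s[a] (s.drop (a + 1))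
  rw [← e] at h1 h2 h3
  rw [List.length_drop] at h2
  refine ⟨h1, by omega, ?_⟩
  rw [replaceRun, ← h3, ← List.drop_drop, List.append_assoc, List.take_append_drop,
    List.take_append_drop]

theorem length_replaceRun {s : List ℕ} {a p : ℕ} (x : ℕ) (h : a + p ≤ s.length) :
    (replaceRun s a p x).length = s.length := by
  simp [replaceRun]
  omega

theorem getD_replaceRun {s : List ℕ} {a p i : ℕ} (q : ℕ) (h : a + p ≤ s.length)
    (hs : replaceRun s a p i = s) (t : ℕ) :
    (replaceRun s a p (i + q)).getD t 0 =
      s.getD t 0 + if a ≤ t ∧ t < a + p then q else 0 := by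
  conv_rhs => rw [← hs]
  have hl : min a s.length = a := by omega
  simp only [replaceRun, List.getD_eq_getElem?_getD, List.getElem?_append, List.length_append,
    List.length_take, List.length_range', hl]
  by_cases h1 : t < a
  · have : t < a + p := by omega
    simp [h1, this]
  · by_cases h2 : t < a + p
    · have h3 : t - a < p := by omega
      have h4 : a ≤ t := by omega
      simp [h1, h2, h4, h3]
      omega
    · simp [h2]

theorem getD_run {s : List ℕ} {a p i : ℕ} (h : a + p ≤ s.length)
    (hs : replaceRun s a p i = s) {t : ℕ} (ht : t < p) : s.getD (a + t) 0 = i + t := by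
  have hl : min a s.length = a := by omega
  rw [← hs]
  simp [replaceRun, List.getD_eq_getElem?_getD, List.getElem?_append, hl, ht]

/-- The cell `(a, b)` lies in the row diagram of `v`. -/
def InRow (v : Column) (a b : ℕ) : Prop := a + b + 2 ≤ v.u.getD a 0

/-- The cell `(a, b)` lies in the column diagram of `v`. -/
def InCol (v : Column) (a b : ℕ) : Prop := a + b + 2 ≤ v.l.getD b 0

/-- The letters of `v` are within the bounds satisfied by strictly increasing sequences. -/
structure Bounded (m k : ℕ) (v : Column) : Prop where
  length_u : v.u.length = m
  length_l : v.l.length = k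
  le_u : ∀ a < m, a + 1 ≤ v.u.getD a 0
  u_le : ∀ a < m, v.u.getD a 0 ≤ a + k + 1
  le_l : ∀ b < k, b + 1 ≤ v.l.getD b 0
  l_le : ∀ b < k, v.l.getD b 0 ≤ b + m + 1

theorem getD_of_getElem? {s : List ℕ} {a i : ℕ} (h : s[a]? = some i) :
    a < s.length ∧ s.getD a 0 = i := by
  obtain ⟨ha, rfl⟩ := List.getElem?_eq_some_iff.1 h
  simp [ha]

theorem getElem?_of_getD {s : List ℕ} {a i : ℕ} (ha : a < s.length) (h : s.getD a 0 = i) :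
    s[a]? = some i := by
  simp [← h, ha]

/-- Summary of an elementary move: a rectangle of cells belonging to neither diagram is added to
both of them. -/
theorem Bounded.move {m k : ℕ} {v : Column} (hv : Bounded m k v) {a b i : ℕ}
    (h : IsPlusOnePair v a b i) :
    Bounded m k (v.move a b i) ∧
    ∃ p q : ℕ, 1 ≤ p ∧ 1 ≤ q ∧ a + p ≤ m ∧ b + q ≤ k ∧
      (∀ x y, a ≤ x ∧ x < a + p → b ≤ y ∧ y < b + q → ¬ InRow v x y ∧ ¬ InCol v x y) ∧
      (∀ x y, x < m → y < k → (InRow (v.move a b i) x y ↔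
        InRow v x y ∨ ((a ≤ x ∧ x < a + p) ∧ b ≤ y ∧ y < b + q))) ∧
      (∀ x y, x < m → y < k → (InCol (v.move a b i) x y ↔
        InCol v x y ∨ ((a ≤ x ∧ x < a + p) ∧ b ≤ y ∧ y < b + q))) := by
  obtain ⟨hu, hl, hi⟩ := h
  obtain ⟨p1, p2, p3⟩ := run_of_getElem? hu
  obtain ⟨q1, q2, q3⟩ := run_of_getElem? hl
  rw [Column.move_eq]
  obtain ⟨b1, b2, b3, b4, b5, b6⟩ := hv
  set p := runLength (v.u.drop a)
  set q := runLength (v.l.drop b)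
  have eu := getD_replaceRun q p2 p3
  have el := getD_replaceRun p q2 q3
  -- Since `i = a + b + 1`, row `x` of the row diagram ends exactly before column `b`, so raising
  -- the run by `q` adds the columns `b, …, b + q - 1`. The same holds for `rl` with rows and
  -- columns exchanged.
  have ru : ∀ x, a ≤ x ∧ x < a + p → v.u.getD x 0 = x + b + 1 := by
    intro x hx
    have := getD_run p2 p3 (t := x - a) (by omega)
    rw [show a + (x - a) = x by omega] at this
    omega
  have rl : ∀ y, b ≤ y ∧ y < b + q → v.l.getD y 0 = y + a + 1 := by
    intro y hy
    have := getD_run q2 q3 (t := y - b) (by omega)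
    rw [show b + (y - b) = y by omega] at this
    omega
  rw [b1] at p2
  rw [b2] at q2
  refine ⟨⟨?_, ?_, ?_, ?_, ?_, ?_⟩, p, q, p1, q1, p2, q2, ?_, ?_, ?_⟩
  · simp only
    rw [length_replaceRun _ (by omega), b1]
  · simp only
    rw [length_replaceRun _ (by omega), b2]
  · intro x hx
    simp only [eu]
    have := b3 x hx
    omega
  · intro x hx
    simp only [eu]
    have := b4 x hx
    split_ifs with hc
    · have := ru x hc
      omega
    · omega
  · intro x hx
    simp only [el]
    have := b5 x hx
    omega
  · intro x hx
    simp only [el]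
    have := b6 x hx
    split_ifs with hc
    · have := rl x hc
      omega
    · omega
  · intro x y hx hy
    simp only [InRow, InCol, ru x hx, rl y hy]
    omega
  · intro x y hx hy
    simp only [InRow, eu]
    split_ifs with hc
    · rw [ru x hc]
      omega
    · omega
  · intro x y hx hy
    simp only [InCol, el]
    split_ifs with hc
    · rw [rl y hc]
      omega
    · omega

/-- `v` arises from the column `w` by moving rectangles. -/
structure Reachable (m k : ℕ) (w v : Column) : Prop extends Bounded m k v where
  row_iff : ∀ a < m, ∀ b < k,
    ((InRow v a b ∨ ¬ InCol v a b) ↔ (InRow w a b ∨ ¬ InCol w a b))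
  col_iff : ∀ a < m, ∀ b < k,
    ((InCol v a b ∨ ¬ InRow v a b) ↔ (InCol w a b ∨ ¬ InRow w a b))

open Classical in
/-- The cells outside both diagrams. -/
noncomputable def freeCells (m k : ℕ) (v : Column) : Finset (ℕ × ℕ) :=
  (Finset.range m ×ˢ Finset.range k).filter fun c => ¬ InRow v c.1 c.2 ∧ ¬ InCol v c.1 c.2

/-- A rectangle of free cells that enters both diagrams changes neither "row or not column" nor
"column or not row". These two sets of cells, rather than monotonicity of the letters, are the
invariants, because intermediate words need not be increasing: `u = (1, 3)`, `l = (1, 2)` is moved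
to `u = (3, 3)`, `l = (2, 3)`. -/
theorem Reachable.move {m k : ℕ} {w v : Column} (hv : Reachable m k w v) {a b i : ℕ}
    (h : IsPlusOnePair v a b i) :
    Reachable m k w (v.move a b i) ∧
      (freeCells m k (v.move a b i)).card < (freeCells m k v).card := by
  obtain ⟨hb, p, q, p1, q1, hp, hq, h0, hr, hc⟩ := hv.toBounded.move h
  refine ⟨⟨hb, fun x hx y hy => ?_, fun x hx y hy => ?_⟩, Finset.card_lt_card ?_⟩
  · rw [hr x y hx hy, hc x y hx hy, ← hv.row_iff x hx y hy]
    have := h0 x y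
    tauto
  · rw [hr x y hx hy, hc x y hx hy, ← hv.col_iff x hx y hy]
    have := h0 x y
    tauto
  · rw [Finset.ssubset_iff_of_subset]
    · refine ⟨(a, b), ?_, ?_⟩
      · simp only [freeCells, Finset.mem_filter, Finset.mem_product, Finset.mem_range]
        exact ⟨by omega, h0 a b (by omega) (by omega)⟩
      · simp only [freeCells, Finset.mem_filter, Finset.mem_product, Finset.mem_range]
        rintro ⟨h1, h2, -⟩
        exact h2 ((hr a b (by omega) (by omega)).2 (Or.inr (by omega)))
    · intro c
      simp only [freeCells, Finset.mem_filter, Finset.mem_product, Finset.mem_range]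
      rintro ⟨h1, h2, h3⟩
      rw [hr _ _ h1.1 h1.2] at h2
      rw [hc _ _ h1.1 h1.2] at h3
      tauto

theorem lt_of_pairwise {s : List ℕ} (h : s.Pairwise (· < ·)) {a b : ℕ} (hab : a < b)
    (hb : b < s.length) : s.getD a 0 < s.getD b 0 := by
  have := List.pairwise_iff_getElem.1 h a b (by omega) hb hab
  simpa [hb, show a < s.length by omega] using this

theorem pairwise_of_lt {s : List ℕ} (h : ∀ a, a + 1 < s.length → s.getD a 0 < s.getD (a + 1) 0) :
    s.Pairwise (· < ·) := by
  rw [← List.isChain_iff_pairwise, List.isChain_iff_getElem]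
  intro a ha
  have := h a ha
  simpa [ha, show a < s.length by omega] using this

theorem mem_iff_getD {s : List ℕ} {x : ℕ} : x ∈ s ↔ ∃ a < s.length, s.getD a 0 = x := by
  rw [List.mem_iff_getElem]
  constructor
  · rintro ⟨a, ha, rfl⟩
    exact ⟨a, ha, by simp [ha]⟩
  · rintro ⟨a, ha, rfl⟩
    exact ⟨a, ha, by simp [ha]⟩

theorem gap_mono {s : List ℕ} (h : s.Pairwise (· < ·)) {a : ℕ} (d : ℕ)
    (hb : a + d < s.length) : s.getD a 0 + d ≤ s.getD (a + d) 0 := by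
  induction d with
  | zero => simp
  | succ d ih =>
    have := ih (by omega)
    have := lt_of_pairwise h (a := a + d) (b := a + (d + 1)) (by omega) hb
    omega

theorem bounds_of_pairwise {s : List ℕ} {n : ℕ} (h : s.Pairwise (· < ·))
    (hs : ∀ x ∈ s, 1 ≤ x ∧ x ≤ n) {a : ℕ} (ha : a < s.length) :
    a + 1 ≤ s.getD a 0 ∧ s.getD a 0 + s.length ≤ a + n + 1 := by
  have h1 := gap_mono h (a := 0) a (by omega)
  have h2 := gap_mono h (a := a) (s.length - 1 - a) (by omega)
  have h3 := hs (s.getD 0 0) (mem_iff_getD.2 ⟨0, by omega, rfl⟩)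
  have h4 := hs (s.getD (a + (s.length - 1 - a)) 0) (mem_iff_getD.2 ⟨_, by omega, rfl⟩)
  rw [zero_add] at h1
  omega

theorem IsColumn.bounded {n : ℕ} {v : Column} (h : IsColumn n v) :
    Bounded v.u.length v.l.length v := by
  obtain ⟨h1, h2, h3, h4, h5⟩ := h
  refine ⟨rfl, rfl, fun a ha => ?_, fun a ha => ?_, fun a ha => ?_, fun a ha => ?_⟩
  · exact (bounds_of_pairwise h1 h3 ha).1
  · have := (bounds_of_pairwise h1 h3 ha).2
    omega
  · exact (bounds_of_pairwise h2 h4 ha).1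
  · have := (bounds_of_pairwise h2 h4 ha).2
    omega

theorem IsColumn.reachable {n : ℕ} {v : Column} (h : IsColumn n v) :
    Reachable v.u.length v.l.length v v :=
  ⟨h.bounded, fun _ _ _ _ => Iff.rfl, fun _ _ _ _ => Iff.rfl⟩

/-- A free cell `(a, b)` with `a + b` minimal yields the pair: the cells just before it in its row
and in its column are not free, and the two invariant sets force them into the row and the column
diagram. So `u_a` and `l_b` are at least `a + b + 1`, and freeness excludes larger values. -/
theorem Reachable.exists_pair {n : ℕ} {w v : Column} (hw : IsColumn n w)
    (hv : Reachable w.u.length w.l.length w v)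
    (hne : (freeCells w.u.length w.l.length v).Nonempty) : ∃ a b i, IsPlusOnePair v a b i := by
  obtain ⟨⟨a, b⟩, hc, hmin⟩ := Finset.exists_min_image _ (fun c : ℕ × ℕ => c.1 + c.2) hne
  simp only [freeCells, Finset.mem_filter, Finset.mem_product, Finset.mem_range] at hc hmin
  obtain ⟨⟨ha, hb⟩, hr, hl⟩ := hc
  have hS := (hv.row_iff a ha b hb).1 (Or.inr hl)
  have hT := (hv.col_iff a ha b hb).1 (Or.inr hr)
  have e1 : v.u.getD a 0 = a + b + 1 := by
    rcases Nat.eq_zero_or_pos b with rfl | hpos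
    · have := hv.le_u a ha
      simp only [InRow] at hr
      omega
    -- The invariant set "row or not column" can be read off from `w`, where the letters increase;
    -- it is therefore closed under decreasing `b`.
    · have hS' : InRow v a (b - 1) ∨ ¬ InCol v a (b - 1) := by
        rw [hv.row_iff a ha (b - 1) (by omega)]
        rcases hS with h | h
        · left
          simp only [InRow] at h ⊢
          omega
        · right
          have := lt_of_pairwise hw.2.1 (a := b - 1) (b := b) (by omega) hb
          simp only [InCol] at h ⊢
          omega
      have hin : InRow v a (b - 1) := by
        by_contra hcon
        have hcon' : ¬ InCol v a (b - 1) := by tauto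
        have := hmin (a, b - 1) ⟨⟨ha, by simp; omega⟩, hcon, hcon'⟩
        simp at this
        omega
      simp only [InRow] at hr hin
      omega
  have e2 : v.l.getD b 0 = a + b + 1 := by
    rcases Nat.eq_zero_or_pos a with rfl | hpos
    · have := hv.le_l b hb
      simp only [InCol] at hl
      omega
    · have hT' : InCol v (a - 1) b ∨ ¬ InRow v (a - 1) b := by
        rw [hv.col_iff (a - 1) (by omega) b hb]
        rcases hT with h | h
        · left
          simp only [InCol] at h ⊢
          omega
        · right
          have := lt_of_pairwise hw.1 (a := a - 1) (b := a) (by omega) ha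
          simp only [InRow] at h ⊢
          omega
      have hin : InCol v (a - 1) b := by
        by_contra hcon
        have hcon' : ¬ InRow v (a - 1) b := by tauto
        have := hmin (a - 1, b) ⟨⟨by simp; omega, hb⟩, hcon', hcon⟩
        simp at this
        omega
      simp only [InCol] at hl hin
      omega
  exact ⟨a, b, a + b + 1, getElem?_of_getD (by rw [hv.length_u]; exact ha) e1,
    getElem?_of_getD (by rw [hv.length_l]; exact hb) e2, by omega⟩

/-- Without free cells the row diagram of `v` equals the invariant set "row or not column" of the
increasing column `w`, and likewise for the column diagram. Both inherit the monotonicity of the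
diagrams of `w`, so `v` is increasing again. A pair `u_a = l_b = i` has `a + b + 2 ≤ i` because its
cell lies in a diagram. -/
theorem Reachable.isAdmissible {n : ℕ} {w v : Column} (hw : IsColumn n w)
    (hv : Reachable w.u.length w.l.length w v)
    (hne : freeCells w.u.length w.l.length v = ∅) : IsAdmissible n v := by
  have hcell : ∀ a < w.u.length, ∀ b < w.l.length, InRow v a b ∨ InCol v a b := by
    intro a ha b hb
    by_contra hcon
    have : (a, b) ∈ freeCells w.u.length w.l.length v := by
      simp only [freeCells, Finset.mem_filter, Finset.mem_product, Finset.mem_range]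
      exact ⟨⟨ha, hb⟩, by tauto⟩
    simp [hne] at this
  have hlen := hw.2.2.2.2
  have pu : v.u.Pairwise (· < ·) := by
    refine pairwise_of_lt fun a ha => ?_
    rw [hv.length_u] at ha
    have h1 := hv.le_u (a + 1) ha
    have h2 := hv.u_le a (by omega)
    rcases Nat.lt_or_ge (v.u.getD a 0) (a + 2) with h | h
    · omega
    -- The cell `(a, d)` with `d = u_a - a - 2` is the last one in row `a`. Its successor `(a + 1,
    -- d)` lies in the row diagram too, which says `u_{a+1} ≥ a + d + 3 > u_a`.
    · obtain ⟨d, hd⟩ := Nat.exists_eq_add_of_le h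
      have hrow : InRow v a d := by
        simp only [InRow]
        omega
      have h3 := (hv.row_iff a (by omega) d (by omega)).1 (Or.inl hrow)
      have h4 : InRow w (a + 1) d ∨ ¬ InCol w (a + 1) d := by
        rcases h3 with h3 | h3
        · left
          have := lt_of_pairwise hw.1 (a := a) (b := a + 1) (by omega) (by omega)
          simp only [InRow] at h3 ⊢
          omega
        · right
          simp only [InCol] at h3 ⊢
          omega
      have h5 := (hv.row_iff (a + 1) ha d (by omega)).2 h4
      have h6 : InRow v (a + 1) d := by
        have := hcell (a + 1) ha d (by omega)
        tauto
      simp only [InRow] at h6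
      omega
  have pl : v.l.Pairwise (· < ·) := by
    refine pairwise_of_lt fun b hb => ?_
    rw [hv.length_l] at hb
    have h1 := hv.le_l (b + 1) hb
    have h2 := hv.l_le b (by omega)
    rcases Nat.lt_or_ge (v.l.getD b 0) (b + 2) with h | h
    · omega
    · obtain ⟨d, hd⟩ := Nat.exists_eq_add_of_le h
      have hrow : InCol v d b := by
        simp only [InCol]
        omega
      have h3 := (hv.col_iff d (by omega) b (by omega)).1 (Or.inl hrow)
      have h4 : InCol w d (b + 1) ∨ ¬ InRow w d (b + 1) := by
        rcases h3 with h3 | h3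
        · left
          have := lt_of_pairwise hw.2.1 (a := b) (b := b + 1) (by omega) (by omega)
          simp only [InCol] at h3 ⊢
          omega
        · right
          simp only [InRow] at h3 ⊢
          omega
      have h5 := (hv.col_iff d (by omega) (b + 1) hb).2 h4
      have h6 : InCol v d (b + 1) := by
        have := hcell d (by omega) (b + 1) hb
        tauto
      simp only [InCol] at h6
      omega
  refine ⟨⟨pu, pl, ?_, ?_, by rw [hv.length_u, hv.length_l, hlen]⟩, ?_⟩
  · intro x hx
    obtain ⟨a, ha, rfl⟩ := mem_iff_getD.1 hx
    rw [hv.length_u] at ha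
    have h1 := hv.le_u a ha
    have h2 := hv.u_le a ha
    omega
  · intro x hx
    obtain ⟨a, ha, rfl⟩ := mem_iff_getD.1 hx
    rw [hv.length_l] at ha
    have h1 := hv.le_l a ha
    have h2 := hv.l_le a ha
    omega
  · intro a b i h1 h2
    obtain ⟨h3, h4⟩ := getD_of_getElem? h1
    obtain ⟨h5, h6⟩ := getD_of_getElem? h2
    rw [hv.length_u] at h3
    rw [hv.length_l] at h5
    have := hcell a h3 b h5
    simp only [InRow, InCol] at this
    omega

theorem TauStep.unique {v w w' : Column} (h : TauStep v w) (h' : TauStep v w') : w = w' := by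
  obtain ⟨a, b, i, h1, h2, rfl⟩ := h
  obtain ⟨a', b', i', h1', h2', rfl⟩ := h'
  have e1 := h2 a' b' i' h1'
  have e2 := h2' a b i h1
  have e3 := h1.2.2
  have e4 := h1'.2.2
  obtain rfl : i = i' := by omega
  obtain rfl : a = a' := by omega
  obtain rfl : b = b' := by omega
  rfl

theorem exists_tauStep {v : Column} (h : ∃ a b i, IsPlusOnePair v a b i) :
    ∃ w a b i, IsPlusOnePair v a b i ∧ w = v.move a b i ∧ TauStep v w := by
  classical
  have h' : ∃ i a b, IsPlusOnePair v a b i := by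
    obtain ⟨a, b, i, h⟩ := h
    exact ⟨i, a, b, h⟩
  set i := Nat.find h' with hi
  obtain ⟨a, b, hab⟩ := Nat.find_spec h'
  have hle : ∀ a, (∃ b, IsPlusOnePair v a b i) → a ≤ i := by
    rintro a ⟨b, -, -, h⟩
    omega
  set a₀ := Nat.findGreatest (fun a => ∃ b, IsPlusOnePair v a b i) i
  obtain ⟨b₀, hb₀⟩ : ∃ b, IsPlusOnePair v a₀ b i :=
    Nat.findGreatest_spec (P := fun a => ∃ b, IsPlusOnePair v a b i) (hle a ⟨b, hab⟩) ⟨b, hab⟩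
  refine ⟨_, a₀, b₀, i, hb₀, rfl, a₀, b₀, i, hb₀, ?_, rfl⟩
  intro a' b' i' hp
  rcases lt_or_eq_of_le (Nat.find_min' h' ⟨a', b', hp⟩) with h | h
  · exact Or.inl h
  · right
    refine ⟨h, ?_⟩
    rw [← h] at hp
    exact Nat.le_findGreatest (hle a' ⟨b', hp⟩) ⟨b', hp⟩

theorem IsAdmissible.not_isPlusOnePair {n : ℕ} {v : Column} (hv : IsAdmissible n v) (a b i : ℕ) :
    ¬ IsPlusOnePair v a b i := by
  rintro ⟨h1, h2, h3⟩
  have := hv.2 a b i h1 h2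
  omega

theorem IsAdmissible.not_tauStep {n : ℕ} {v w : Column} (hv : IsAdmissible n v) :
    ¬ TauStep v w := by
  rintro ⟨a, b, i, h, -⟩
  exact hv.not_isPlusOnePair a b i h

/-- Descent on the number of free cells, which bounds the number of remaining moves. -/
theorem Reachable.exists_rect {n : ℕ} {w : Column} (hw : IsColumn n w) (N : ℕ) :
    ∀ v, Reachable w.u.length w.l.length w v →
      (freeCells w.u.length w.l.length v).card ≤ N → ∃ b : AdmissibleColumn n, IsRect v b := by
  induction N with
  | zero =>
    intro v hv h
    exact ⟨⟨v, hv.isAdmissible hw (by simpa using h)⟩, Relation.ReflTransGen.refl⟩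
  | succ N ih =>
    intro v hv h
    rcases Finset.eq_empty_or_nonempty (freeCells w.u.length w.l.length v) with h0 | h0
    · exact ⟨⟨v, hv.isAdmissible hw h0⟩, Relation.ReflTransGen.refl⟩
    · obtain ⟨x, a, b, i, hp, rfl, hstep⟩ := exists_tauStep (hv.exists_pair hw h0)
      obtain ⟨h1, h2⟩ := hv.move hp
      obtain ⟨b, hb⟩ := ih _ h1 (by omega)
      exact ⟨b, Relation.ReflTransGen.head hstep hb⟩

theorem IsRect.unique {n : ℕ} {v : Column} {b b' : AdmissibleColumn n} (h : IsRect v b)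
    (h' : IsRect v b') : b = b' := by
  unfold IsRect at h
  induction h using Relation.ReflTransGen.head_induction_on with
  | refl =>
    rcases Relation.ReflTransGen.cases_head h' with h | ⟨c, h, -⟩
    · exact Subtype.ext h
    · exact (b.2.not_tauStep h).elim
  | head hs _ ih =>
    rcases Relation.ReflTransGen.cases_head h' with h | ⟨c, h, hc⟩
    · subst h
      exact (b'.2.not_tauStep hs).elim
    · rw [← hs.unique h] at hc
      exact ih hc

/-- Every column has a well-defined rectification. -/
theorem existsUnique_isRect {n : ℕ} {v : Column} (hv : IsColumn n v) :
    ∃! b : AdmissibleColumn n, IsRect v b := by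
  obtain ⟨b, hb⟩ := Reachable.exists_rect hv _ v hv.reachable le_rfl
  exact ⟨b, hb, fun b' hb' => hb'.unique hb⟩

/-- The lengths of both halves of a column are invariant under rectification. -/
theorem IsRect.length_eq {n : ℕ} {v : Column} (hv : IsColumn n v) {b : AdmissibleColumn n}
    (h : IsRect v b) : b.val.u.length = v.u.length ∧ b.val.l.length = v.l.length := by
  have : ∀ w, Relation.ReflTransGen TauStep v w → Reachable v.u.length v.l.length v w := by
    intro w hw
    induction hw with
    | refl => exact hv.reachable
    | tail _ hs ih =>
      obtain ⟨a, b, i, hp, -, rfl⟩ := hs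
      exact (ih.move hp).1
  exact ⟨(this _ h).length_u, (this _ h).length_l⟩

/-! ### The monomial of a column -/

/-- The variable `Y_{m,x}` for `1 ≤ x ≤ n`, and `1` for all other `x`. -/
noncomputable def varY (n : ℕ) (m : ℤ) (x : ℕ) : LaurentMonomial n :=
  if h : 1 ≤ x ∧ x ≤ n then monoVar n m ⟨x - 1, by omega⟩ else 0

/-- The monomial of the letter `x` at position `a`. -/
noncomputable def boxPos (n : ℕ) (a : ℤ) (x : ℕ) : LaurentMonomial n :=
  varY n (n - a) x - varY n (n + 1 - a) (x - 1)

/-- The monomial of the barred letter `x` at position `b` from the end. -/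
noncomputable def boxNeg (n : ℕ) (b : ℤ) (x : ℕ) : LaurentMonomial n :=
  varY n (n - x + b) (x - 1) - varY n (n - x + b) x

/-- The sum of `f a x` over the letters `x` of a list with positions `a` counted from `a₀`. -/
def posSum {M : Type*} [AddCommGroup M] (f : ℤ → ℕ → M) (a₀ : ℤ) : List ℕ → M
  | [] => 0
  | x :: s => f a₀ x + posSum f (a₀ + 1) s

theorem posSum_append {M : Type*} [AddCommGroup M] (f : ℤ → ℕ → M) (a₀ : ℤ) (s t : List ℕ) :
    posSum f a₀ (s ++ t) = posSum f a₀ s + posSum f (a₀ + s.length) t := by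
  induction s generalizing a₀ with
  | nil => simp [posSum]
  | cons x s ih =>
    simp only [List.cons_append, posSum, ih, List.length_cons]
    rw [show a₀ + 1 + (s.length : ℤ) = a₀ + ((s.length + 1 : ℕ) : ℤ) by push_cast; ring, add_assoc]

theorem posSum_range' {M : Type*} [AddCommGroup M] (f : ℤ → ℕ → M) (a₀ : ℤ) (x p : ℕ) :
    posSum f a₀ (List.range' x p) = ∑ t ∈ Finset.range p, f (a₀ + t) (x + t) := by
  induction p generalizing a₀ x with
  | zero => simp [posSum]
  | succ p ih =>
    rw [List.range'_succ, posSum, ih, Finset.sum_range_succ', add_comm]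
    congr 1
    · refine Finset.sum_congr rfl fun t _ => ?_
      congr 1
      · push_cast
        ring
      · ring
    · simp

theorem posSum_replaceRun {M : Type*} [AddCommGroup M] (f : ℤ → ℕ → M) (a₀ : ℤ) {s : List ℕ}
    {a p i : ℕ} (q : ℕ) (h : a + p ≤ s.length) (hs : replaceRun s a p i = s) :
    posSum f a₀ (replaceRun s a p (i + q)) = posSum f a₀ s +
      ∑ t ∈ Finset.range p, (f (a₀ + a + t) (i + t + q) - f (a₀ + a + t) (i + t)) := by
  conv_rhs => rw [← hs]
  have hl : min a s.length = a := by omega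
  simp only [replaceRun, posSum_append, posSum_range', List.length_append, List.length_take,
    List.length_range', hl, Finset.sum_sub_distrib]
  have : ∀ t, i + q + t = i + t + q := fun t => by ring
  simp only [this]
  abel

/-- The monomial `Y_{m,x} Y_{m+1,x} Y_{m+1,x-1}⁻¹ Y_{m,x+1}⁻¹`. -/
noncomputable def varA (n : ℕ) (m : ℤ) (x : ℕ) : LaurentMonomial n :=
  varY n m x + varY n (m + 1) x - varY n (m + 1) (x - 1) - varY n m (x + 1)

/-- The boxes are chosen so that lowering in the crystal divides by the same kind of factor for both
sorts of letters: `x ↦ x + 1` for unbarred ones here, `\overline{x+1} ↦ \bar x` for barred ones in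
`boxNeg_succ`. For `x < n` the factor is the monomial `A_{m,x}`. -/
theorem boxPos_succ (n : ℕ) (a : ℤ) (x : ℕ) :
    boxPos n a (x + 1) = boxPos n a x - varA n (n - a) x := by
  simp only [boxPos, varA, Nat.add_sub_cancel]
  rw [show (n : ℤ) - a + 1 = n + 1 - a by ring]
  abel

theorem boxNeg_succ (n : ℕ) (b : ℤ) (x : ℕ) :
    boxNeg n b (x + 1) = boxNeg n b x + varA n (n - x + b - 1) x := by
  simp only [boxNeg, varA, Nat.add_sub_cancel, Nat.cast_add, Nat.cast_one]
  rw [show (n : ℤ) - x + b - 1 + 1 = n - x + b by ring,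
    show (n : ℤ) - (x + 1) + b = n - x + b - 1 by ring]
  abel

theorem boxPos_add (n : ℕ) (a : ℤ) (x q : ℕ) :
    boxPos n a (x + q) - boxPos n a x = - ∑ s ∈ Finset.range q, varA n (n - a) (x + s) := by
  induction q with
  | zero => simp
  | succ q ih =>
    rw [← add_assoc, boxPos_succ, Finset.sum_range_succ, neg_add, ← ih]
    abel

theorem boxNeg_add (n : ℕ) (b : ℤ) (x q : ℕ) :
    boxNeg n b (x + q) - boxNeg n b x =
      ∑ s ∈ Finset.range q, varA n (n - (x + s) + b - 1) (x + s) := by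
  induction q with
  | zero => simp
  | succ q ih =>
    rw [← add_assoc, boxNeg_succ, Finset.sum_range_succ, ← ih]
    push_cast
    abel

/-- The monomial of a column. -/
noncomputable def colMono (n : ℕ) (v : Column) : LaurentMonomial n :=
  posSum (boxPos n) 1 v.u + posSum (boxNeg n) 1 v.l

/-- Both changes are sums of `varA` over the cells of the added rectangle. The unbarred letters
contribute each cell with a minus sign, the barred ones with a plus sign. -/
theorem colMono_move (n : ℕ) {v : Column} {a b i : ℕ} (h : IsPlusOnePair v a b i) :
    colMono n (v.move a b i) = colMono n v := by
  obtain ⟨hu, hl, hi⟩ := h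
  obtain ⟨-, p2, p3⟩ := run_of_getElem? hu
  obtain ⟨-, q2, q3⟩ := run_of_getElem? hl
  rw [Column.move_eq, colMono, colMono, posSum_replaceRun _ _ _ p2 p3,
    posSum_replaceRun _ _ _ q2 q3]
  simp only [boxPos_add, boxNeg_add, Finset.sum_neg_distrib]
  rw [Finset.sum_comm (s := Finset.range (runLength (v.l.drop b)))]
  -- The superscripts agree precisely because the pair is in `(+1)`-configuration, `i = a + b + 1`
  -- with positions from `0`.
  have key : ∀ t s : ℕ, varA n (n - ((i + s : ℕ) + t) + (1 + b + s) - 1) (i + s + t) =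
      varA n (n - (1 + a + t)) (i + t + s) := by
    intro t s
    congr 1
    · have : (i : ℤ) = a + b + 1 := by omega
      push_cast
      rw [this]
      ring
    · ring
  simp only [key]
  abel

theorem IsRect.colMono_eq {n : ℕ} {v : Column} {b : AdmissibleColumn n} (h : IsRect v b) :
    colMono n b.val = colMono n v := by
  obtain ⟨w, hw⟩ := b
  change Relation.ReflTransGen TauStep v w at h
  change colMono n w = _
  clear hw
  induction h with
  | refl => rfl
  | tail _ hs ih =>
    obtain ⟨a, b, i, hp, -, rfl⟩ := hs
    rw [colMono_move n hp, ih]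

/-! ### Multiplicities and the sum over all columns -/

theorem IsColumn.u_eq_of_l_nil {n : ℕ} {v : Column} (hv : IsColumn n v) (h : v.l = []) :
    v.u = List.range' 1 n := by
  obtain ⟨h1, -, h3, -, h5⟩ := hv
  rw [h, List.length_nil, add_zero] at h5
  refine List.ext_getElem (by simp [h5]) fun a ha _ => ?_
  have := bounds_of_pairwise h1 h3 ha
  simp only [List.getD_eq_getElem?_getD, List.getElem?_eq_getElem ha, Option.getD_some] at this
  rw [List.getElem_range']
  omega

theorem eq_highestColumn_iff {n : ℕ} (b : AdmissibleColumn n) :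
    b = highestColumn n ↔ b.val.l = [] := by
  refine ⟨fun h => by rw [h]; rfl, fun h => Subtype.ext (Column.ext ?_ ?_)⟩
  · rw [b.2.1.u_eq_of_l_nil h]
    rfl
  · rw [h]
    rfl

/-- The set of all columns of length `n`. -/
noncomputable def columns (n : ℕ) : Finset Column := (finite_isColumn n).toFinset

theorem mem_columns {n : ℕ} {v : Column} : v ∈ columns n ↔ IsColumn n v := by
  simp [columns]

open Classical in
/-- Summing over `B(Λ_n)` with multiplicities is summing over all columns. -/
theorem sum_rectMultiplicity (n : ℕ) (F : LaurentMonomial n → ℂ) :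
    ∑ b ∈ Finset.univ.erase (highestColumn n), (rectMultiplicity b : ℂ) * F (colMono n b.val) =
      ∑ v ∈ (columns n).filter (fun v => v.l ≠ []), F (colMono n v) := by
  -- The rectification map; its value on words outside `𝓑` is arbitrary.
  let g : Column → AdmissibleColumn n := fun v =>
    if h : IsColumn n v then (existsUnique_isRect h).choose else highestColumn n
  have hg : ∀ v, IsColumn n v → ∀ b, g v = b ↔ IsRect v b := by
    intro v hv b
    have h1 : IsRect v (g v) := by
      simp only [g, dif_pos hv]
      exact (existsUnique_isRect hv).choose_spec.1
    exact ⟨fun h => h ▸ h1, fun h => h1.unique h⟩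
  have hmaps : ∀ v ∈ (columns n).filter (fun v => v.l ≠ []),
      g v ∈ Finset.univ.erase (highestColumn n) := by
    intro v hv
    obtain ⟨hv, hl⟩ := Finset.mem_filter.1 hv
    rw [mem_columns] at hv
    rw [Finset.mem_erase]
    -- Rectification keeps the number of barred letters, so only the column without barred letters
    -- lies over the highest weight vector.
    refine ⟨fun h => hl ?_, Finset.mem_univ _⟩
    have := ((hg v hv _).1 rfl).length_eq hv
    rw [(eq_highestColumn_iff _).1 h] at this
    exact List.length_eq_zero_iff.1 this.2.symm
  rw [← Finset.sum_fiberwise_of_maps_to hmaps]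
  refine Finset.sum_congr rfl fun b hb => ?_
  have hfil : ((columns n).filter (fun v => v.l ≠ [])).filter (fun v => g v = b) =
      (columns n).filter (fun v => IsRect v b) := by
    ext v
    simp only [Finset.mem_filter, mem_columns]
    constructor
    · rintro ⟨⟨h1, -⟩, h2⟩
      exact ⟨h1, (hg v h1 b).1 h2⟩
    · rintro ⟨h1, h2⟩
      refine ⟨⟨h1, fun h => Finset.ne_of_mem_erase hb ?_⟩, (hg v h1 b).2 h2⟩
      rw [eq_highestColumn_iff, ← List.length_eq_zero_iff, (h2.length_eq h1).2, h]
      rfl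
  have hcard : rectMultiplicity b = ((columns n).filter (fun v => IsRect v b)).card := by
    rw [rectMultiplicity, ← Set.ncard_coe_finset]
    congr 1
    ext v
    simp [mem_columns]
  rw [hfil, hcard, Finset.sum_congr rfl
    (g := fun _ => F (colMono n b.val)), Finset.sum_const, nsmul_eq_mul]
  intro v hv
  rw [((Finset.mem_filter.1 hv).2).colMono_eq]

/-! ### Local structure of words with respect to one color -/

/-- `N` can be inserted on the left of any word without effect on the crystal structure of
color `r`. -/
structure Neutral (n r : ℕ) (N : List Letter) : Prop where
  eps : ∀ w, wordEps n r (N ++ w) = wordEps n r w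
  phi : ∀ w, wordPhi n r (N ++ w) = wordPhi n r w
  f : ∀ w, wordF n r (N ++ w) = (wordF n r w).map (N ++ ·)
  e : ∀ w, wordE n r (N ++ w) = (wordE n r w).map (N ++ ·)
  wt : wordWt r N = 0

theorem wordE_eq_none {n r : ℕ} {w : List Letter} (h : wordEps n r w = 0) :
    wordE n r w = none := by
  cases w with
  | nil => rfl
  | cons x w =>
    simp only [wordEps, Nat.add_eq_zero_iff, letterEps, ite_eq_right_iff, one_ne_zero,
      imp_false, Bool.not_eq_true, Option.isSome_eq_false_iff, Option.isNone_iff_eq_none] at h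
    have h2 : wordEps n r w ≤ letterPhi n r x := by omega
    simp [wordE, h.1, h2]

theorem wordWt_append (r : ℕ) (w w' : List Letter) :
    wordWt r (w ++ w') = wordWt r w + wordWt r w' := by
  simp [wordWt]

theorem Neutral.nil (n r : ℕ) : Neutral n r [] :=
  ⟨by simp, by simp, by simp, by simp, by simp [wordWt]⟩

theorem Neutral.append {n r : ℕ} {N N' : List Letter} (h : Neutral n r N)
    (h' : Neutral n r N') : Neutral n r (N ++ N') := by
  refine ⟨fun w => ?_, fun w => ?_, fun w => ?_, fun w => ?_, ?_⟩
  · rw [List.append_assoc, h.eps, h'.eps]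
  · rw [List.append_assoc, h.phi, h'.phi]
  · rw [List.append_assoc, h.f, h'.f, Option.map_map]
    congr 1
    funext x
    simp
  · rw [List.append_assoc, h.e, h'.e, Option.map_map]
    congr 1
    funext x
    simp
  · rw [wordWt_append, h.wt, h'.wt, add_zero]

theorem Neutral.singleton {n r : ℕ} {x : Letter} (hf : letterF n r x = none)
    (he : letterE n r x = none) (hw : letterWt r x = 0) : Neutral n r [x] := by
  have h1 : letterPhi n r x = 0 := by simp [letterPhi, hf]
  have h2 : letterEps n r x = 0 := by simp [letterEps, he]
  refine ⟨fun w => ?_, fun w => ?_, fun w => ?_, fun w => ?_, by simp [wordWt, hw]⟩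
  · simp [wordEps, h1, h2]
  · simp [wordPhi, h1]
  · simp [wordF, h1]
  · by_cases h : wordEps n r w = 0
    · simp [wordE, h, he, wordE_eq_none h]
    · simp [wordE, h, h1]

theorem Neutral.of_forall {n r : ℕ} {N : List Letter} (h : ∀ x ∈ N, Neutral n r [x]) :
    Neutral n r N := by
  induction N with
  | nil => exact Neutral.nil n r
  | cons x N ih =>
    exact (h x (by simp)).append (ih fun y hy => h y (by simp [hy]))

/-- Signature rule: `φ(x) = 1` absorbs `ε(y) = 1`, and nothing remains to interact with the letters
further to the right. -/
theorem Neutral.pair {n r : ℕ} {x y x' y' : Letter} (hx : letterF n r x = some x')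
    (hx' : letterE n r x = none) (hy : letterE n r y = some y') (hy' : letterF n r y = none)
    (hw : letterWt r x + letterWt r y = 0) : Neutral n r [x, y] := by
  have h1 : letterPhi n r x = 1 := by simp [letterPhi, hx]
  have h2 : letterEps n r x = 0 := by simp [letterEps, hx']
  have h3 : letterPhi n r y = 0 := by simp [letterPhi, hy']
  have h4 : letterEps n r y = 1 := by simp [letterEps, hy]
  refine ⟨fun w => ?_, fun w => ?_, fun w => ?_, fun w => ?_, by simpa [wordWt] using hw⟩
  · simp [wordEps, h1, h2, h3, h4]
  · simp [wordPhi, wordEps, h1, h3, h4]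
  · simp [wordF, wordEps, h1, h3, h4]
    rfl
  · by_cases h : wordEps n r w = 0
    · simp [wordE, wordEps, h, h1, h3, h4, hx', wordE_eq_none h]
    · simp [wordE, wordEps, h, h1, h3, h4]
      rfl

/-- The types of words of length at most one in a crystal of type `A_1`. -/
inductive Kind where
  | zero
  | plus
  | minus
deriving DecidableEq

/-- The weight of a kind. -/
def Kind.val : Kind → ℤ
  | .zero => 0
  | .plus => 1
  | .minus => -1

/-- `φ` of a tensor product. -/
def Kind.phi : Kind → Kind → ℕ
  | .plus, .plus => 2
  | .plus, .zero => 1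
  | _, .plus => 1
  | _, _ => 0

/-- `ε` of a tensor product. -/
def Kind.eps : Kind → Kind → ℕ
  | .minus, .minus => 2
  | .zero, .minus => 1
  | .minus, _ => 1
  | _, _ => 0

/-- `X` is a word of kind `k`, and `f̃_r X = XF` if `k` is `plus`, `ẽ_r X = XE` if `k` is
`minus`. -/
def HasKind (n r : ℕ) (X XF XE : List Letter) : Kind → Prop
  | .zero => Neutral n r X
  | .plus => ∃ x y, X = [x] ∧ XF = [y] ∧ letterF n r x = some y ∧ letterE n r x = none ∧
      letterWt r x = 1
  | .minus => ∃ x y, X = [x] ∧ XE = [y] ∧ letterE n r x = some y ∧ letterF n r x = none ∧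
      letterWt r x = -1

set_option linter.unusedSimpArgs false in
/-- The crystal structure of color `r` on a word consisting of neutral words and two words of
given kinds. -/
theorem word_table {n r : ℕ} {A X XF XE B X' XF' XE' C : List Letter} {k k' : Kind}
    (hA : Neutral n r A) (hB : Neutral n r B) (hC : Neutral n r C)
    (hX : HasKind n r X XF XE k) (hX' : HasKind n r X' XF' XE' k') :
    wordEps n r (A ++ (X ++ (B ++ (X' ++ C)))) = Kind.eps k k' ∧
    wordPhi n r (A ++ (X ++ (B ++ (X' ++ C)))) = Kind.phi k k' ∧
    wordWt r (A ++ (X ++ (B ++ (X' ++ C)))) = k.val + k'.val ∧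
    wordF n r (A ++ (X ++ (B ++ (X' ++ C)))) =
      (if Kind.phi k k' = 0 then none else
        some (if k = .plus then A ++ (XF ++ (B ++ (X' ++ C)))
          else A ++ (X ++ (B ++ (XF' ++ C))))) ∧
    wordE n r (A ++ (X ++ (B ++ (X' ++ C)))) =
      (if Kind.eps k k' = 0 then none else
        some (if k' = .minus then A ++ (X ++ (B ++ (XE' ++ C)))
          else A ++ (XE ++ (B ++ (X' ++ C))))) := by
  have c1 : wordEps n r C = 0 := by simpa [wordEps] using hC.eps []
  have c2 : wordPhi n r C = 0 := by simpa [wordPhi] using hC.phi []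
  have c3 : wordF n r C = none := by simpa [wordF] using hC.f []
  have c4 : wordE n r C = none := by simpa [wordE] using hC.e []
  have c5 := hC.wt
  have w1 := hA.wt
  have w2 := hB.wt
  have w3 : ∀ x w, wordWt r (x :: w) = letterWt r x + wordWt r w := by simp [wordWt]
  rw [hA.eps, hA.phi, hA.f, hA.e]
  simp only [wordWt_append, c5, w1, w2, add_zero, zero_add]
  cases k <;> cases k' <;> simp only [HasKind] at hX hX'
  case zero.zero =>
    simp [hX.eps, hB.eps, hX'.eps, hX.phi, hB.phi, hX'.phi, hX.f, hB.f, hX'.f, hX.e, hB.e,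
      hX'.e, hX.wt, hX'.wt, c1, c2, c3, c4, Kind.val, Kind.phi, Kind.eps]
  case zero.plus =>
    obtain ⟨x, y, rfl, rfl, h1, h2, h3⟩ := hX'
    simp [hX.eps, hB.eps, hX.phi, hB.phi, hX.f, hB.f, hX.e, hB.e,
      hX.wt, w3, wordEps, wordPhi, wordF, wordE, letterEps, letterPhi,
      h1, h2, h3, c1, c2, Kind.val, Kind.phi, Kind.eps]
    simp [wordWt]
  case zero.minus =>
    obtain ⟨x, y, rfl, rfl, h1, h2, h3⟩ := hX'
    simp [hX.eps, hB.eps, hX.phi, hB.phi, hX.f, hB.f, hX.e, hB.e,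
      hX.wt, w3, wordEps, wordPhi, wordF, wordE, letterEps, letterPhi,
      h1, h2, h3, c1, c2, c3, Kind.val, Kind.phi, Kind.eps]
    simp [wordWt]
  case plus.zero =>
    obtain ⟨x, y, rfl, rfl, h1, h2, h3⟩ := hX
    simp [hX'.eps, hB.eps, hX'.phi, hB.phi, hX'.f, hB.f, hX'.e, hB.e,
      hX'.wt, w3, wordEps, wordPhi, wordF, wordE, letterEps, letterPhi,
      h1, h2, h3, c1, c2, Kind.val, Kind.phi, Kind.eps]
    simp [wordWt]
  case minus.zero =>
    obtain ⟨x, y, rfl, rfl, h1, h2, h3⟩ := hX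
    simp [hX'.eps, hB.eps, hX'.phi, hB.phi, hX'.f, hB.f, hX'.e, hB.e,
      hX'.wt, w3, wordEps, wordPhi, wordF, wordE, letterEps, letterPhi,
      h1, h2, h3, c1, c2, c3, Kind.val, Kind.phi, Kind.eps]
    simp [wordWt]
  all_goals
    obtain ⟨x, y, rfl, rfl, h1, h2, h3⟩ := hX
    obtain ⟨x', y', rfl, rfl, h1', h2', h3'⟩ := hX'
    simp [hB.eps, hB.phi, hB.f, hB.e,
      w3, wordEps, wordPhi, wordF, wordE, letterEps, letterPhi,
      h1, h2, h3, h1', h2', h3', c1, c2, c3, Kind.val, Kind.phi, Kind.eps]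
    try simp [wordWt]

/-! ### Local structure of monomials with respect to one color -/

/-- The partial sum `∑_{k ≤ m} l_{k,i}` as a homomorphism. -/
noncomputable def partialHom {n : ℕ} (i : Fin n) (m : ℤ) : LaurentMonomial n →+ ℤ :=
  Finsupp.liftAddHom fun q => if q.2 = i ∧ q.1 ≤ m then AddMonoidHom.id ℤ else 0

/-- The weight as a homomorphism. -/
noncomputable def wtHom {n : ℕ} (i : Fin n) : LaurentMonomial n →+ ℤ :=
  Finsupp.liftAddHom fun q => if q.2 = i then AddMonoidHom.id ℤ else 0

theorem partialHom_apply {n : ℕ} (i : Fin n) (m : ℤ) (Y : LaurentMonomial n) :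
    partialHom i m Y = partialSum Y i m := by
  rw [partialHom, Finsupp.liftAddHom_apply, partialSum, Finset.sum_filter, Finsupp.sum]
  refine Finset.sum_congr rfl fun q _ => ?_
  split_ifs <;> simp

theorem wtHom_apply {n : ℕ} (i : Fin n) (Y : LaurentMonomial n) : wtHom i Y = monoWt Y i := by
  rw [wtHom, Finsupp.liftAddHom_apply, monoWt, Finset.sum_filter, Finsupp.sum]
  refine Finset.sum_congr rfl fun q _ => ?_
  split_ifs <;> simp

theorem partialHom_varY {n : ℕ} (i : Fin n) (m m' : ℤ) (x : ℕ) :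
    partialHom i m (varY n m' x) = if x = i.val + 1 ∧ m' ≤ m then 1 else 0 := by
  unfold varY
  split_ifs with h1 h2 h2
  · have : (⟨x - 1, by omega⟩ : Fin n) = i := Fin.ext (by simp [h2.1])
    simp [partialHom, monoVar, h2.2, this]
  · have : ¬ ((⟨x - 1, by omega⟩ : Fin n) = i ∧ m' ≤ m) := by
      rintro ⟨rfl, h⟩
      exact h2 ⟨by simp only; omega, h⟩
    simp [partialHom, monoVar, this]
  · exact absurd ⟨by omega, by omega⟩ h1
  · simp

theorem wtHom_varY {n : ℕ} (i : Fin n) (m' : ℤ) (x : ℕ) :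
    wtHom i (varY n m' x) = if x = i.val + 1 then 1 else 0 := by
  unfold varY
  split_ifs with h1 h2 h2
  · have : (⟨x - 1, by omega⟩ : Fin n) = i := Fin.ext (by simp [h2])
    simp [wtHom, monoVar, this]
  · have : ¬ (⟨x - 1, by omega⟩ : Fin n) = i := by
      rintro rfl
      exact h2 (by simp only; omega)
    simp [wtHom, monoVar, this]
  · exact absurd ⟨by omega, by omega⟩ h1
  · simp

/-- The contribution of one letter to the partial sums. -/
def Kind.step : Kind → ℤ → ℤ → ℤ
  | .zero, _, _ => 0
  | .plus, x, m => if x ≤ m then 1 else 0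
  | .minus, x, m => if x + 1 ≤ m then -1 else 0

/-- In color `i` the partial sums form a step function with at most two jumps: a letter of kind
`plus` at `x` jumps up at `x`, one of kind `minus` jumps down at `x + 1`. The step of the second
letter comes first, since `y ≤ x`. For `plus`, `minus` the strict inequality makes the downward
jump, at `y + 1`, happen no later than the upward one; otherwise the maximum would be `1` and the
cancellation of the pair in the word would have no counterpart. -/
theorem mono_table {n : ℕ} {Y : LaurentMonomial n} {i : Fin n} {k k' : Kind} {x y : ℤ}
    (hS : ∀ m, partialSum Y i m = k.step x m + k'.step y m)
    (hw : monoWt Y i = k.val + k'.val) (hxy : y ≤ x)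
    (hpm : k = .plus → k' = .minus → y + 1 ≤ x) :
    monoPhi i Y = Kind.phi k k' ∧ monoEps i Y = Kind.eps k k' ∧
      (Kind.phi k k' ≠ 0 → monoNf i Y = if k = .plus then x else y) ∧
      (Kind.eps k k' ≠ 0 → monoNe i Y = if k' = .minus then y else x) := by
  have hphi : monoPhi i Y = Kind.phi k k' := by
    -- The maximum is attained at the last upward jump; without one it is `0`, attained at `y - 1`,
    -- to the left of all jumps.
    refine IsGreatest.csSup_eq ⟨⟨if k = .plus then x else if k' = .plus then y else y - 1, ?_⟩, ?_⟩
    · rw [hS]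
      cases k <;> cases k' <;> simp [Kind.step, Kind.phi, hxy] <;> simp at hpm <;> omega
    · rintro _ ⟨m, rfl⟩
      rw [hS]
      cases k <;> cases k' <;> simp [Kind.step, Kind.phi] <;> simp at hpm <;> grind
  refine ⟨hphi, ?_, fun h => ?_, fun h => ?_⟩
  · rw [monoEps, hphi, hw]
    cases k <;> cases k' <;> simp [Kind.phi, Kind.eps, Kind.val]
  · refine IsLeast.csInf_eq ⟨?_, ?_⟩
    · rw [Set.mem_ofPred_eq, hphi, hS]
      cases k <;> cases k' <;> simp [Kind.step, Kind.phi, hxy] at h hpm ⊢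
    · intro m hm
      rw [Set.mem_ofPred_eq, hphi, hS] at hm
      cases k <;> cases k' <;> simp [Kind.step, Kind.phi] at h hm hpm ⊢ <;> grind
  · refine IsGreatest.csSup_eq ⟨?_, ?_⟩
    · rw [Set.mem_ofPred_eq, hphi, hS]
      cases k <;> cases k' <;> simp [Kind.step, Kind.phi, Kind.eps, hxy] at h hpm ⊢
    · intro m hm
      rw [Set.mem_ofPred_eq, hphi, hS] at hm
      cases k <;> cases k' <;> simp [Kind.step, Kind.phi, Kind.eps] at h hm hpm ⊢ <;> grind

theorem sum_neighbors {n : ℕ} {M : Type*} [AddCommGroup M] (g : ℕ → M) (i : Fin n) (x : ℕ)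
    (hx : x ≠ i.val) :
    ∑ j ∈ Finset.univ.erase i, (if j.val = x then g j.val else 0) =
      if x < n then g x else 0 := by
  split_ifs with h
  · rw [Finset.sum_eq_single ⟨x, h⟩]
    · simp
    · intro j _ hj
      rw [if_neg fun e => hj (Fin.ext e)]
    · intro hj
      exact absurd (Finset.mem_erase.2 ⟨fun e => hx (by rw [← e]), Finset.mem_univ _⟩) hj
  · refine Finset.sum_eq_zero fun j _ => if_neg fun e => h ?_
    rw [← e]
    exact j.2

theorem varY_succ {n : ℕ} (m : ℤ) (j : Fin n) : varY n m (j.val + 1) = monoVar n m j := by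
  have : 1 ≤ j.val + 1 ∧ j.val + 1 ≤ n := by omega
  simp [varY]

/-- Only the neighbours `j = i ± 1` contribute, with shift `1` for the smaller one and `0` for the
larger one. Missing neighbours at both ends are absorbed by `varY` being trivial outside `1, …, n`.
The exponent `-2` occurs only for the last color. -/
theorem monoA_eq {n : ℕ} (m : ℤ) (i : Fin n) :
    monoA n m i = varY n m (i.val + 1) + varY n (m + 1) (i.val + 1) -
      (if i.val + 1 = n then (2 : ℤ) else 1) • varY n (m + 1) i.val - varY n m (i.val + 2) := by
  have h1 : ∀ j ∈ Finset.univ.erase i, cartan n j i • monoVar n (m + signP n j i) j =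
      - ((if i.val + 1 = n then (2 : ℤ) else 1) •
        if j.val + 1 = i.val then varY n (m + 1) (j.val + 1) else 0) -
      (if j.val = i.val + 1 then varY n m (j.val + 1) else 0) := by
    intro j hj
    have hne : j ≠ i := Finset.ne_of_mem_erase hj
    have hj1 : ¬ j.val = n := by omega
    have hj2 : ¬ n = j.val := by omega
    simp only [cartan, signP, hne, if_false, varY_succ]
    rcases lt_trichotomy j.val i.val with h | h | h
    · have h' : ¬ i.val + 1 = j.val := by omega
      have h'' : ¬ j.val = i.val + 1 := by omega
      have h3 : j < i := h
      by_cases e : j.val + 1 = i.val <;> by_cases e' : i.val + 1 = n <;> simp [h'', h3, e, e', h', hj1, hj2]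
    · exact absurd (Fin.ext h) hne
    · have h' : ¬ j.val + 1 = i.val := by omega
      have h3 : ¬ j < i := by omega
      by_cases e : i.val + 1 = j.val
      · rw [if_neg (fun hc => h' hc.1), if_pos (Or.inr e), if_neg h3, if_neg h', if_pos e.symm]
        simp
      · have : ¬ j.val = i.val + 1 := fun h => e h.symm
        simp [h', h3, e, this]
  rw [monoA, Finset.sum_congr rfl h1, Finset.sum_sub_distrib, Finset.sum_neg_distrib,
    ← Finset.smul_sum, sum_neighbors (fun j => varY n m (j + 1)) i (i.val + 1) (by omega),
    varY_succ, varY_succ]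
  have h2 : ∑ j ∈ Finset.univ.erase i, (if j.val + 1 = i.val then varY n (m + 1) (j.val + 1)
      else 0) = varY n (m + 1) i.val := by
    rcases Nat.eq_zero_or_pos i.val with h | h
    · rw [h]
      simp [varY]
    · have := sum_neighbors (fun j => varY n (m + 1) (j + 1)) i (i.val - 1) (by omega)
      rw [if_pos (by omega), show i.val - 1 + 1 = i.val by omega] at this
      rw [← this]
      refine Finset.sum_congr rfl fun j _ => if_congr (by omega) rfl rfl
  rw [h2]
  have h3 : (if i.val + 1 < n then varY n m (i.val + 1 + 1) else 0) = varY n m (i.val + 2) := by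
    split_ifs with h
    · rfl
    · rw [varY, dif_neg (by omega)]
  rw [h3]
  abel

/-! ### Admissibility in terms of counting functions -/

/-- The number of letters `≤ j`. -/
def cnt (s : List ℕ) (j : ℕ) : ℕ := s.countP (· ≤ j)

theorem cnt_append (s t : List ℕ) (j : ℕ) : cnt (s ++ t) j = cnt s j + cnt t j :=
  List.countP_append

theorem cnt_of_le {s : List ℕ} {j : ℕ} (h : ∀ x ∈ s, x ≤ j) : cnt s j = s.length :=
  List.countP_eq_length.2 (by simpa using h)

theorem cnt_of_lt {s : List ℕ} {j : ℕ} (h : ∀ x ∈ s, j < x) : cnt s j = 0 :=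
  List.countP_eq_zero.2 (by simpa using h)

theorem cnt_cons (x : ℕ) (s : List ℕ) (j : ℕ) :
    cnt (x :: s) j = (if x ≤ j then 1 else 0) + cnt s j := by
  simp only [cnt, List.countP_cons, decide_eq_true_eq]
  omega

theorem cnt_nil (j : ℕ) : cnt [] j = 0 := rfl

theorem cnt_of_getElem? {s : List ℕ} (hs : s.Pairwise (· < ·)) {a i : ℕ} (h : s[a]? = some i) :
    cnt s i = a + 1 := by
  induction s generalizing a with
  | nil => simp at h
  | cons x t ih =>
    rw [List.pairwise_cons] at hs
    rw [cnt_cons]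
    cases a with
    | zero =>
      simp only [List.getElem?_cons_zero, Option.some.injEq] at h
      subst h
      rw [cnt_of_lt hs.1]
      simp
    | succ a =>
      rw [List.getElem?_cons_succ] at h
      rw [ih hs.2 h, if_pos (hs.1 i (List.mem_of_getElem? h)).le]
      omega

theorem cnt_succ {s : List ℕ} (hs : s.Pairwise (· < ·)) (j : ℕ) :
    cnt s (j + 1) = cnt s j + if j + 1 ∈ s then 1 else 0 := by
  induction s with
  | nil => simp [cnt]
  | cons x t ih =>
    rw [List.pairwise_cons] at hs
    rw [cnt_cons, cnt_cons, ih hs.2]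
    by_cases hx : x = j + 1
    · subst hx
      have : j + 1 ∉ t := fun h => (hs.1 _ h).false
      simp [this]
      omega
    · have h1 : (x ≤ j + 1) ↔ (x ≤ j) := by omega
      have h2 : j + 1 ∈ x :: t ↔ j + 1 ∈ t := by simp [Ne.symm hx]
      simp only [h1, h2]
      omega

/-- The count increases by two at `j` only if `j` occurs in both halves, and there `a + b` is the
count itself. At all other `j` it increases by at most one, as does the bound. In this form it is
clear which inequalities a change of a letter affects. -/
theorem isAdmissible_iff {n : ℕ} {v : Column} :
    IsAdmissible n v ↔ IsColumn n v ∧ ∀ j, cnt v.u j + cnt v.l j ≤ j := by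
  refine ⟨fun h => ⟨h.1, fun j => ?_⟩, fun h => ⟨h.1, fun a b i h1 h2 => ?_⟩⟩
  · obtain ⟨⟨h1, h2, h3, h4, -⟩, h5⟩ := h
    induction j with
    | zero =>
      rw [cnt_of_lt, cnt_of_lt]
      · exact fun x hx => (h4 x hx).1
      · exact fun x hx => (h3 x hx).1
    | succ j ih =>
      by_cases hu : j + 1 ∈ v.u
      · by_cases hl : j + 1 ∈ v.l
        · obtain ⟨a, ha⟩ := List.mem_iff_getElem?.1 hu
          obtain ⟨b, hb⟩ := List.mem_iff_getElem?.1 hl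
          rw [cnt_of_getElem? h1 ha, cnt_of_getElem? h2 hb]
          exact h5 a b _ ha hb
        · rw [cnt_succ h1, cnt_succ h2, if_pos hu, if_neg hl]
          omega
      · rw [cnt_succ h1, cnt_succ h2, if_neg hu]
        split_ifs <;> omega
  · have e1 := cnt_of_getElem? h.1.1 h1
    have e2 := cnt_of_getElem? h.1.2.1 h2
    have := h.2 i
    omega

/-! ### Splitting a column at the letters `r`, `r + 1` -/

/-- A splitting of an increasing sequence at the letters `r`, `r + 1`. -/
structure Split (r : ℕ) (s s₁ mid s₂ : List ℕ) : Prop where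
  eq : s = s₁ ++ mid ++ s₂
  lt : ∀ x ∈ s₁, x < r
  gt : ∀ x ∈ s₂, r + 1 < x
  mid : mid = [] ∨ mid = [r] ∨ mid = [r + 1] ∨ mid = [r, r + 1]

theorem exists_split (r : ℕ) {s : List ℕ} (hs : s.Pairwise (· < ·)) :
    ∃ s₁ mid s₂, Split r s s₁ mid s₂ := by
  induction s with
  | nil => exact ⟨[], [], [], by simp, by simp, by simp, by simp⟩
  | cons x t ih =>
    rw [List.pairwise_cons] at hs
    obtain ⟨s₁, mid, s₂, rfl, h1, h2, h3⟩ := ih hs.2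
    by_cases hx : x < r
    · refine ⟨x :: s₁, mid, s₂, by simp, ?_, h2, h3⟩
      intro y hy
      rcases List.mem_cons.1 hy with rfl | hy
      · exact hx
      · exact h1 y hy
    · have e1 : s₁ = [] := by
        rw [List.eq_nil_iff_forall_not_mem]
        intro y hy
        have := h1 y hy
        have := hs.1 y (by simp [hy])
        omega
      subst e1
      by_cases hx1 : x = r
      · subst hx1
        have hr : x ∉ mid := fun h => (hs.1 x (by simp [h])).false
        refine ⟨[], x :: mid, s₂, by simp, by simp, h2, ?_⟩
        rcases h3 with rfl | rfl | rfl | rfl <;> simp at hr ⊢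
      · have e2 : mid = [] := by
          rw [List.eq_nil_iff_forall_not_mem]
          intro y hy
          have h5 := hs.1 y (by simp [hy])
          rcases h3 with rfl | rfl | rfl | rfl <;> simp at hy <;> omega
        subst e2
        by_cases hx2 : x = r + 1
        · subst hx2
          exact ⟨[], [r + 1], s₂, by simp, by simp, h2, by simp⟩
        · refine ⟨[], [], x :: s₂, by simp, by simp, ?_, by simp⟩
          intro y hy
          rcases List.mem_cons.1 hy with rfl | hy
          · omega
          · exact h2 y hy

theorem Split.cnt {r : ℕ} {s s₁ mid s₂ : List ℕ} (h : Split r s s₁ mid s₂) {j : ℕ}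
    (h1 : r ≤ j + 1) (h2 : j ≤ r + 1) : TypeC.cnt s j = s₁.length + TypeC.cnt mid j := by
  rw [h.eq, cnt_append, cnt_append, cnt_of_le, cnt_of_lt (s := s₂), add_zero]
  · intro x hx
    have := h.gt x hx
    omega
  · intro x hx
    have := h.lt x hx
    omega

theorem posSum_eq_zero {M : Type*} [AddCommGroup M] {f : ℤ → ℕ → M} {s : List ℕ}
    (h : ∀ a, ∀ x ∈ s, f a x = 0) (a₀ : ℤ) : posSum f a₀ s = 0 := by
  induction s generalizing a₀ with
  | nil => rfl
  | cons x s ih =>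
    rw [posSum, h _ x (by simp), ih fun a y hy => h a y (by simp [hy]), add_zero]

theorem map_posSum {M N : Type*} [AddCommGroup M] [AddCommGroup N] (g : M →+ N)
    (f : ℤ → ℕ → M) (a₀ : ℤ) (s : List ℕ) :
    g (posSum f a₀ s) = posSum (fun a x => g (f a x)) a₀ s := by
  induction s generalizing a₀ with
  | nil => simp [posSum]
  | cons x s ih => simp [posSum, ih]

theorem Split.posSum {r : ℕ} {s s₁ mid s₂ : List ℕ} (h : Split r s s₁ mid s₂) {M : Type*}
    [AddCommGroup M] {f : ℤ → ℕ → M} (hf : ∀ a x, x ≠ r → x ≠ r + 1 → f a x = 0) (a₀ : ℤ) :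
    TypeC.posSum f a₀ s = TypeC.posSum f (a₀ + s₁.length) mid := by
  rw [h.eq, posSum_append, posSum_append, posSum_eq_zero (s := s₁), posSum_eq_zero (s := s₂),
    zero_add, add_zero]
  · intro a x hx
    have := h.gt x hx
    exact hf a x (by omega) (by omega)
  · intro a x hx
    have := h.lt x hx
    exact hf a x (by omega) (by omega)

/-- The letters `r`, `r + 1` in the first half of a column. -/
def MidPos (r : ℕ) (mid : List ℕ) : Kind → Prop
  | .zero => mid = [] ∨ mid = [r, r + 1]
  | .plus => mid = [r]
  | .minus => mid = [r + 1]

/-- The letters `r`, `r + 1` in the second half of a column. -/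
def MidNeg (r : ℕ) (mid : List ℕ) : Kind → Prop
  | .zero => mid = [] ∨ mid = [r, r + 1]
  | .plus => mid = [r + 1]
  | .minus => mid = [r]

theorem Split.exists_midPos {r : ℕ} {s s₁ mid s₂ : List ℕ} (h : Split r s s₁ mid s₂) :
    ∃ k, MidPos r mid k := by
  rcases h.mid with h | h | h | h
  exacts [⟨.zero, Or.inl h⟩, ⟨.plus, h⟩, ⟨.minus, h⟩, ⟨.zero, Or.inr h⟩]

theorem Split.exists_midNeg {r : ℕ} {s s₁ mid s₂ : List ℕ} (h : Split r s s₁ mid s₂) :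
    ∃ k, MidNeg r mid k := by
  rcases h.mid with h | h | h | h
  exacts [⟨.zero, Or.inl h⟩, ⟨.minus, h⟩, ⟨.plus, h⟩, ⟨.zero, Or.inr h⟩]

theorem partialHom_boxPos {n : ℕ} (i : Fin n) (m a : ℤ) (x : ℕ) :
    partialHom i m (boxPos n a x) = (if x = i.val + 1 ∧ n - a ≤ m then 1 else 0) -
      (if x = i.val + 2 ∧ n + 1 - a ≤ m then 1 else 0) := by
  rw [boxPos, map_sub, partialHom_varY, partialHom_varY]
  congr 1
  exact if_congr (by omega) rfl rfl

theorem partialHom_boxNeg {n : ℕ} (i : Fin n) (m b : ℤ) (x : ℕ) :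
    partialHom i m (boxNeg n b x) = (if x = i.val + 2 ∧ n - x + b ≤ m then 1 else 0) -
      (if x = i.val + 1 ∧ n - x + b ≤ m then 1 else 0) := by
  rw [boxNeg, map_sub, partialHom_varY, partialHom_varY]
  congr 1
  exact if_congr (by omega) rfl rfl

theorem wtHom_boxPos {n : ℕ} (i : Fin n) (a : ℤ) (x : ℕ) :
    wtHom i (boxPos n a x) = (if x = i.val + 1 then 1 else 0) -
      (if x = i.val + 2 then 1 else 0) := by
  rw [boxPos, map_sub, wtHom_varY, wtHom_varY]
  congr 1
  exact if_congr (by omega) rfl rfl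

theorem wtHom_boxNeg {n : ℕ} (i : Fin n) (b : ℤ) (x : ℕ) :
    wtHom i (boxNeg n b x) = (if x = i.val + 2 then 1 else 0) -
      (if x = i.val + 1 then 1 else 0) := by
  rw [boxNeg, map_sub, wtHom_varY, wtHom_varY]
  congr 1
  exact if_congr (by omega) rfl rfl

/-- Letters other than `r`, `r + 1` do not involve color `r`. If both occur in one half they have
consecutive positions, and then their jumps are at the same place and cancel. -/
theorem partialSum_colMono {n : ℕ} {v : Column} {i : Fin n} {u₁ mu u₂ l₁ ml l₂ : List ℕ}
    (hu : Split (i.val + 1) v.u u₁ mu u₂) (hl : Split (i.val + 1) v.l l₁ ml l₂) {k k' : Kind}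
    (hk : MidPos (i.val + 1) mu k) (hk' : MidNeg (i.val + 1) ml k') (m : ℤ) :
    partialSum (colMono n v) i m = k.step (n - u₁.length - 1) m +
      k'.step (n - (i.val + 1 : ℕ) + l₁.length) m := by
  rw [← partialHom_apply, colMono, map_add, map_posSum, map_posSum, hu.posSum, hl.posSum]
  · congr 1
    · cases k <;> simp only [MidPos] at hk
      · rcases hk with rfl | rfl
        · simp [posSum, Kind.step]
        · simp only [posSum, partialHom_boxPos, Kind.step, true_and]
          split_ifs <;> omega
      · subst hk
        simp only [posSum, partialHom_boxPos, Kind.step, true_and]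
        split_ifs <;> omega
      · subst hk
        simp only [posSum, partialHom_boxPos, Kind.step, true_and]
        split_ifs <;> omega
    · cases k' <;> simp only [MidNeg] at hk'
      · rcases hk' with rfl | rfl
        · simp [posSum, Kind.step]
        · simp only [posSum, partialHom_boxNeg, Kind.step, true_and]
          split_ifs <;> omega
      · subst hk'
        simp only [posSum, partialHom_boxNeg, Kind.step, true_and]
        split_ifs <;> omega
      · subst hk'
        simp only [posSum, partialHom_boxNeg, Kind.step, true_and]
        split_ifs <;> omega
  · intro a x h1 h2
    rw [partialHom_boxNeg, if_neg (by omega), if_neg (by omega), sub_zero]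
  · intro a x h1 h2
    rw [partialHom_boxPos, if_neg (by omega), if_neg (by omega), sub_zero]

theorem monoWt_colMono {n : ℕ} {v : Column} {i : Fin n} {u₁ mu u₂ l₁ ml l₂ : List ℕ}
    (hu : Split (i.val + 1) v.u u₁ mu u₂) (hl : Split (i.val + 1) v.l l₁ ml l₂) {k k' : Kind}
    (hk : MidPos (i.val + 1) mu k) (hk' : MidNeg (i.val + 1) ml k') :
    monoWt (colMono n v) i = k.val + k'.val := by
  rw [← wtHom_apply, colMono, map_add, map_posSum, map_posSum, hu.posSum, hl.posSum]
  · congr 1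
    · cases k <;> simp only [MidPos] at hk
      · rcases hk with rfl | rfl <;> simp [posSum, wtHom_boxPos, Kind.val]
      · simp [hk, posSum, wtHom_boxPos, Kind.val]
      · simp [hk, posSum, wtHom_boxPos, Kind.val]
    · cases k' <;> simp only [MidNeg] at hk'
      · rcases hk' with rfl | rfl <;> simp [posSum, wtHom_boxNeg, Kind.val]
      · simp [hk', posSum, wtHom_boxNeg, Kind.val]
      · simp [hk', posSum, wtHom_boxNeg, Kind.val]
  · intro a x h1 h2
    rw [wtHom_boxNeg, if_neg (by omega), if_neg (by omega), sub_zero]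
  · intro a x h1 h2
    rw [wtHom_boxPos, if_neg (by omega), if_neg (by omega), sub_zero]

/-- The numerical consequences of admissibility for the kinds at color `r`. -/
theorem IsAdmissible.le_of_split {n : ℕ} {v : Column} (hv : IsAdmissible n v) {i : Fin n}
    {u₁ mu u₂ l₁ ml l₂ : List ℕ}
    (hu : Split (i.val + 1) v.u u₁ mu u₂) (hl : Split (i.val + 1) v.l l₁ ml l₂) {k k' : Kind}
    (hk : MidPos (i.val + 1) mu k) (hk' : MidNeg (i.val + 1) ml k') :
    u₁.length + l₁.length ≤ i.val ∧ (k = .plus → k' = .minus →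
      u₁.length + l₁.length + 1 ≤ i.val) := by
  have h := (isAdmissible_iff.1 hv).2
  refine ⟨?_, ?_⟩
  · have h1 := h i.val
    rw [hu.cnt (by omega) (by omega), hl.cnt (by omega) (by omega)] at h1
    omega
  · rintro rfl rfl
    -- In the `plus`, `minus` case the letter `r` itself occurs in both halves, and the count at `r`
    -- instead of `r - 1` gives the strict inequality.
    have h1 := h (i.val + 1)
    rw [hu.cnt (by omega) (by omega), hl.cnt (by omega) (by omega)] at h1
    simp only [MidPos] at hk
    simp only [MidNeg] at hk'
    simp only [hk, hk', cnt_cons, cnt_nil, le_refl, if_true] at h1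
    omega

theorem Column.word_split (u₁ mu u₂ l₁ ml l₂ : List ℕ) :
    (⟨u₁ ++ mu ++ u₂, l₁ ++ ml ++ l₂⟩ : Column).word =
      u₁.map Letter.pos ++ (mu.map Letter.pos ++ ((u₂.map Letter.pos ++
        (l₂.map Letter.neg).reverse) ++ ((ml.map Letter.neg).reverse ++
          (l₁.map Letter.neg).reverse))) := by
  simp [Column.word]

theorem Neutral.pos {n r x : ℕ} (h1 : x ≠ r) (h2 : x ≠ r + 1) : Neutral n r [Letter.pos x] :=
  Neutral.singleton (by simp [letterF, h1]) (by simp [letterE, h2]) (by simp [letterWt, h1, h2])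

theorem Neutral.neg {n r x : ℕ} (h1 : x ≠ r) (h2 : x ≠ r + 1) : Neutral n r [Letter.neg x] :=
  Neutral.singleton (by simp [letterF, h2]) (by simp [letterE, h1]) (by simp [letterWt, h1, h2])

theorem Neutral.map_pos {n r : ℕ} {s : List ℕ} (h : ∀ x ∈ s, x ≠ r ∧ x ≠ r + 1) :
    Neutral n r (s.map Letter.pos) := by
  refine Neutral.of_forall fun x hx => ?_
  obtain ⟨y, hy, rfl⟩ := List.mem_map.1 hx
  exact Neutral.pos (h y hy).1 (h y hy).2

theorem Neutral.map_neg {n r : ℕ} {s : List ℕ} (h : ∀ x ∈ s, x ≠ r ∧ x ≠ r + 1) :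
    Neutral n r (s.map Letter.neg).reverse := by
  refine Neutral.of_forall fun x hx => ?_
  obtain ⟨y, hy, rfl⟩ := List.mem_map.1 (List.mem_reverse.1 hx)
  exact Neutral.neg (h y hy).1 (h y hy).2

theorem MidPos.hasKind {n r : ℕ} (hr : r < n) {mid : List ℕ} {k : Kind} (h : MidPos r mid k) :
    HasKind n r (mid.map Letter.pos) [Letter.pos (r + 1)] [Letter.pos r] k := by
  cases k <;> simp only [MidPos] at h <;> simp only [HasKind]
  · rcases h with rfl | rfl
    · exact Neutral.nil n r
    · exact Neutral.pair (x' := .pos (r + 1)) (y' := .pos r) (by simp [letterF, hr])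
        (by simp [letterE]) (by simp [letterE, hr]) (by simp [letterF]) (by simp [letterWt])
  · subst h
    exact ⟨_, _, rfl, rfl, by simp [letterF, hr], by simp [letterE], by simp [letterWt]⟩
  · subst h
    exact ⟨_, _, rfl, rfl, by simp [letterE, hr], by simp [letterF], by simp [letterWt]⟩

theorem MidNeg.hasKind {n r : ℕ} (hr : r < n) {mid : List ℕ} {k : Kind} (h : MidNeg r mid k) :
    HasKind n r (mid.map Letter.neg).reverse [Letter.neg r] [Letter.neg (r + 1)] k := by
  cases k <;> simp only [MidNeg] at h <;> simp only [HasKind]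
  · rcases h with rfl | rfl
    · exact Neutral.nil n r
    · exact Neutral.pair (x' := .neg r) (y' := .neg (r + 1)) (by simp [letterF, hr])
        (by simp [letterE]) (by simp [letterE, hr]) (by simp [letterF]) (by simp [letterWt])
  · subst h
    exact ⟨_, _, rfl, rfl, by simp [letterF, hr], by simp [letterE], by simp [letterWt]⟩
  · subst h
    exact ⟨_, _, rfl, rfl, by simp [letterE, hr], by simp [letterF], by simp [letterWt]⟩

/-! ### The crystal structure of a single column -/

theorem pairwise_replace {r : ℕ} {s₁ s₂ : List ℕ} {c c' : ℕ} (h1 : ∀ x ∈ s₁, x < r)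
    (h2 : ∀ x ∈ s₂, r + 1 < x) (hc' : c' = r ∨ c' = r + 1)
    (hs : (s₁ ++ [c] ++ s₂).Pairwise (· < ·)) : (s₁ ++ [c'] ++ s₂).Pairwise (· < ·) := by
  simp only [List.append_assoc, List.pairwise_append, List.cons_append, List.nil_append,
    List.pairwise_cons] at hs ⊢
  refine ⟨hs.1, ⟨fun x hx => ?_, hs.2.1.2⟩, fun x hx y hy => ?_⟩
  · have := h2 x hx
    omega
  · have := h1 x hx
    rcases List.mem_cons.1 hy with rfl | hy
    · omega
    · have := h2 y hy
      omega

/-- Exchanging `r` and `r + 1` is visible only in the count at `r`. So the admissibility of the new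
column reduces to a single inequality in `IsAdmissible.replace_u` and `IsAdmissible.replace_l`. -/
theorem cnt_replace {r : ℕ} {s₁ s₂ : List ℕ} {c c' : ℕ} (hc : c = r ∨ c = r + 1)
    (hc' : c' = r ∨ c' = r + 1) {j : ℕ} (hj : j ≠ r) :
    cnt (s₁ ++ [c'] ++ s₂) j = cnt (s₁ ++ [c] ++ s₂) j := by
  simp only [cnt_append, cnt_cons, cnt_nil]
  have : c ≤ j ↔ c' ≤ j := by omega
  simp only [this]

theorem bounds_replace {n r : ℕ} {s₁ s₂ : List ℕ} {c c' : ℕ} (hr : 1 ≤ r) (hrn : r < n)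
    (hc' : c' = r ∨ c' = r + 1)
    (hs : ∀ x ∈ s₁ ++ [c] ++ s₂, 1 ≤ x ∧ x ≤ n) : ∀ x ∈ s₁ ++ [c'] ++ s₂, 1 ≤ x ∧ x ≤ n := by
  intro x hx
  simp only [List.mem_append, List.mem_singleton] at hx hs
  rcases hx with (h | h) | h
  · exact hs x (by tauto)
  · omega
  · exact hs x (by tauto)

theorem IsAdmissible.replace_u {n r : ℕ} {u₁ u₂ l : List ℕ} {c c' : ℕ} (h1 : ∀ x ∈ u₁, x < r)
    (h2 : ∀ x ∈ u₂, r + 1 < x) (hc : c = r ∨ c = r + 1) (hc' : c' = r ∨ c' = r + 1)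
    (hr : 1 ≤ r) (hrn : r < n) (h : IsAdmissible n ⟨u₁ ++ [c] ++ u₂, l⟩)
    (hcnt : cnt (u₁ ++ [c'] ++ u₂) r + cnt l r ≤ r) :
    IsAdmissible n ⟨u₁ ++ [c'] ++ u₂, l⟩ := by
  rw [isAdmissible_iff] at h ⊢
  obtain ⟨⟨a1, a2, a3, a4, a5⟩, a6⟩ := h
  refine ⟨⟨pairwise_replace h1 h2 hc' a1, a2, bounds_replace hr hrn hc' a3, a4, by simpa using a5⟩,
    fun j => ?_⟩
  by_cases hj : j = r
  · subst hj
    exact hcnt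
  · have := a6 j
    simp only at this ⊢
    rwa [cnt_replace hc hc' hj]

theorem IsAdmissible.replace_l {n r : ℕ} {u l₁ l₂ : List ℕ} {c c' : ℕ} (h1 : ∀ x ∈ l₁, x < r)
    (h2 : ∀ x ∈ l₂, r + 1 < x) (hc : c = r ∨ c = r + 1) (hc' : c' = r ∨ c' = r + 1)
    (hr : 1 ≤ r) (hrn : r < n) (h : IsAdmissible n ⟨u, l₁ ++ [c] ++ l₂⟩)
    (hcnt : cnt u r + cnt (l₁ ++ [c'] ++ l₂) r ≤ r) :
    IsAdmissible n ⟨u, l₁ ++ [c'] ++ l₂⟩ := by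
  rw [isAdmissible_iff] at h ⊢
  obtain ⟨⟨a1, a2, a3, a4, a5⟩, a6⟩ := h
  refine ⟨⟨a1, pairwise_replace h1 h2 hc' a2, a3, bounds_replace hr hrn hc' a4, by simpa using a5⟩,
    fun j => ?_⟩
  by_cases hj : j = r
  · subst hj
    exact hcnt
  · have := a6 j
    simp only at this ⊢
    rwa [cnt_replace hc hc' hj]

theorem monoA_eq_varA {n : ℕ} (m : ℤ) {i : Fin n} (hi : i.val + 1 < n) :
    monoA n m i = varA n m (i.val + 1) := by
  rw [monoA_eq, if_neg hi.ne, one_smul, varA, Nat.add_sub_cancel]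

theorem colMono_replace_u {n : ℕ} {i : Fin n} (hi : i.val + 1 < n) (u₁ u₂ l : List ℕ) :
    colMono n ⟨u₁ ++ [i.val + 1 + 1] ++ u₂, l⟩ =
      colMono n ⟨u₁ ++ [i.val + 1] ++ u₂, l⟩ - monoA n (n - u₁.length - 1) i := by
  simp only [colMono, posSum_append, posSum, boxPos_succ, monoA_eq_varA _ hi, List.length_append,
    List.length_cons, List.length_nil]
  rw [show (n : ℤ) - u₁.length - 1 = n - (1 + u₁.length) by ring]
  abel

theorem colMono_replace_l {n : ℕ} {i : Fin n} (hi : i.val + 1 < n) (u l₁ l₂ : List ℕ) :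
    colMono n ⟨u, l₁ ++ [i.val + 1] ++ l₂⟩ =
      colMono n ⟨u, l₁ ++ [i.val + 1 + 1] ++ l₂⟩ - monoA n (n - (i.val + 1 : ℕ) + l₁.length) i := by
  simp only [colMono, posSum_append, posSum, boxNeg_succ, monoA_eq_varA _ hi, List.length_append,
    List.length_cons, List.length_nil]
  rw [show (n : ℤ) - (i.val + 1 : ℕ) + (1 + l₁.length) - 1 = n - (i.val + 1 : ℕ) + l₁.length by
    ring]
  abel

/-- The sum of the ranks of the letters with respect to the order
`1 < ⋯ < n < \bar n < ⋯ < \bar 1`. -/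
def Column.rank (n : ℕ) (v : Column) : ℕ := v.u.sum + (v.l.map fun x => 2 * n + 1 - x).sum

/-- The crystal structures of color `i` on a column and on its monomial. -/
structure ColumnTable (n : ℕ) (i : Fin n) (v : Column) (k k' : Kind) (x y : ℤ) : Prop where
  le : y ≤ x
  lt : k = .plus → k' = .minus → y + 1 ≤ x
  partialSum_eq : ∀ m, partialSum (colMono n v) i m = k.step x m + k'.step y m
  monoWt_eq : monoWt (colMono n v) i = k.val + k'.val
  eps_eq : wordEps n (i.val + 1) v.word = Kind.eps k k'
  phi_eq : wordPhi n (i.val + 1) v.word = Kind.phi k k'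
  wt_eq : wordWt (i.val + 1) v.word = k.val + k'.val
  f_none : Kind.phi k k' = 0 → wordF n (i.val + 1) v.word = none
  e_none : Kind.eps k k' = 0 → wordE n (i.val + 1) v.word = none
  f_some : Kind.phi k k' ≠ 0 → ∃ v', IsAdmissible n v' ∧
    wordF n (i.val + 1) v.word = some v'.word ∧ wordE n (i.val + 1) v'.word = some v.word ∧
    colMono n v' = colMono n v - monoA n (if k = .plus then x else y) i
  e_some : Kind.eps k k' ≠ 0 → ∃ v', IsAdmissible n v' ∧
    wordE n (i.val + 1) v.word = some v'.word ∧ wordF n (i.val + 1) v'.word = some v.word ∧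
    colMono n v' = colMono n v + monoA n (if k' = .minus then y else x) i ∧
    v'.rank n + 1 = v.rank n

/-- For `i < n` the operators exchange `r` and `r + 1` within one half. The word rule selects the
half, and it is the half whose jump is selected in the monomial. -/
theorem columnTable_of_lt {n : ℕ} {i : Fin n} (hi : i.val + 1 < n) {v : Column}
    (hv : IsAdmissible n v) {u₁ mu u₂ l₁ ml l₂ : List ℕ}
    (hu : Split (i.val + 1) v.u u₁ mu u₂) (hl : Split (i.val + 1) v.l l₁ ml l₂) {k k' : Kind}
    (hk : MidPos (i.val + 1) mu k) (hk' : MidNeg (i.val + 1) ml k') :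
    ColumnTable n i v k k' (n - u₁.length - 1) (n - (i.val + 1 : ℕ) + l₁.length) := by
  obtain ⟨b1, b2⟩ := hv.le_of_split hu hl hk hk'
  have hv2 := (isAdmissible_iff.1 hv).2
  have h1 := partialSum_colMono (n := n) hu hl hk hk'
  have h2 := monoWt_colMono (n := n) hu hl hk hk'
  obtain ⟨u, l⟩ := v
  simp only at hu hl hv2
  have cU : ∀ j, i.val ≤ j → j ≤ i.val + 2 → cnt u j = u₁.length + cnt mu j :=
    fun j h h' => hu.cnt (by omega) (by omega)
  have cL : ∀ j, i.val ≤ j → j ≤ i.val + 2 → cnt l j = l₁.length + cnt ml j :=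
    fun j h h' => hl.cnt (by omega) (by omega)
  have e0 := hv2 i.val
  have e1 := hv2 (i.val + 1)
  have e2 := hv2 (i.val + 2)
  rw [cU _ (by omega) (by omega), cL _ (by omega) (by omega)] at e0 e1 e2
  obtain rfl := hu.eq
  obtain rfl := hl.eq
  -- The table is kept general in the middle parts, so that it applies to `v` and also to the column
  -- obtained by changing a letter; the latter gives the inverse operator.
  have tab : ∀ mu ml k k', MidPos (i.val + 1) mu k → MidNeg (i.val + 1) ml k' →
      _ := fun mu ml k k' hk hk' => word_table
    (Neutral.map_pos fun x hx => ⟨(hu.lt x hx).ne, (by have := hu.lt x hx; omega)⟩)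
    ((Neutral.map_pos fun x hx => (by have := hu.gt x hx; omega)).append
      (Neutral.map_neg fun x hx => (by have := hl.gt x hx; omega)))
    (Neutral.map_neg fun x hx => ⟨(hl.lt x hx).ne, (by have := hl.lt x hx; omega)⟩)
    (MidPos.hasKind hi hk) (MidNeg.hasKind hi hk')
  simp only [← Column.word_split] at tab
  have tF := fun mu ml k k' hk hk' => (tab mu ml k k' hk hk').2.2.2.1
  have tE := fun mu ml k k' hk hk' => (tab mu ml k k' hk hk').2.2.2.2
  have w1 : ∀ c (ml : List ℕ), u₁.map Letter.pos ++ ([Letter.pos c] ++ ((u₂.map Letter.pos ++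
        (l₂.map Letter.neg).reverse) ++ ((ml.map Letter.neg).reverse ++
          (l₁.map Letter.neg).reverse))) = (⟨u₁ ++ [c] ++ u₂, l₁ ++ ml ++ l₂⟩ : Column).word :=
    fun c ml => (Column.word_split u₁ [c] u₂ l₁ ml l₂).symm
  have w2 : ∀ c (mu : List ℕ), u₁.map Letter.pos ++ (mu.map Letter.pos ++ ((u₂.map Letter.pos ++
        (l₂.map Letter.neg).reverse) ++ ([Letter.neg c] ++
          (l₁.map Letter.neg).reverse))) = (⟨u₁ ++ mu ++ u₂, l₁ ++ [c] ++ l₂⟩ : Column).word :=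
    fun c mu => (Column.word_split u₁ mu u₂ l₁ [c] l₂).symm
  simp only [w1, w2] at tF tE
  obtain ⟨t1, t2, t3, -, -⟩ := tab mu ml k k' hk hk'
  have hcu : ∀ c, cnt (u₁ ++ [c] ++ u₂) (i.val + 1) =
      u₁.length + if c ≤ i.val + 1 then 1 else 0 := by
    intro c
    rw [cnt_append, cnt_append, cnt_of_le (s := u₁), cnt_of_lt (s := u₂), cnt_cons, cnt_nil]
    · omega
    · exact fun x hx => by have := hu.gt x hx; omega
    · exact fun x hx => (hu.lt x hx).le
  have hcl : ∀ c, cnt (l₁ ++ [c] ++ l₂) (i.val + 1) =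
      l₁.length + if c ≤ i.val + 1 then 1 else 0 := by
    intro c
    rw [cnt_append, cnt_append, cnt_of_le (s := l₁), cnt_of_lt (s := l₂), cnt_cons, cnt_nil]
    · omega
    · exact fun x hx => by have := hl.gt x hx; omega
    · exact fun x hx => (hl.lt x hx).le
  refine ⟨by omega, fun h h' => by have := b2 h h'; omega, h1, h2, t1, t2, t3,
    fun h => by rw [tF mu ml k k' hk hk', if_pos h], fun h => by rw [tE mu ml k k' hk hk', if_pos h],
    fun h => ?_, fun h => ?_⟩
  · by_cases hp : k = .plus
    · subst hp
      simp only [MidPos] at hk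
      subst hk
      have hk2 : k' ≠ .minus := by
        rintro rfl
        exact h rfl
      refine ⟨⟨u₁ ++ [i.val + 1 + 1] ++ u₂, l₁ ++ ml ++ l₂⟩, ?_, ?_, ?_, ?_⟩
      · refine hv.replace_u hu.lt hu.gt (Or.inl rfl) (Or.inr rfl) (by omega) hi ?_
        rw [hcu, cL _ (by omega) (by omega), if_neg (by omega)]
        simp only [cnt_cons, cnt_nil, le_refl, if_true] at e1
        omega
      · rw [tF [i.val + 1] ml .plus k' rfl hk', if_neg h, if_pos rfl]
      · rw [tE [i.val + 1 + 1] ml .minus k' rfl hk', if_neg, if_neg hk2]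
        cases k' <;> simp [Kind.eps]
      · rw [if_pos rfl, colMono_replace_u hi]
    · have hk2 : k' = .plus := by
        cases k <;> cases k' <;> simp [Kind.phi] at h hp ⊢
      subst hk2
      simp only [MidNeg] at hk'
      subst hk'
      refine ⟨⟨u₁ ++ mu ++ u₂, l₁ ++ [i.val + 1] ++ l₂⟩, ?_, ?_, ?_, ?_⟩
      · refine hv.replace_l hl.lt hl.gt (Or.inr rfl) (Or.inl rfl) (by omega) hi ?_
        rw [hcl, cU _ (by omega) (by omega), if_pos (by omega)]
        -- If `r` and `r + 1` both occur among the unbarred letters, the bound at `r + 1` is needed;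
        -- if `r` does not occur, the bound at `r - 1` suffices. The case of `r` alone is of kind
        -- `plus` and is excluded.
        rcases hu.mid with rfl | rfl | rfl | rfl <;>
          simp [cnt_cons, cnt_nil] at e0 e1 e2 ⊢ <;> try omega
        cases k <;> simp [MidPos] at hk hp
      · rw [tF mu [i.val + 1 + 1] k .plus hk rfl, if_neg h, if_neg hp]
      · rw [tE mu [i.val + 1] k .minus hk rfl, if_neg, if_pos rfl]
        cases k <;> simp [Kind.eps] at hp ⊢
      · rw [if_neg hp, colMono_replace_l hi]
  · by_cases hp : k' = .minus
    · subst hp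
      simp only [MidNeg] at hk'
      subst hk'
      have hk2 : k ≠ .plus := by
        rintro rfl
        exact h rfl
      refine ⟨⟨u₁ ++ mu ++ u₂, l₁ ++ [i.val + 1 + 1] ++ l₂⟩, ?_, ?_, ?_, ?_, ?_⟩
      · refine hv.replace_l hl.lt hl.gt (Or.inl rfl) (Or.inr rfl) (by omega) hi ?_
        rw [hcl, cU _ (by omega) (by omega), if_neg (by omega)]
        simp only [cnt_cons, cnt_nil, le_refl, if_true] at e1
        omega
      · rw [tE mu [i.val + 1] k .minus hk rfl, if_neg h, if_pos rfl]
      · rw [tF mu [i.val + 1 + 1] k .plus hk rfl, if_neg, if_neg hk2]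
        cases k <;> simp [Kind.phi]
      · rw [if_pos rfl, colMono_replace_l hi, sub_add_cancel]
      · simp only [Column.rank, List.sum_append, List.map_append, List.map_cons, List.map_nil,
          List.sum_cons, List.sum_nil]
        omega
    · have hk2 : k = .minus := by
        cases k <;> cases k' <;> simp [Kind.eps] at h hp ⊢
      subst hk2
      simp only [MidPos] at hk
      subst hk
      refine ⟨⟨u₁ ++ [i.val + 1] ++ u₂, l₁ ++ ml ++ l₂⟩, ?_, ?_, ?_, ?_, ?_⟩
      · refine hv.replace_u hu.lt hu.gt (Or.inr rfl) (Or.inl rfl) (by omega) hi ?_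
        rw [hcu, cL _ (by omega) (by omega), if_pos (by omega)]
        -- The mirror image: `\bar r` alone is of kind `minus` and excluded, and the bound at `r +
        -- 1` is used when both barred letters occur.
        rcases hl.mid with rfl | rfl | rfl | rfl <;>
          simp [cnt_cons, cnt_nil] at e0 e1 e2 ⊢ <;> try omega
        cases k' <;> simp [MidNeg] at hk' hp
      · rw [tE [i.val + 1 + 1] ml .minus k' rfl hk', if_neg h, if_neg hp]
      · rw [tF [i.val + 1] ml .plus k' rfl hk', if_neg, if_pos rfl]
        cases k' <;> simp [Kind.phi] at hp ⊢
      · rw [if_neg hp, colMono_replace_u hi, sub_add_cancel]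
      · simp only [Column.rank, List.sum_append, List.sum_cons, List.sum_nil]
        omega

/-- The letter `n` passes from one half to the other, so the sum of the two counts is unchanged for
every `j`. -/
theorem IsAdmissible.move_last {n : ℕ} {u l : List ℕ}
    (hl : ∀ x ∈ l, x < n) (h : IsAdmissible n ⟨u ++ [n], l⟩) :
    IsAdmissible n ⟨u, l ++ [n]⟩ := by
  rw [isAdmissible_iff] at h ⊢
  obtain ⟨⟨a1, a2, a3, a4, a5⟩, a6⟩ := h
  simp only [List.pairwise_append, List.mem_append, List.mem_singleton, List.length_append,
    List.length_singleton, cnt_append] at a1 a3 a5 a6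
  refine ⟨⟨a1.1, ?_, fun x hx => a3 x (Or.inl hx), ?_, ?_⟩, fun j => ?_⟩
  · simp only [List.pairwise_append, List.mem_singleton]
    exact ⟨a2, List.pairwise_singleton _ _, fun x hx y hy => hy ▸ hl x hx⟩
  · intro x hx
    rcases List.mem_append.1 hx with hx | hx
    · exact a4 x hx
    · rw [List.mem_singleton.1 hx]
      exact a3 n (Or.inr rfl)
  · simp only [List.length_append, List.length_singleton]
    omega
  · have := a6 j
    simp only [cnt_append]
    omega

theorem IsAdmissible.move_last' {n : ℕ} {u l : List ℕ}
    (hu : ∀ x ∈ u, x < n) (h : IsAdmissible n ⟨u, l ++ [n]⟩) :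
    IsAdmissible n ⟨u ++ [n], l⟩ := by
  rw [isAdmissible_iff] at h ⊢
  obtain ⟨⟨a1, a2, a3, a4, a5⟩, a6⟩ := h
  simp only [List.pairwise_append, List.mem_append, List.mem_singleton, List.length_append,
    List.length_singleton, cnt_append] at a2 a4 a5 a6
  refine ⟨⟨?_, a2.1, ?_, fun x hx => a4 x (Or.inl hx), ?_⟩, fun j => ?_⟩
  · simp only [List.pairwise_append, List.mem_singleton]
    exact ⟨a1, List.pairwise_singleton _ _, fun x hx y hy => hy ▸ hu x hx⟩
  · intro x hx
    rcases List.mem_append.1 hx with hx | hx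
    · exact a3 x hx
    · rw [List.mem_singleton.1 hx]
      exact a4 n (Or.inr rfl)
  · simp only [List.length_append, List.length_singleton]
    omega
  · have := a6 j
    simp only [cnt_append]
    omega

/-- With `m = l.length` the boxes are `Y_{m,n} / Y_{m+1,n-1}` for `n` and `Y_{m+1,n-1} / Y_{m+1,n}`
for `\bar n`. The square of `Y_{m+1,n-1}` in their quotient is the entry `a_{n-1,n} = -2`. -/
theorem colMono_move_last {n : ℕ} {i : Fin n} (hi : i.val + 1 = n) {u l : List ℕ}
    (h : u.length + l.length = i.val) :
    colMono n ⟨u, l ++ [n]⟩ = colMono n ⟨u ++ [n], l⟩ - monoA n l.length i := by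
  have e1 : (n : ℤ) - (1 + u.length) = l.length := by omega
  have e2 : (n : ℤ) + 1 - (1 + u.length) = l.length + 1 := by omega
  have e3 : (n : ℤ) - n + (1 + l.length) = l.length + 1 := by omega
  have e4 : n - 1 = i.val := by omega
  have e5 : varY n l.length (i.val + 2) = 0 := by rw [varY, dif_neg (by omega)]
  rw [monoA_eq, if_pos hi, two_smul]
  simp only [colMono, posSum_append, posSum, boxPos, boxNeg, e1, e2, e3, e4, e5, hi]
  abel

theorem Split.last {n : ℕ} {s s₁ mid s₂ : List ℕ} (h : Split n s s₁ mid s₂)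
    (hs : ∀ x ∈ s, 1 ≤ x ∧ x ≤ n) : s₂ = [] ∧ (mid = [] ∨ mid = [n]) := by
  obtain ⟨rfl, -, h2, h3⟩ := h
  refine ⟨List.eq_nil_iff_forall_not_mem.2 fun x hx => ?_, ?_⟩
  · have := h2 x hx
    have := hs x (by simp [hx])
    omega
  · rcases h3 with rfl | rfl | rfl | rfl
    · exact Or.inl rfl
    · exact Or.inr rfl
    · have := hs (n + 1) (by simp)
      omega
    · have := hs (n + 1) (by simp)
      omega

/-- In color `n` only `n` and `\bar n` are active, and they are adjacent in the middle of the word.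
If both occur they cancel, so an operator acts only if exactly one of them is present, and it moves
that letter to the other half. -/
theorem columnTable_last {n : ℕ} {i : Fin n} (hi : i.val + 1 = n) {v : Column}
    (hv : IsAdmissible n v) {u₁ mu u₂ l₁ ml l₂ : List ℕ}
    (hu : Split (i.val + 1) v.u u₁ mu u₂) (hl : Split (i.val + 1) v.l l₁ ml l₂) {k k' : Kind}
    (hk : MidPos (i.val + 1) mu k) (hk' : MidNeg (i.val + 1) ml k') :
    ColumnTable n i v k k' (n - u₁.length - 1) (n - (i.val + 1 : ℕ) + l₁.length) := by
  obtain ⟨b1, b2⟩ := hv.le_of_split hu hl hk hk'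
  have h1 := partialSum_colMono (n := n) hu hl hk hk'
  have h2 := monoWt_colMono (n := n) hu hl hk hk'
  obtain ⟨rfl, hmu⟩ := (hi ▸ hu).last hv.1.2.2.1
  obtain ⟨rfl, hml⟩ := (hi ▸ hl).last hv.1.2.2.2.1
  have hlen := hv.1.2.2.2.2
  obtain ⟨u, l⟩ := v
  simp only at hu hl hlen
  obtain rfl := hu.eq
  obtain rfl := hl.eq
  simp only [List.length_append, List.length_nil, add_zero] at hlen
  have hlt := hu.lt
  have hlt' := hl.lt
  simp only [hi] at hlt hlt' h1 hk hk' ⊢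
  have K : HasKind n n (mu.map Letter.pos) [Letter.neg n] [] k := by
    rcases hmu with rfl | rfl <;> cases k <;> simp [MidPos] at hk
    · exact Neutral.nil n n
    · exact ⟨_, _, rfl, rfl, by simp [letterF], by simp [letterE], by simp [letterWt]⟩
  have K' : HasKind n n (ml.map Letter.neg).reverse [] [Letter.pos n] k' := by
    rcases hml with rfl | rfl <;> cases k' <;> simp [MidNeg] at hk'
    · exact Neutral.nil n n
    · exact ⟨_, _, rfl, rfl, by simp [letterE], by simp [letterF], by simp [letterWt]⟩
  have hA : Neutral n n (u₁.map Letter.pos) :=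
    Neutral.map_pos fun x hx => ⟨(hlt x hx).ne, (by have := hlt x hx; omega)⟩
  have hC : Neutral n n (l₁.map Letter.neg).reverse :=
    Neutral.map_neg fun x hx => ⟨(hlt' x hx).ne, (by have := hlt' x hx; omega)⟩
  have tab := word_table hA (Neutral.nil n n) hC K K'
  have z1 : HasKind n n [Letter.pos n] [Letter.neg n] [] .plus :=
    ⟨_, _, rfl, rfl, by simp [letterF], by simp [letterE], by simp [letterWt]⟩
  have z2 : HasKind n n [Letter.neg n] [] [Letter.pos n] .minus :=
    ⟨_, _, rfl, rfl, by simp [letterE], by simp [letterF], by simp [letterWt]⟩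
  have hw : (⟨u₁ ++ mu ++ [], l₁ ++ ml ++ []⟩ : Column).word = u₁.map Letter.pos ++
      (mu.map Letter.pos ++ ([] ++ ((ml.map Letter.neg).reverse ++
        (l₁.map Letter.neg).reverse))) := by
    simp [Column.word]
  rw [← hw] at tab
  obtain ⟨t1, t2, t3, t4, t5⟩ := tab
  refine ⟨by omega, fun h h' => by have := b2 h h'; omega, h1, h2, by rw [hi]; exact t1,
    by rw [hi]; exact t2, by rw [hi]; exact t3,
    fun h => by rw [hi, t4, if_pos h], fun h => by rw [hi, t5, if_pos h],
    fun h => ?_, fun h => ?_⟩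
  -- The only surviving case is that `n` occurs and `\bar n` does not.
  · rcases hmu with rfl | rfl <;> rcases hml with rfl | rfl <;> cases k <;> cases k' <;>
      simp [MidPos, MidNeg, Kind.phi] at hk hk' h
    simp only [List.length_nil, List.length_singleton] at hlen
    simp only [List.append_nil] at hv t4 ⊢
    refine ⟨⟨u₁, l₁ ++ [n]⟩, hv.move_last hlt', ?_, ?_, ?_⟩
    · rw [hi, t4]
      simp [Column.word, Kind.phi]
    · rw [hi]
      have := (word_table (XF := []) (XE := []) hA (Neutral.nil n n) hC (k := .zero)
        (Neutral.nil n n) z2).2.2.2.2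
      simp only [Column.word]
      simpa [Kind.eps] using this
    · rw [if_true, colMono_move_last hi (by omega),
        show (n : ℤ) - u₁.length - 1 = l₁.length by omega]
  · rcases hmu with rfl | rfl <;> rcases hml with rfl | rfl <;> cases k <;> cases k' <;>
      simp [MidPos, MidNeg, Kind.eps] at hk hk' h
    simp only [List.length_nil, List.length_singleton] at hlen
    simp only [List.append_nil] at hv t5 ⊢
    refine ⟨⟨u₁ ++ [n], l₁⟩, hv.move_last' hlt, ?_, ?_, ?_, ?_⟩
    · rw [hi, t5]
      simp [Column.word, Kind.eps]
    · rw [hi]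
      have := (word_table (XF' := []) (XE' := []) hA (Neutral.nil n n) hC (k' := .zero)
        z1 (Neutral.nil n n)).2.2.2.1
      simp only [Column.word]
      simpa [Kind.phi] using this
    · rw [if_true, colMono_move_last hi (by omega), sub_self, zero_add, sub_add_cancel]
    · simp only [Column.rank, List.sum_append, List.map_append, List.map_cons, List.map_nil,
          List.sum_cons, List.sum_nil]
      omega

theorem IsAdmissible.columnTable {n : ℕ} {i : Fin n} {v : Column}
    (hv : IsAdmissible n v) {u₁ mu u₂ l₁ ml l₂ : List ℕ}
    (hu : Split (i.val + 1) v.u u₁ mu u₂) (hl : Split (i.val + 1) v.l l₁ ml l₂) {k k' : Kind}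
    (hk : MidPos (i.val + 1) mu k) (hk' : MidNeg (i.val + 1) ml k') :
    ColumnTable n i v k k' (n - u₁.length - 1) (n - (i.val + 1 : ℕ) + l₁.length) := by
  rcases Nat.lt_or_ge (i.val + 1) n with hi | hi
  · exact columnTable_of_lt hi hv hu hl hk hk'
  · exact columnTable_last (by omega) hv hu hl hk hk'

theorem IsAdmissible.exists_columnTable {n : ℕ} (i : Fin n) {v : Column}
    (hv : IsAdmissible n v) : ∃ k k' x y, ColumnTable n i v k k' x y := by
  obtain ⟨u₁, mu, u₂, hu⟩ := exists_split (i.val + 1) hv.1.1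
  obtain ⟨l₁, ml, l₂, hl⟩ := exists_split (i.val + 1) hv.1.2.1
  obtain ⟨k, hk⟩ := hu.exists_midPos
  obtain ⟨k', hk'⟩ := hl.exists_midNeg
  exact ⟨k, k', _, _, hv.columnTable hu hl hk hk'⟩

/-! ### The embedding of `B(Λ_n)` into the monomial crystal -/

theorem Column.ofWord_word (v : Column) : Column.ofWord v.word = v := by
  obtain ⟨u, l⟩ := v
  simp [Column.ofWord, Column.word, List.filterMap_append, List.filterMap_reverse]

theorem toAdmissible_word {n : ℕ} {v : Column} (hv : IsAdmissible n v) :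
    toAdmissible n v.word = some ⟨v, hv⟩ := by
  simp [toAdmissible, Column.ofWord_word, hv]

/-- Compatibility with `ẽ_i` is stated separately because the proof of injectivity already uses it.
-/
theorem monomialCrystal_e_colMono {n : ℕ} (i : Fin n) (b : AdmissibleColumn n) :
    (monomialCrystal n).e i (colMono n b.val) =
      ((columnCrystal n).e i b).map fun b => colMono n b.val := by
  obtain ⟨k, k', x, y, t⟩ := b.2.exists_columnTable i
  obtain ⟨m1, m2, m3, m4⟩ := mono_table t.partialSum_eq t.monoWt_eq t.le t.lt
  simp only [columnCrystal, monomialCrystal, m2]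
  by_cases h0 : Kind.eps k k' = 0
  · rw [if_neg (by omega), t.e_none h0]
    rfl
  · obtain ⟨v', hv', e1, -, e3, -⟩ := t.e_some h0
    rw [if_pos (by omega), e1, Option.bind_some, toAdmissible_word hv', Option.map_some, e3,
      m4 h0]

theorem isCrystalEmbedding_of_injective {n : ℕ}
    (h : Function.Injective fun b : AdmissibleColumn n => colMono n b.val) :
    IsCrystalEmbedding (columnCrystal n) (monomialCrystal n) fun b => colMono n b.val := by
  refine ⟨h, fun b => ?_, fun i b => ?_, fun i b => ?_,
    monomialCrystal_e_colMono, fun i b => ?_⟩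
  · funext i
    obtain ⟨k, k', x, y, t⟩ := b.2.exists_columnTable i
    exact t.monoWt_eq.trans t.wt_eq.symm
  all_goals
    obtain ⟨k, k', x, y, t⟩ := b.2.exists_columnTable i
    obtain ⟨m1, m2, m3, m4⟩ := mono_table t.partialSum_eq t.monoWt_eq t.le t.lt
  · simp only [columnCrystal, monomialCrystal, m2, t.eps_eq]
  · simp only [columnCrystal, monomialCrystal, m1, t.phi_eq]
  · simp only [columnCrystal, monomialCrystal, m1]
    by_cases h0 : Kind.phi k k' = 0
    · rw [if_neg (by omega), t.f_none h0]
      rfl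
    · obtain ⟨v', hv', e1, -, e3⟩ := t.f_some h0
      rw [if_pos (by omega), e1, Option.bind_some, toAdmissible_word hv', Option.map_some, e3,
        m3 h0]

/-- The product of the boxes of `1, …, n` telescopes, and the last numerator `Y_{0,n}` remains. -/
theorem colMono_highestColumn {n : ℕ} (hn : 0 < n) :
    colMono n (highestColumn n).val = monoVar n 0 (lastIdx n hn) := by
  have h1 : colMono n (highestColumn n).val =
      ∑ t ∈ Finset.range n, boxPos n (1 + t) (1 + t) := by
    simp [colMono, highestColumn, posSum, posSum_range']
  have h2 : ∀ t ∈ Finset.range n, boxPos n (1 + t) (1 + t) =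
      varY n (n - (t + 1 : ℕ)) (t + 1) - varY n (n - t) t := by
    intro t _
    rw [boxPos, show (n : ℤ) - (1 + t) = n - (t + 1 : ℕ) by push_cast; ring,
      show (n : ℤ) + 1 - (1 + t) = n - t by ring, Nat.add_sub_cancel_left, add_comm 1 t]
  rw [h1, Finset.sum_congr rfl h2,
    Finset.sum_range_sub (fun t : ℕ => varY n ((n : ℤ) - (t : ℤ)) t), sub_self]
  have h3 : varY n ((n : ℤ) - (0 : ℕ)) 0 = 0 := by simp [varY]
  rw [h3, sub_zero, varY, dif_pos ⟨hn, le_rfl⟩]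
  rfl

/-- Every element of `B(Λ_n)` except for the highest weight vector is not annihilated by
some `ẽ_i`. -/
theorem exists_e_ne_zero {n : ℕ} {b : AdmissibleColumn n} (hb : b ≠ highestColumn n) :
    ∃ (i : Fin n) (b' : AdmissibleColumn n), (columnCrystal n).e i b = some b' ∧
      (columnCrystal n).f i b' = some b ∧ b'.val.rank n < b.val.rank n := by
  obtain ⟨v, hv⟩ := b
  rw [Ne, eq_highestColumn_iff] at hb
  simp only at hb
  suffices ∃ (i : Fin n) (k k' : Kind) (x y : ℤ), ColumnTable n i v k k' x y ∧
      Kind.eps k k' ≠ 0 by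
    obtain ⟨i, k, k', x, y, t, h⟩ := this
    obtain ⟨v', hv', e1, e2, -, e3⟩ := t.e_some h
    refine ⟨i, ⟨v', hv'⟩, ?_, ?_, by simp only; omega⟩
    · simp only [columnCrystal, e1, Option.bind_some]
      exact toAdmissible_word hv'
    · simp only [columnCrystal, e2, Option.bind_some]
      exact toAdmissible_word hv
  -- A letter `r + 1` without `r` in the first half has kind `minus`, and `ε_r > 0` whatever the
  -- second half contains.
  by_cases hA : ∃ r, 1 ≤ r ∧ r + 1 ∈ v.u ∧ r ∉ v.u
  · obtain ⟨r, hr, h1, h2⟩ := hA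
    have hrn := (hv.1.2.2.1 _ h1).2
    obtain ⟨i, rfl⟩ : ∃ i : Fin n, r = i.val + 1 := ⟨⟨r - 1, by omega⟩, by simp only; omega⟩
    obtain ⟨u₁, mu, u₂, hu⟩ := exists_split (i.val + 1) hv.1.1
    obtain ⟨l₁, ml, l₂, hl⟩ := exists_split (i.val + 1) hv.1.2.1
    obtain ⟨k', hk'⟩ := hl.exists_midNeg
    have hk : MidPos (i.val + 1) mu .minus := by
      rcases hu.mid with h | h | h | h
      · rw [hu.eq, h] at h1
        simp only [List.append_nil, List.mem_append] at h1
        rcases h1 with h1 | h1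
        · have := hu.lt _ h1
          omega
        · have := hu.gt _ h1
          omega
      · rw [hu.eq, h] at h2
        simp at h2
      · exact h
      · rw [hu.eq, h] at h2
        simp at h2
    exact ⟨i, _, _, _, _, hv.columnTable hu hl hk hk', by cases k' <;> simp [Kind.eps]⟩
  · push Not at hA
    have hlen := hv.1.2.2.2.2
    have hln : 0 < v.l.length := List.length_pos_of_ne_nil hb
    -- Now the unbarred letters form an initial segment `1, 2, …`; if it reached `n` there would be
    -- no room for barred letters.
    have hnu : n ∉ v.u := by
      intro hmem
      have hall : ∀ d, d < n → n - d ∈ v.u := by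
        intro d
        induction d with
        | zero => exact fun _ => hmem
        | succ d ih =>
          intro hd
          refine hA (n - (d + 1)) (by omega) ?_
          rw [show n - (d + 1) + 1 = n - d by omega]
          exact ih (by omega)
      have hsub : Finset.Icc 1 n ⊆ v.u.toFinset := by
        intro x hx
        rw [Finset.mem_Icc] at hx
        have := hall (n - x) (by omega)
        rw [show n - (n - x) = x by omega] at this
        exact List.mem_toFinset.2 this
      have h1 := Finset.card_le_card hsub
      have h2 := v.u.toFinset_card_le
      rw [Nat.card_Icc] at h1
      omega
    have hn : 0 < n := by omega
    by_cases hnl : n ∈ v.l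
    · obtain ⟨i, hi⟩ : ∃ i : Fin n, n = i.val + 1 := ⟨⟨n - 1, by omega⟩, by simp only; omega⟩
      obtain ⟨u₁, mu, u₂, hu⟩ := exists_split (i.val + 1) hv.1.1
      obtain ⟨l₁, ml, l₂, hl⟩ := exists_split (i.val + 1) hv.1.2.1
      obtain ⟨rfl, hmu⟩ := (hi.symm ▸ hu).last hv.1.2.2.1
      obtain ⟨rfl, hml⟩ := (hi.symm ▸ hl).last hv.1.2.2.2.1
      have hk : MidPos (i.val + 1) mu .zero := by
        rcases hmu with h | h
        · exact Or.inl h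
        · rw [hu.eq, h] at hnu
          simp at hnu
      have hk' : MidNeg (i.val + 1) ml .minus := by
        rcases hml with h | h
        · rw [hl.eq, h] at hnl
          simp only [List.append_nil] at hnl
          have := hl.lt _ hnl
          omega
        · exact h.trans (congrArg (fun x => [x]) hi)
      exact ⟨i, _, _, _, _, hv.columnTable hu hl hk hk', by simp [Kind.eps]⟩
    -- If neither `n` nor `\bar n` occurs, all `n` letters are counted at `n - 1`, which contradicts
    -- admissibility.
    · have h1 := (isAdmissible_iff.1 hv).2 (n - 1)
      rw [cnt_of_le, cnt_of_le] at h1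
      · omega
      · intro x hx
        have h2 := (hv.1.2.2.2.1 x hx).2
        have h3 : x ≠ n := fun h => hnl (h ▸ hx)
        omega
      · intro x hx
        have h2 := (hv.1.2.2.1 x hx).2
        have h3 : x ≠ n := fun h => hnu (h ▸ hx)
        omega

theorem highestColumn_e {n : ℕ} (i : Fin n) : (columnCrystal n).e i (highestColumn n) = none := by
  obtain ⟨u₁, mu, u₂, hu⟩ := exists_split (i.val + 1) (highestColumn n).2.1.1
  have hl : Split (i.val + 1) (highestColumn n).val.l [] [] [] :=
    ⟨rfl, by simp, by simp, by simp⟩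
  obtain ⟨k, hk⟩ := hu.exists_midPos
  have t := (highestColumn n).2.columnTable hu hl hk (k' := .zero) (Or.inl rfl)
  have hmem : ∀ x, 1 ≤ x → x ≤ n → x ∈ (highestColumn n).val.u := by
    intro x h1 h2
    simp only [highestColumn, List.mem_range'_1]
    omega
  have hk2 : Kind.eps k .zero = 0 := by
    cases k <;> try rfl
    have := hmem (i.val + 1) (by omega) (by omega)
    rw [hu.eq, show mu = [i.val + 1 + 1] from hk] at this
    simp only [List.mem_append, List.mem_singleton] at this
    rcases this with (h | h) | h
    · have := hu.lt _ h
      omega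
    · omega
    · have := hu.gt _ h
      omega
  simp only [columnCrystal, t.e_none hk2, Option.bind_none]

/-- Equal monomials are raised by the same operators. Induction on the rank: raise both columns
until one of them is the highest column, which no `ẽ_i` raises and which is the only such column;
then come back by `f̃_i`. -/
theorem colMono_injective {n : ℕ} :
    Function.Injective fun b : AdmissibleColumn n => colMono n b.val := by
  have key : ∀ (i : Fin n) (b b' : AdmissibleColumn n), colMono n b.val = colMono n b'.val →
      ((columnCrystal n).e i b).map (fun b => colMono n b.val) =
        ((columnCrystal n).e i b').map fun b => colMono n b.val := by
    intro i b b' h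
    rw [← monomialCrystal_e_colMono, ← monomialCrystal_e_colMono, h]
  have main : ∀ (N : ℕ) (b b' : AdmissibleColumn n), b.val.rank n ≤ N →
      colMono n b.val = colMono n b'.val → b = b' := by
    intro N
    induction N with
    | zero =>
      intro b b' hN h
      by_cases hb : b = highestColumn n
      · by_contra hne
        obtain ⟨i, c, hc, -⟩ := exists_e_ne_zero (b := b') (fun h => hne (hb.trans h.symm))
        have := key i b b' h
        rw [hc, hb, highestColumn_e] at this
        simp at this
      · obtain ⟨i, c, -, -, hc⟩ := exists_e_ne_zero hb
        omega
    | succ N ih =>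
      intro b b' hN h
      by_cases hb : b = highestColumn n
      · by_contra hne
        obtain ⟨i, c, hc, -⟩ := exists_e_ne_zero (b := b') (fun h => hne (hb.trans h.symm))
        have := key i b b' h
        rw [hc, hb, highestColumn_e] at this
        simp at this
      · obtain ⟨i, c, hc1, hc2, hc3⟩ := exists_e_ne_zero hb
        have h1 := key i b b' h
        rw [hc1, Option.map_some] at h1
        obtain ⟨c', hc', hcc⟩ := Option.map_eq_some_iff.1 h1.symm
        have h2 := ih c c' (by omega) hcc.symm
        subst h2
        obtain ⟨k, k', x, y, t⟩ := b'.2.exists_columnTable i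
        have h0 : Kind.eps k k' ≠ 0 := by
          intro h0
          simp only [columnCrystal, t.e_none h0, Option.bind_none] at hc'
          simp at hc'
        obtain ⟨v', hv', e1, e2, -, -⟩ := t.e_some h0
        simp only [columnCrystal, e1, Option.bind_some, toAdmissible_word hv',
          Option.some.injEq] at hc'
        subst hc'
        simp only [columnCrystal, e2, Option.bind_some] at hc2
        rw [toAdmissible_word b'.2] at hc2
        exact (Option.some.inj hc2).symm
  exact fun b b' h => main _ b b' le_rfl h

theorem isCrystalEmbedding_colMono (n : ℕ) :
    IsCrystalEmbedding (columnCrystal n) (monomialCrystal n) fun b => colMono n b.val :=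
  isCrystalEmbedding_of_injective colMono_injective

/-- Each column is obtained by some `f̃_i` from a column of smaller rank, so the image of the
highest weight vector determines the embedding. -/
theorem IsCrystalEmbedding.eq_colMono {n : ℕ} {hn : 0 < n}
    {m : AdmissibleColumn n → LaurentMonomial n}
    (h : IsCrystalEmbedding (columnCrystal n) (monomialCrystal n) m)
    (h0 : m (highestColumn n) = monoVar n 0 (lastIdx n hn)) : m = fun b => colMono n b.val := by
  have main : ∀ (N : ℕ) (b : AdmissibleColumn n), b.val.rank n ≤ N → m b = colMono n b.val := by
    intro N
    induction N with
    | zero =>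
      intro b hN
      by_cases hb : b = highestColumn n
      · rw [hb, h0, colMono_highestColumn hn]
      · obtain ⟨i, c, -, -, hc⟩ := exists_e_ne_zero hb
        omega
    | succ N ih =>
      intro b hN
      by_cases hb : b = highestColumn n
      · rw [hb, h0, colMono_highestColumn hn]
      · obtain ⟨i, c, -, hc2, hc3⟩ := exists_e_ne_zero hb
        have h1 := h.f_eq i c
        have h2 := (isCrystalEmbedding_colMono n).f_eq i c
        rw [ih c (by omega), hc2] at h1
        rw [hc2] at h2
        exact Option.some.inj (h1.symm.trans h2)
  exact funext fun b => main _ b le_rfl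

/-! ### The Weyl group as a group of signed permutations -/

/-- The action of `s_i` on coordinate vectors with respect to the basis `ε_1, …, ε_n`. -/
def signedAct (n i : ℕ) (x : ℕ → ℤ) : ℕ → ℤ := fun k =>
  if i + 1 < n then (if k = i then x (i + 1) else if k = i + 1 then x i else x k)
  else if k = i then - x i else x k

/-- The weight with coordinates `x`. -/
def toWeight (n : ℕ) (x : ℕ → ℤ) : Fin n → ℤ := fun j =>
  x j.val - if j.val + 1 < n then x (j.val + 1) else 0

theorem simpleReflection_toWeight (n : ℕ) (i : Fin n) (x : ℕ → ℤ) :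
    simpleReflection n i (toWeight n x) = toWeight n (signedAct n i x) := by
  funext j
  have hi := i.2
  have hj := j.2
  have hij : j = i ↔ j.val = i.val := Fin.ext_iff
  simp only [simpleReflection, toWeight, cartan, signedAct, hij]
  grind

theorem weylOf_toWeight (n : ℕ) (w : List (Fin n)) (x : ℕ → ℤ) :
    weylOf n w (toWeight n x) =
      toWeight n ((w.map Fin.val).foldr (signedAct n) x) := by
  induction w with
  | nil => rfl
  | cons i w ih =>
    have : weylOf n (i :: w) (toWeight n x) = simpleReflection n i (weylOf n w (toWeight n x)) := rfl
    rw [this, ih, simpleReflection_toWeight]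
    rfl

theorem toWeight_injective {n : ℕ} {x y : ℕ → ℤ} (h : toWeight n x = toWeight n y) :
    ∀ k < n, x k = y k := by
  have key : ∀ d k, k + d + 1 = n → x k = y k := by
    intro d
    induction d with
    | zero =>
      intro k hk
      have := congrFun h ⟨k, by omega⟩
      simpa [toWeight, show ¬ k + 1 < n by omega] using this
    | succ d ih =>
      intro k hk
      have h1 := congrFun h ⟨k, by omega⟩
      have h2 := ih (k + 1) (by omega)
      simp only [toWeight, show k + 1 < n by omega, if_true] at h1
      omega
  exact fun k hk => key (n - 1 - k) k (by omega)

/-- The Coxeter element `s_1 ⋯ s_n`. -/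
theorem foldr_range'_signedAct (n : ℕ) (x : ℕ → ℤ) (d : ℕ) (hd : d + 1 ≤ n) :
    (List.range' (n - (d + 1)) (d + 1)).foldr (signedAct n) x = fun k =>
      if k < n - (d + 1) ∨ n ≤ k then x k else if k = n - (d + 1) then - x (n - 1)
        else x (k - 1) := by
  induction d with
  | zero =>
    funext k
    simp only [zero_add, List.range'_one, List.foldr_cons, List.foldr_nil, signedAct,
      show ¬ n - 1 + 1 < n by omega, if_false]
    grind
  | succ d ih =>
    rw [List.range'_succ, List.foldr_cons, show n - (d + 1 + 1) + 1 = n - (d + 1) by omega,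
      ih (by omega)]
    funext k
    simp only [signedAct, show n - (d + 1 + 1) + 1 < n by omega, if_true]
    grind

/-- The action of the Coxeter element. -/
def coxeterAct (n : ℕ) (x : ℕ → ℤ) : ℕ → ℤ := fun k =>
  if n ≤ k then x k else if k = 0 then - x (n - 1) else x (k - 1)

theorem foldr_finRange_signedAct (n : ℕ) (hn : 0 < n) (x : ℕ → ℤ) :
    ((List.finRange n).map Fin.val).foldr (signedAct n) x = coxeterAct n x := by
  have h := foldr_range'_signedAct n x (n - 1) (by omega)
  rw [show n - (n - 1 + 1) = 0 by omega, show n - 1 + 1 = n by omega,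
    ← List.range_eq_range'] at h
  rw [List.map_coe_finRange_eq_range, h]
  funext k
  simp [coxeterAct]

/-- The Coxeter element is a cyclic shift with one sign change; for `p = n` every coordinate has
been negated once, so `w_0` acts as `-1`. -/
theorem coxeterAct_iterate (n : ℕ) (x : ℕ → ℤ) (p : ℕ) (hp : p ≤ n) :
    (coxeterAct n)^[p] x = fun k =>
      if n ≤ k then x k else if k < p then - x (k + n - p) else x (k - p) := by
  induction p with
  | zero =>
    funext k
    simp
  | succ p ih =>
    rw [Function.iterate_succ_apply', ih (by omega)]
    funext k
    simp only [coxeterAct]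
    grind

theorem foldr_longestWord (n : ℕ) (hn : 0 < n) (x : ℕ → ℤ) :
    ((longestWord n).map Fin.val).foldr (signedAct n) x = (coxeterAct n)^[n] x := by
  have key : ∀ (l : List (Fin n)) (y : ℕ → ℤ),
      ((l.flatMap fun _ => List.finRange n).map Fin.val).foldr (signedAct n) y =
        (coxeterAct n)^[l.length] y := by
    intro l
    induction l with
    | nil => exact fun _ => rfl
    | cons a l ih =>
      intro y
      rw [List.flatMap_cons, List.map_append, List.foldr_append, foldr_finRange_signedAct n hn,
        ih, List.length_cons, Function.iterate_succ_apply']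
  have := key (List.finRange n) x
  rwa [List.length_finRange] at this

theorem simpleReflection_involutive (n : ℕ) (i : Fin n) (lam : Fin n → ℤ) :
    simpleReflection n i (simpleReflection n i lam) = lam := by
  funext j
  have : cartan n i i = 2 := by simp [cartan]
  simp only [simpleReflection, this]
  ring

/-- Deleting the last letter of the word of `w_0` gives a word of `w_0 s_n` of length `n² - 1`, the
upper bound for reduced words needed below. -/
theorem exists_longestWord_eq (n : ℕ) (hn : 0 < n) :
    ∃ w : List (Fin n), longestWord n = w ++ [lastIdx n hn] ∧ w.length + 1 = n * n := by
  obtain ⟨n, rfl⟩ : ∃ m, n = m + 1 := ⟨n - 1, by omega⟩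
  have h1 : List.finRange (n + 1) = (List.finRange n).map Fin.castSucc ++ [Fin.last n] :=
    List.finRange_succ_last
  refine ⟨(((List.finRange n).map Fin.castSucc).flatMap fun _ => List.finRange (n + 1)) ++
    (List.finRange n).map Fin.castSucc, ?_, ?_⟩
  · have h2 : ∀ M : List (Fin (n + 1)), ((List.finRange (n + 1)).flatMap fun _ => M) =
        (((List.finRange n).map Fin.castSucc).flatMap fun _ => M) ++ M := by
      intro M
      rw [h1, List.flatMap_append, List.flatMap_singleton]
    have h3 : ∀ L : List (Fin (n + 1)), L ++ List.finRange (n + 1) =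
        L ++ (List.finRange n).map Fin.castSucc ++ [lastIdx (n + 1) hn] := by
      intro L
      rw [h1, List.append_assoc]
      rfl
    rw [longestWord, h2, h3]
  · simp only [List.length_append, List.length_flatMap, List.length_finRange, List.length_map,
      List.map_const', List.sum_replicate, smul_eq_mul]
    ring

/-! ### Inversions -/

/-- The short inversions of a coordinate vector: triples `(p, q, e)` with `e = ± 1` and
`x_p < e x_q`. -/
def shortInv (n : ℕ) (x : ℕ → ℤ) : Finset (ℕ × ℕ × ℤ) :=
  (Finset.range n ×ˢ Finset.range n ×ˢ {1, -1}).filter fun t =>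
    t.1 < t.2.1 ∧ x t.1 < t.2.2 * x t.2.1

theorem mem_shortInv {n : ℕ} {x : ℕ → ℤ} {p q : ℕ} {e : ℤ} :
    (p, q, e) ∈ shortInv n x ↔ p < q ∧ q < n ∧ (e = 1 ∨ e = -1) ∧ x p < e * x q := by
  simp only [shortInv, Finset.mem_filter, Finset.mem_product, Finset.mem_range,
    Finset.mem_insert, Finset.mem_singleton]
  constructor
  · rintro ⟨⟨h1, h2, h3⟩, h4, h5⟩
    exact ⟨h4, h2, h3, h5⟩
  · rintro ⟨h1, h2, h3, h4⟩
    exact ⟨⟨by omega, h2, h3⟩, h1, h4⟩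

/-- The transposition permutes the inversion conditions, and only `(i, i + 1, 1)` can become a new
inversion. -/
theorem card_shortInv_signedAct_of_lt {n i : ℕ} (hi : i + 1 < n) (x : ℕ → ℤ) :
    (shortInv n (signedAct n i x)).card ≤ (shortInv n x).card + 1 := by
  let s : ℕ → ℕ := fun k => if k = i then i + 1 else if k = i + 1 then i else k
  -- On the pair `(i, i + 1)` only `e = -1` remains after the erasure. Its condition `x_i + x_{i+1}
  -- < 0` is symmetric, so the triple is kept.
  let f : ℕ × ℕ × ℤ → ℕ × ℕ × ℤ := fun t =>
    if t.1 = i ∧ t.2.1 = i + 1 then t else (s t.1, s t.2.1, t.2.2)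
  have hx : ∀ k, signedAct n i x k = x (s k) := by
    intro k
    simp only [signedAct, hi, if_true, s]
    split_ifs <;> rfl
  have h1 : (shortInv n (signedAct n i x)).card ≤
      ((shortInv n (signedAct n i x)).erase (i, i + 1, 1)).card + 1 :=
    Nat.sub_le_iff_le_add.1 Finset.pred_card_le_card_erase
  refine h1.trans (Nat.add_le_add_right ?_ 1)
  refine Finset.card_le_card_of_injOn f ?_ ?_
  · rintro ⟨p, q, e⟩ ht
    obtain ⟨hne, ht⟩ := Finset.mem_erase.1 (Finset.mem_coe.1 ht)
    rw [mem_shortInv, hx, hx] at ht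
    obtain ⟨h1, h2, h3, h4⟩ := ht
    rw [Finset.mem_coe]
    by_cases hc : p = i ∧ q = i + 1
    · obtain ⟨rfl, rfl⟩ := hc
      have he : e = -1 := by
        rcases h3 with rfl | rfl
        · exact absurd rfl hne
        · rfl
      subst he
      simp only [f, and_self, if_true, mem_shortInv]
      simp only [s, if_true, show ¬ p + 1 = p by omega, if_false] at h4
      refine ⟨h1, h2, Or.inr trivial, by omega⟩
    · simp only [f, hc, if_false, mem_shortInv]
      refine ⟨?_, ?_, h3, h4⟩ <;> simp only [s] <;> grind
  · rintro ⟨p, q, e⟩ ht ⟨p', q', e'⟩ ht' h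
    rw [Finset.mem_coe, Finset.mem_erase, mem_shortInv] at ht ht'
    simp only [f, s] at h
    split_ifs at h <;> simp only [Prod.mk.injEq] at h ⊢ <;> omega

/-- Negating the last coordinate exchanges `e` and `-e` in the conditions with `q = i`; the smaller
index `p` is never the last one. -/
theorem card_shortInv_signedAct_last {n i : ℕ} (hi : i + 1 = n) (x : ℕ → ℤ) :
    (shortInv n (signedAct n i x)).card ≤ (shortInv n x).card := by
  refine Finset.card_le_card_of_injOn
    (fun t => (t.1, t.2.1, if t.2.1 = i then - t.2.2 else t.2.2)) ?_ ?_
  · rintro ⟨p, q, e⟩ ht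
    rw [Finset.mem_coe, mem_shortInv] at ht
    rw [Finset.mem_coe, mem_shortInv]
    obtain ⟨h1, h2, h3, h4⟩ := ht
    simp only [signedAct, show ¬ i + 1 < n by omega, if_false] at h4
    refine ⟨h1, h2, ?_, ?_⟩
    · dsimp only
      split_ifs <;> omega
    · rw [if_neg (by omega)] at h4
      split_ifs at h4 ⊢ with h
      · subst h
        linarith
      · exact h4
  · rintro ⟨p, q, e⟩ ht ⟨p', q', e'⟩ ht' h
    simp only [Prod.mk.injEq] at h
    obtain ⟨rfl, rfl, h⟩ := h
    split_ifs at h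
    · rw [neg_inj.1 h]
    · rw [h]

theorem card_shortInv_foldr (n : ℕ) (x : ℕ → ℤ) (w : List (Fin n)) :
    (shortInv n ((w.map Fin.val).foldr (signedAct n) x)).card ≤
      (shortInv n x).card + w.countP (fun i => decide (i.val + 1 < n)) := by
  induction w with
  | nil => simp
  | cons i w ih =>
    rw [List.map_cons, List.foldr_cons, List.countP_cons]
    by_cases hi : i.val + 1 < n
    · have := card_shortInv_signedAct_of_lt hi ((w.map Fin.val).foldr (signedAct n) x)
      simp only [hi, decide_true, if_true]
      omega
    · have := card_shortInv_signedAct_last (n := n) (i := i.val) (by omega)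
        ((w.map Fin.val).foldr (signedAct n) x)
      omega

/-- The number of negative coordinates. -/
def negCount (n : ℕ) (x : ℕ → ℤ) : ℕ := ((Finset.range n).filter fun k => x k < 0).card

theorem negCount_signedAct_of_lt {n i : ℕ} (hi : i + 1 < n) (x : ℕ → ℤ) :
    negCount n (signedAct n i x) = negCount n x := by
  refine Finset.card_nbij' (Equiv.swap i (i + 1)) (Equiv.swap i (i + 1)) ?_ ?_ ?_ ?_
  · intro k hk
    simp only [Finset.coe_filter, Finset.mem_range, Set.mem_ofPred_eq, signedAct, hi,
      if_true, Equiv.swap_apply_def] at hk ⊢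
    grind
  · intro k hk
    simp only [Finset.coe_filter, Finset.mem_range, Set.mem_ofPred_eq, signedAct, hi,
      if_true, Equiv.swap_apply_def] at hk ⊢
    grind
  · intro k _
    simp
  · intro k _
    simp

theorem negCount_signedAct_last {n i : ℕ} (hi : i + 1 = n) (x : ℕ → ℤ) (hx : x i ≠ 0) :
    negCount n (signedAct n i x) + 2 * (if x i < 0 then 1 else 0) = negCount n x + 1 := by
  have key : ∀ y : ℕ → ℤ, negCount n y =
      ((Finset.range i).filter fun k => y k < 0).card + if y i < 0 then 1 else 0 := by
    intro y
    rw [negCount, ← hi, Finset.range_add_one, Finset.filter_insert]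
    split_ifs with h
    · rw [Finset.card_insert_of_notMem (by simp)]
    · rfl
  rw [key, key]
  have h1 : signedAct n i x i = - x i := by simp [signedAct, show ¬ i + 1 < n by omega]
  have h2 : (Finset.range i).filter (fun k => signedAct n i x k < 0) =
      (Finset.range i).filter fun k => x k < 0 := by
    refine Finset.filter_congr fun k hk => ?_
    rw [Finset.mem_range] at hk
    simp [signedAct, show ¬ i + 1 < n by omega, hk.ne]
  rw [h1, h2]
  split_ifs <;> omega

/-- The number of times the last simple reflection is applied to a vector with negative last
coordinate. -/
def badCount (n : ℕ) (x : ℕ → ℤ) : List (Fin n) → ℕ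
  | [] => 0
  | i :: w => badCount n x w +
    if i.val + 1 = n ∧ (w.map Fin.val).foldr (signedAct n) x i < 0 then 1 else 0

theorem foldr_signedAct_ne_zero {n : ℕ} {x : ℕ → ℤ} (hx : ∀ k < n, x k ≠ 0) (w : List (Fin n)) :
    ∀ k < n, (w.map Fin.val).foldr (signedAct n) x k ≠ 0 := by
  induction w with
  | nil => exact hx
  | cons i w ih =>
    intro k hk
    have hi := i.2
    simp only [List.map_cons, List.foldr_cons, signedAct]
    split_ifs
    · exact ih _ (by omega)
    · exact ih _ (by omega)
    · exact ih _ hk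
    · have := ih i.val hi
      omega
    · exact ih _ hk

/-- Each `s_n` raises the number of negative coordinates by one, except that it lowers it by one
when applied to a negative last coordinate. An exception costs two letters `s_n` in the balance. -/
theorem negCount_foldr {n : ℕ} {x : ℕ → ℤ} (hx : ∀ k < n, x k ≠ 0) (w : List (Fin n)) :
    negCount n ((w.map Fin.val).foldr (signedAct n) x) + 2 * badCount n x w =
      negCount n x + w.countP (fun i => decide (¬ i.val + 1 < n)) := by
  induction w with
  | nil => simp [badCount]
  | cons i w ih =>
    rw [List.map_cons, List.foldr_cons, List.countP_cons, badCount]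
    by_cases hi : i.val + 1 < n
    · rw [negCount_signedAct_of_lt hi, if_neg (by omega), if_neg (by simpa using hi)]
      omega
    · have hi' : i.val + 1 = n := by omega
      have := negCount_signedAct_last hi' ((w.map Fin.val).foldr (signedAct n) x)
        (foldr_signedAct_ne_zero hx w i.val i.2)
      simp only [hi', true_and, lt_self_iff_false, not_false_eq_true, decide_true, if_true]
      omega

/-- A dominant regular coordinate vector. -/
def rhoVec (n : ℕ) : ℕ → ℤ := fun k => n - k

/-- The image of `rhoVec` under `w_0 s_n`. -/
def lowVec (n : ℕ) : ℕ → ℤ := fun k => if k + 1 < n then k - n else n - k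

theorem shortInv_rhoVec (n : ℕ) : (shortInv n (rhoVec n)).card = 0 := by
  rw [Finset.card_eq_zero, Finset.eq_empty_iff_forall_notMem]
  rintro ⟨p, q, e⟩ h
  rw [mem_shortInv] at h
  obtain ⟨h1, h2, rfl | rfl, h4⟩ := h <;> simp only [rhoVec] at h4 <;> omega

/-- The absolute values of `lowVec` decrease and all entries except the last are negative, so every
condition with `p < q` and either sign holds. -/
theorem shortInv_lowVec (n : ℕ) : n * n - n ≤ (shortInv n (lowVec n)).card := by
  have h := Finset.offDiag_card (Finset.range n)
  rw [Finset.card_range] at h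
  rw [← h]
  refine Finset.card_le_card_of_injOn
    (fun t => if t.1 < t.2 then (t.1, t.2, 1) else (t.2, t.1, -1)) ?_ ?_
  · rintro ⟨p, q⟩ ht
    simp only [Finset.coe_offDiag, Set.mem_offDiag, Finset.coe_range, Set.mem_Iio] at ht
    rw [Finset.mem_coe]
    simp only
    split_ifs with hc
    · rw [mem_shortInv]
      refine ⟨hc, ht.2.1, Or.inl rfl, ?_⟩
      simp only [lowVec]
      split_ifs <;> omega
    · rw [mem_shortInv]
      refine ⟨by omega, ht.1, Or.inr rfl, ?_⟩
      simp only [lowVec]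
      split_ifs <;> omega
  · rintro ⟨p, q⟩ ht ⟨p', q'⟩ ht' h
    simp only at h
    split_ifs at h <;> simp only [Prod.mk.injEq] at h ⊢ <;> omega

theorem negCount_rhoVec (n : ℕ) : negCount n (rhoVec n) = 0 := by
  rw [negCount, Finset.card_eq_zero, Finset.filter_eq_empty_iff]
  intro k hk
  rw [Finset.mem_range] at hk
  simp only [rhoVec]
  omega

theorem negCount_lowVec (n : ℕ) : negCount n (lowVec n) = n - 1 := by
  have : (Finset.range n).filter (fun k => lowVec n k < 0) = Finset.range (n - 1) := by
    ext k
    rw [Finset.mem_filter, Finset.mem_range, Finset.mem_range, lowVec]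
    split_ifs <;> omega
  rw [negCount, this, Finset.card_range]

theorem shortInv_congr {n : ℕ} {x y : ℕ → ℤ} (h : ∀ k < n, x k = y k) :
    shortInv n x = shortInv n y := by
  ext ⟨p, q, e⟩
  rw [mem_shortInv, mem_shortInv]
  constructor
  · rintro ⟨h1, h2, h3, h4⟩
    exact ⟨h1, h2, h3, by rwa [← h p (by omega), ← h q h2]⟩
  · rintro ⟨h1, h2, h3, h4⟩
    exact ⟨h1, h2, h3, by rwa [h p (by omega), h q h2]⟩

theorem negCount_congr {n : ℕ} {x y : ℕ → ℤ} (h : ∀ k < n, x k = y k) :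
    negCount n x = negCount n y := by
  rw [negCount, negCount]
  congr 1
  refine Finset.filter_congr fun k hk => ?_
  rw [h k (Finset.mem_range.1 hk)]

theorem foldr_eq_lowVec {n : ℕ} (hn : 0 < n) {u : List (Fin n)}
    (hu : weylOf n u = weylOf n (longestWord n ++ [lastIdx n hn])) :
    ∀ k < n, (u.map Fin.val).foldr (signedAct n) (rhoVec n) k = lowVec n k := by
  have h1 := congrFun hu (toWeight n (rhoVec n))
  rw [weylOf_toWeight, weylOf_toWeight, List.map_append, List.foldr_append,
    foldr_longestWord n hn, coxeterAct_iterate n _ n le_rfl] at h1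
  intro k hk
  rw [toWeight_injective h1 k hk]
  simp only [not_le.2 hk, if_false, hk, if_true, List.map_cons, List.map_nil, List.foldr_cons,
    List.foldr_nil, lastIdx, signedAct, rhoVec, lowVec, show ¬ n - 1 + 1 < n by omega,
    Nat.add_sub_cancel]
  split_ifs <;> omega

/-- In a reduced word of `w_0 s_n` all occurrences of `s_n` are applied to positive last
coordinates. -/
theorem badCount_eq_zero {n : ℕ} (hn : 0 < n) {u : List (Fin n)} (hred : IsReducedWord n u)
    (hu : weylOf n u = weylOf n (longestWord n ++ [lastIdx n hn])) :
    badCount n (rhoVec n) u = 0 := by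
  have hlow := foldr_eq_lowVec hn hu
  obtain ⟨w, hw1, hw2⟩ := exists_longestWord_eq n hn
  -- Together with the counts below this leaves no slack: at least `n² - n` letters differ from
  -- `s_n`, exactly `n - 1 + 2 · badCount` letters equal `s_n`, and there are at most `n² - 1`
  -- letters.
  have hlen : u.length ≤ w.length := by
    refine hred w ?_
    rw [hu, hw1]
    funext lam
    simp [weylOf, simpleReflection_involutive]
  have h1 := card_shortInv_foldr n (rhoVec n) u
  have h2 := negCount_foldr (x := rhoVec n) (fun k hk => by simp only [rhoVec]; omega) u
  rw [shortInv_congr hlow, shortInv_rhoVec] at h1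
  rw [negCount_congr hlow, negCount_rhoVec, negCount_lowVec] at h2
  have h3 := shortInv_lowVec n
  have h4 := List.length_eq_countP_add_countP (l := u) (fun i => decide (i.val + 1 < n))
  have h5 : u.countP (fun i => decide ¬ decide (i.val + 1 < n) = true) =
      u.countP (fun i => decide (¬ i.val + 1 < n)) := by simp
  rw [h5] at h4
  have h6 : n ≤ n * n := Nat.le_mul_self n
  omega

/-! ### Rows of products with Chevalley generators -/

theorem fMat_mul_inl (n : ℕ) (i a c : Fin n) (g : Matrix (BasisIdx n) (Fin n) ℂ) :
    (fMat n i * g) (.inl a) c = if a.val = i.val + 1 then g (.inl i) c else 0 := by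
  simp [Matrix.mul_apply, fMat, ite_and]

theorem fMat_mul_inr_of_lt (n : ℕ) (i a c : Fin n) (h : i.val + 1 < n)
    (g : Matrix (BasisIdx n) (Fin n) ℂ) :
    (fMat n i * g) (.inr a) c = if a = i then g (.inr ⟨i.val + 1, h⟩) c else 0 := by
  have h1 : ∀ b : Fin n, b.val = i.val + 1 ↔ b = ⟨i.val + 1, h⟩ :=
    fun b => by simp [Fin.ext_iff]
  by_cases ha : a = i <;> simp [Matrix.mul_apply, fMat, h1, h.ne, ha]

theorem fMat_mul_inr_last (n : ℕ) (i a c : Fin n) (h : i.val + 1 = n)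
    (g : Matrix (BasisIdx n) (Fin n) ℂ) :
    (fMat n i * g) (.inr a) c = if a = i then g (.inl i) c else 0 := by
  have h2 : ∀ b : Fin n, ¬ b.val = n := fun b => by omega
  by_cases ha : a = i <;> simp [Matrix.mul_apply, fMat, h, h2, ha]

theorem eMat_mul_inl_of_lt (n : ℕ) (i a c : Fin n) (h : i.val + 1 < n)
    (g : Matrix (BasisIdx n) (Fin n) ℂ) :
    (eMat n i * g) (.inl a) c = if a = i then g (.inl ⟨i.val + 1, h⟩) c else 0 := by
  have h1 : ∀ b : Fin n, b.val = i.val + 1 ↔ b = ⟨i.val + 1, h⟩ :=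
    fun b => by simp [Fin.ext_iff]
  by_cases ha : a = i <;> simp [Matrix.mul_apply, eMat, fMat, h1, h.ne, ha]

theorem eMat_mul_inl_last (n : ℕ) (i a c : Fin n) (h : i.val + 1 = n)
    (g : Matrix (BasisIdx n) (Fin n) ℂ) :
    (eMat n i * g) (.inl a) c = if a = i then g (.inr i) c else 0 := by
  have h2 : ∀ b : Fin n, ¬ b.val = n := fun b => by omega
  by_cases ha : a = i <;> simp [Matrix.mul_apply, eMat, fMat, h, h2, ha]

theorem eMat_mul_inr (n : ℕ) (i a c : Fin n) (g : Matrix (BasisIdx n) (Fin n) ℂ) :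
    (eMat n i * g) (.inr a) c = if a.val = i.val + 1 then g (.inr i) c else 0 := by
  simp [Matrix.mul_apply, eMat, fMat, ite_and]

/-! ### Inverses of the representatives of the simple reflections -/

theorem xMat_mul_xMat (n : ℕ) (i : Fin n) (s t : ℂ) : xMat n i s * xMat n i t = xMat n i (s + t) := by
  have h : eMat n i * eMat n i = 0 := by
    rw [eMat, ← Matrix.transpose_mul, fMat_mul_self, Matrix.transpose_zero]
  simp only [xMat, add_mul, mul_add, one_mul, mul_one, Matrix.smul_mul, Matrix.mul_smul, h,
    smul_zero, add_zero, add_smul]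
  abel

theorem yMat_mul_yMat (n : ℕ) (i : Fin n) (s t : ℂ) : yMat n i s * yMat n i t = yMat n i (s + t) := by
  simp only [yMat, add_mul, mul_add, one_mul, mul_one, Matrix.smul_mul, Matrix.mul_smul,
    fMat_mul_self, smul_zero, add_zero, add_smul]
  abel

theorem inv_sBar (n : ℕ) (i : Fin n) :
    (sBar n i)⁻¹ = xMat n i 1 * yMat n i (-1) * xMat n i 1 := by
  refine Matrix.inv_eq_left_inv ?_
  have hx : xMat n i 0 = 1 := by simp [xMat]
  have hy : yMat n i 0 = 1 := by simp [yMat]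
  have h1 : xMat n i 1 * xMat n i (-1) = 1 := by rw [xMat_mul_xMat, add_neg_cancel, hx]
  have h2 : yMat n i (-1) * yMat n i 1 = 1 := by rw [yMat_mul_yMat, neg_add_cancel, hy]
  calc xMat n i 1 * yMat n i (-1) * xMat n i 1 * sBar n i
      = xMat n i 1 * yMat n i (-1) * (xMat n i 1 * xMat n i (-1)) * yMat n i 1 *
          xMat n i (-1) := by simp only [sBar, Matrix.mul_assoc]
    _ = xMat n i 1 * (yMat n i (-1) * yMat n i 1) * xMat n i (-1) := by
        rw [h1, Matrix.mul_one, Matrix.mul_assoc (xMat n i 1)]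
    _ = 1 := by rw [h2, Matrix.mul_one, h1]

theorem inv_sBar_mul (n : ℕ) (i : Fin n) (g : Matrix (BasisIdx n) (Fin n) ℂ) :
    (sBar n i)⁻¹ * g = xMat n i 1 * (yMat n i (-1) * (xMat n i 1 * g)) := by
  rw [inv_sBar, Matrix.mul_assoc, Matrix.mul_assoc]

theorem xMat_one_mul (n : ℕ) (i : Fin n) (g : Matrix (BasisIdx n) (Fin n) ℂ) (r c) :
    (xMat n i 1 * g) r c = g r c + (eMat n i * g) r c := by
  simp [xMat, Matrix.add_mul]

theorem yMat_neg_one_mul (n : ℕ) (i : Fin n) (g : Matrix (BasisIdx n) (Fin n) ℂ) (r c) :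
    (yMat n i (-1) * g) r c = g r c - (fMat n i * g) r c := by
  simp [yMat, Matrix.add_mul, sub_eq_add_neg]

theorem inv_sBar_mul_inl_of_lt (n : ℕ) (i a c : Fin n) (h : i.val + 1 < n)
    (g : Matrix (BasisIdx n) (Fin n) ℂ) :
    ((sBar n i)⁻¹ * g) (.inl a) c =
      (if a.val = i.val + 1 then -1 else 1) *
        g (.inl (Equiv.swap i ⟨i.val + 1, h⟩ a)) c := by
  have hj : ∀ b : Fin n, b.val = i.val + 1 ↔ b = ⟨i.val + 1, h⟩ :=
    fun b => by simp [Fin.ext_iff]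
  have hne : (⟨i.val + 1, h⟩ : Fin n) ≠ i := by simp [Fin.ext_iff]
  simp only [inv_sBar_mul, xMat_one_mul, yMat_neg_one_mul, eMat_mul_inl_of_lt n i _ _ h,
    fMat_mul_inl, hj, Equiv.swap_apply_def]
  rcases eq_or_ne a i with rfl | h1
  · simp [hne, hne.symm]
  · rcases eq_or_ne a ⟨i.val + 1, h⟩ with rfl | h2
    · simp [hne]
    · simp [h1, h2]

theorem inv_sBar_mul_inr_of_lt (n : ℕ) (i a c : Fin n) (h : i.val + 1 < n)
    (g : Matrix (BasisIdx n) (Fin n) ℂ) :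
    ((sBar n i)⁻¹ * g) (.inr a) c =
      (if a = i then -1 else 1) * g (.inr (Equiv.swap i ⟨i.val + 1, h⟩ a)) c := by
  have hj : ∀ b : Fin n, b.val = i.val + 1 ↔ b = ⟨i.val + 1, h⟩ :=
    fun b => by simp [Fin.ext_iff]
  have hne : (⟨i.val + 1, h⟩ : Fin n) ≠ i := by simp [Fin.ext_iff]
  simp only [inv_sBar_mul, xMat_one_mul, yMat_neg_one_mul, eMat_mul_inr,
    fMat_mul_inr_of_lt n i _ _ h, hj, Equiv.swap_apply_def]
  rcases eq_or_ne a i with rfl | h1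
  · simp [hne.symm]
  · rcases eq_or_ne a ⟨i.val + 1, h⟩ with rfl | h2
    · simp [hne, hne.symm]
    · simp [h1, h2]

theorem inv_sBar_mul_inl_last (n : ℕ) (i a c : Fin n) (h : i.val + 1 = n)
    (g : Matrix (BasisIdx n) (Fin n) ℂ) :
    ((sBar n i)⁻¹ * g) (.inl a) c = if a = i then g (.inr i) c else g (.inl a) c := by
  have h2 : ∀ b : Fin n, ¬ b.val = i.val + 1 := fun b => by omega
  simp only [inv_sBar_mul, xMat_one_mul, yMat_neg_one_mul, eMat_mul_inl_last n i _ _ h,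
    fMat_mul_inr_last n i _ _ h, fMat_mul_inl, eMat_mul_inr, h2, if_false, if_true]
  split_ifs with h1
  · subst h1
    ring
  · ring

theorem inv_sBar_mul_inr_last (n : ℕ) (i a c : Fin n) (h : i.val + 1 = n)
    (g : Matrix (BasisIdx n) (Fin n) ℂ) :
    ((sBar n i)⁻¹ * g) (.inr a) c = if a = i then - g (.inl i) c else g (.inr a) c := by
  have h2 : ∀ b : Fin n, ¬ b.val = i.val + 1 := fun b => by omega
  simp only [inv_sBar_mul, xMat_one_mul, yMat_neg_one_mul, eMat_mul_inl_last n i _ _ h,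
    fMat_mul_inr_last n i _ _ h, eMat_mul_inr, h2, if_false, if_true]
  split_ifs with h1
  · subst h1
    ring
  · ring

/-! ### Extremal minors -/

/-- The row of the extremal weight vector with coordinate signs `x`. -/
def rowIdx (n : ℕ) (x : ℕ → ℤ) (a : Fin n) : BasisIdx n := if x a < 0 then .inr a else .inl a

/-- The sign which relates the minor with rows `rowIdx n x` to a generalized minor. -/
def flipSign (n : ℕ) (x : ℕ → ℤ) : ℂ :=
  ∏ a : Fin n, if x a < 0 then (-1) ^ (n - 1 - a.val) else 1

/-- The signed minor with rows `rowIdx n x`. -/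
def signedMinor (n : ℕ) (x : ℕ → ℤ) (g : Matrix (BasisIdx n) (Fin n) ℂ) : ℂ :=
  flipSign n x * (g.submatrix (rowIdx n x) id).det

/-- The lift exchanges two rows up to signs, and the exponents `n - 1 - a` in `flipSign` are chosen
to absorb these: moving one negative coordinate by one place changes `flipSign` by `-1`. -/
theorem signedMinor_inv_sBar_of_lt {n : ℕ} {i : Fin n} (h : i.val + 1 < n) (x : ℕ → ℤ)
    (g : Matrix (BasisIdx n) (Fin n) ℂ) :
    signedMinor n x ((sBar n i)⁻¹ * g) = signedMinor n (signedAct n i x) g := by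
  let j : Fin n := ⟨i.val + 1, h⟩
  have hne : i ≠ j := by simp [Fin.ext_iff, j]
  let σ := Equiv.swap i j
  have hσ : ∀ a : Fin n, signedAct n i x (σ a) = x a := by
    intro a
    simp only [signedAct, h, if_true, σ, Equiv.swap_apply_def, Fin.ext_iff, j]
    grind
  have hσ' : ∀ a : Fin n, signedAct n i x a = x (σ a) := by
    intro a
    rw [← hσ (σ a), Equiv.swap_apply_self]
  let t : Fin n → ℂ := fun a => if x a < 0 ∧ (a = i ∨ a = j) then -1 else 1
  -- The extra factor `-1` at `j` cancels the sign of the transposition of rows, so that only `∏ t`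
  -- is left.
  let s : Fin n → ℂ := fun a => t a * if a = j then -1 else 1
  have hdet : (((sBar n i)⁻¹ * g).submatrix (rowIdx n x) id).det =
      (∏ a, t a) * (g.submatrix (rowIdx n (signedAct n i x)) id).det := by
    have h1 : ((sBar n i)⁻¹ * g).submatrix (rowIdx n x) id = Matrix.of fun a b =>
        s a * ((g.submatrix (rowIdx n (signedAct n i x)) id).submatrix σ id) a b := by
      ext a b
      simp only [Matrix.submatrix_apply, Matrix.of_apply, id, rowIdx, hσ]
      have hj : a.val = i.val + 1 ↔ a = j := by simp [Fin.ext_iff, j]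
      by_cases hxa : x a < 0
      · simp only [hxa, if_true, inv_sBar_mul_inr_of_lt n i _ _ h, s, t, true_and]
        congr 1
        rcases eq_or_ne a i with rfl | h1
        · simp [hne]
        · rcases eq_or_ne a j with rfl | h2
          · simp [hne.symm]
          · simp [h1, h2]
      · simp only [hxa, if_false, inv_sBar_mul_inl_of_lt n i _ _ h, s, t, false_and, hj, one_mul]
        rfl
    rw [h1, Matrix.det_mul_column, Matrix.det_permute, Equiv.Perm.sign_swap hne,
      Finset.prod_mul_distrib, Finset.prod_ite_eq' Finset.univ j]
    simp
  have hflip : flipSign n (signedAct n i x) = flipSign n x * ∏ a, t a := by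
    rw [flipSign, ← Equiv.prod_comp σ, flipSign, ← Finset.prod_mul_distrib]
    refine Finset.prod_congr rfl fun a _ => ?_
    rw [hσ]
    by_cases hxa : x a < 0
    · simp only [hxa, if_true, t, true_and]
      rcases eq_or_ne a i with rfl | h1
      · have h2 : (σ a).val = a.val + 1 := by simp [σ, j]
        rw [h2, if_pos (Or.inl rfl), show n - 1 - a.val = (n - 1 - (a.val + 1)) + 1 by omega,
          pow_succ]
        ring
      · rcases eq_or_ne a j with rfl | h2
        · have h2 : (σ j).val = i.val := by simp [σ]
          have h3 : j.val = i.val + 1 := rfl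
          rw [h2, h3, if_pos (Or.inr rfl), show n - 1 - i.val = (n - 1 - (i.val + 1)) + 1 by omega,
            pow_succ]
        · simp [σ, Equiv.swap_apply_of_ne_of_ne h1 h2, h1, h2]
    · simp [hxa, t]
  rw [signedMinor, signedMinor, hdet, hflip]
  ring

/-- The lift of `s_n` exchanges the rows `n` and `\bar n`, with a minus sign only when an entry of
the row `\bar n` is read. The exponent in `flipSign` is `0` at the last coordinate, so this sign is
not absorbed; `badCount` records it. -/
theorem signedMinor_inv_sBar_last {n : ℕ} {i : Fin n} (h : i.val + 1 = n) (x : ℕ → ℤ)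
    (hx : x i ≠ 0) (g : Matrix (BasisIdx n) (Fin n) ℂ) :
    signedMinor n x ((sBar n i)⁻¹ * g) =
      (if x i < 0 then -1 else 1) * signedMinor n (signedAct n i x) g := by
  have hy : ∀ a : Fin n, signedAct n i x a = if a = i then - x i else x a := by
    intro a
    simp only [signedAct, show ¬ i.val + 1 < n by omega, if_false, Fin.ext_iff]
  have hdet : (((sBar n i)⁻¹ * g).submatrix (rowIdx n x) id).det =
      (if x i < 0 then -1 else 1) * (g.submatrix (rowIdx n (signedAct n i x)) id).det := by
    have h1 : ((sBar n i)⁻¹ * g).submatrix (rowIdx n x) id = Matrix.of fun a b =>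
        (if a = i then (if x i < 0 then -1 else 1) else 1) *
          (g.submatrix (rowIdx n (signedAct n i x)) id) a b := by
      ext a b
      simp only [Matrix.submatrix_apply, Matrix.of_apply, id, rowIdx, hy]
      rcases eq_or_ne a i with rfl | h1
      · by_cases hxa : x a < 0
        · simp [hxa, inv_sBar_mul_inr_last n a _ _ h, show ¬ 0 < x a by omega]
        · simp [hxa, inv_sBar_mul_inl_last n a _ _ h, show 0 < x a by omega]
      · by_cases hxa : x a < 0
        · simp [hxa, inv_sBar_mul_inr_last n i _ _ h, h1]
        · simp [hxa, inv_sBar_mul_inl_last n i _ _ h, h1]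
    rw [h1, Matrix.det_mul_column, Finset.prod_ite_eq' Finset.univ i, if_pos (Finset.mem_univ i)]
  have hflip : flipSign n (signedAct n i x) = flipSign n x := by
    rw [flipSign, flipSign]
    refine Finset.prod_congr rfl fun a _ => ?_
    rw [hy]
    rcases eq_or_ne a i with rfl | h1
    · simp [show n - 1 - a.val = 0 by omega]
    · simp [h1]
  rw [signedMinor, signedMinor, hdet, hflip]
  ring

theorem signedMinor_inv_weylLift {n : ℕ} {x : ℕ → ℤ} (hx : ∀ k < n, x k ≠ 0) (w : List (Fin n))
    (g : Matrix (BasisIdx n) (Fin n) ℂ) :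
    signedMinor n x ((weylLift n w)⁻¹ * g) =
      (-1) ^ badCount n x w * signedMinor n ((w.map Fin.val).foldr (signedAct n) x) g := by
  induction w generalizing g with
  | nil => simp [weylLift, badCount]
  | cons i w ih =>
    have h1 : (weylLift n (i :: w))⁻¹ = (weylLift n w)⁻¹ * (sBar n i)⁻¹ := by
      rw [weylLift, List.map_cons, List.prod_cons, Matrix.mul_inv_rev]
      rfl
    rw [h1, Matrix.mul_assoc, ih, List.map_cons, List.foldr_cons, badCount]
    by_cases hi : i.val + 1 < n
    · rw [signedMinor_inv_sBar_of_lt hi, if_neg (by omega), add_zero]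
    · have hi' : i.val + 1 = n := by omega
      rw [signedMinor_inv_sBar_last hi' _ (foldr_signedAct_ne_zero hx w i.val i.2)]
      simp only [hi', true_and]
      split_ifs
      · ring
      · ring

theorem principalMinor_lastIdx {n : ℕ} (hn : 0 < n) (g : Matrix (BasisIdx n) (BasisIdx n) ℂ) :
    principalMinor n (lastIdx n hn) g = (g.submatrix Sum.inl Sum.inl).det := by
  have h : ∀ a : Fin n, a ≤ lastIdx n hn := fun a => Fin.le_def.2 (by
    simp only [lastIdx]
    omega)
  rw [principalMinor, ← Matrix.det_submatrix_equiv_self (Equiv.subtypeUnivEquiv h)]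
  rfl

/-- The generalized minor `Δ_{w_0 s_n Λ_n, Λ_n}` is, up to sign, the minor in the first `n` columns
and the rows `\bar 1, …, \overline{n-1}, n`. -/
theorem generalizedMinor_eq_det {n : ℕ} (hn : 0 < n) {u : List (Fin n)} (hred : IsReducedWord n u)
    (hu : weylOf n u = weylOf n (longestWord n ++ [lastIdx n hn]))
    (g : Matrix (BasisIdx n) (BasisIdx n) ℂ) :
    generalizedMinor n (lastIdx n hn) u [] g =
      (∏ a : Fin n, (-1 : ℂ) ^ (n - 1 - a.val)) *
        (Matrix.of fun a b : Fin n =>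
          g (if a.val + 1 < n then .inr a else .inl a) (.inl b)).det := by
  have h1 : generalizedMinor n (lastIdx n hn) u [] g =
      signedMinor n (rhoVec n) ((weylLift n u)⁻¹ * g.submatrix id Sum.inl) := by
    have hρ : ∀ a : Fin n, ¬ rhoVec n a < 0 := fun a => by
      simp only [rhoVec]
      omega
    rw [generalizedMinor, principalMinor_lastIdx, signedMinor, flipSign]
    simp only [hρ, if_false, Finset.prod_const_one, one_mul]
    congr 1
    ext a b
    simp [weylLift, rowIdx, hρ, Matrix.mul_apply]
  rw [h1, signedMinor_inv_weylLift (fun k hk => by simp only [rhoVec]; omega),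
    badCount_eq_zero hn hred hu, pow_zero, one_mul, signedMinor]
  have hlow := foldr_eq_lowVec hn hu
  have hneg : ∀ a : Fin n, (u.map Fin.val).foldr (signedAct n) (rhoVec n) a < 0 ↔
      a.val + 1 < n := by
    intro a
    rw [hlow a a.2, lowVec]
    split_ifs <;> omega
  congr 1
  · refine Finset.prod_congr rfl fun a _ => ?_
    simp only [hneg]
    split_ifs with h
    · rfl
    · rw [show n - 1 - a.val = 0 by omega, pow_zero]
  · congr 1
    ext a b
    simp [rowIdx, hneg]

/-! ### The factors of `Θ^-` -/

theorem corootMat_mul (n : ℕ) (i : Fin n) (t : ℂ) (g : Matrix (BasisIdx n) (Fin n) ℂ) (r c) :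
    (corootMat n i t * g) r c = (match r with
      | .inl a => if a = i then t else if a.val = i.val + 1 then t⁻¹ else 1
      | .inr a => if a = i then t⁻¹ else if a.val = i.val + 1 then t else 1) * g r c := by
  rcases r with a | a <;> simp only [corootMat, Matrix.diagonal_mul]

theorem boldY_mul (n : ℕ) (i : Fin n) (t : ℂ) (g : Matrix (BasisIdx n) (Fin n) ℂ) (r c) :
    (boldY n i t * g) r c = (corootMat n i t⁻¹ * g) r c +
      t * (fMat n i * (corootMat n i t⁻¹ * g)) r c := by
  simp [boldY, yMat, Matrix.mul_assoc, Matrix.add_mul]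

theorem boldY_mul_inl (n : ℕ) (i a c : Fin n) {t : ℂ} (ht : t ≠ 0)
    (g : Matrix (BasisIdx n) (Fin n) ℂ) :
    (boldY n i t * g) (.inl a) c =
      if a = i then t⁻¹ * g (.inl a) c
      else if a.val = i.val + 1 then t * g (.inl a) c + g (.inl i) c else g (.inl a) c := by
  rw [boldY_mul, fMat_mul_inl, corootMat_mul, corootMat_mul]
  rcases eq_or_ne a i with rfl | h1
  · simp
  · simp only [h1, if_false, if_true, inv_inv]
    split_ifs
    · field_simp
    · ring

theorem boldY_mul_inr_of_lt (n : ℕ) (i a c : Fin n) (h : i.val + 1 < n) {t : ℂ} (ht : t ≠ 0)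
    (g : Matrix (BasisIdx n) (Fin n) ℂ) :
    (boldY n i t * g) (.inr a) c =
      if a = i then t * g (.inr a) c + g (.inr ⟨i.val + 1, h⟩) c
      else if a.val = i.val + 1 then t⁻¹ * g (.inr a) c else g (.inr a) c := by
  rw [boldY_mul, fMat_mul_inr_of_lt n i a c h, corootMat_mul, corootMat_mul]
  rcases eq_or_ne a i with rfl | h1
  · simp [Fin.ext_iff, ht]
  · simp only [h1, if_false, inv_inv]
    split_ifs <;> ring

theorem boldY_mul_inr_last (n : ℕ) (i a c : Fin n) (h : i.val + 1 = n) {t : ℂ} (ht : t ≠ 0)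
    (g : Matrix (BasisIdx n) (Fin n) ℂ) :
    (boldY n i t * g) (.inr a) c =
      if a = i then t * g (.inr a) c + g (.inl a) c else g (.inr a) c := by
  rw [boldY_mul, fMat_mul_inr_last n i a c h, corootMat_mul, corootMat_mul]
  rcases eq_or_ne a i with rfl | h1
  · simp [ht]
  · simp only [h1, if_false, inv_inv, show ¬ a.val = i.val + 1 by omega]
    ring

/-- The pairing of the upper and lower halves of two columns. -/
def halfPairing {n : ℕ} (g : Matrix (BasisIdx n) (Fin n) ℂ) (b c : Fin n) : ℂ :=
  ∑ k : Fin n, (-1) ^ (n - 1 - k.val) * (g (.inl k) b * g (.inr k) c)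

/-- For `i < n` a factor acts on the lower half by the inverse transpose of its action on the upper
half, up to the alternating signs in the pairing. -/
theorem halfPairing_boldY_of_lt {n : ℕ} {i : Fin n} (h : i.val + 1 < n) {t : ℂ} (ht : t ≠ 0)
    (g : Matrix (BasisIdx n) (Fin n) ℂ) (b c : Fin n) :
    halfPairing (boldY n i t * g) b c = halfPairing g b c := by
  let j : Fin n := ⟨i.val + 1, h⟩
  have hne : j ≠ i := by simp [Fin.ext_iff, j]
  have hj : ∀ a : Fin n, a.val = i.val + 1 ↔ a = j := fun a => by simp [Fin.ext_iff, j]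
  rw [halfPairing, halfPairing, ← sub_eq_zero, ← Finset.sum_sub_distrib,
    ← Finset.sum_subset (Finset.subset_univ {i, j}), Finset.sum_pair hne.symm]
  · simp only [boldY_mul_inl n i _ _ ht, boldY_mul_inr_of_lt n i _ _ h ht, if_true, hj, hne,
      if_false]
    have h1 : n - 1 - i.val = (n - 1 - j.val) + 1 := by simp only [j]; omega
    rw [h1, pow_succ]
    change _ + _ = _
    simp only [show (⟨i.val + 1, h⟩ : Fin n) = j from rfl]
    field_simp
    ring
  · intro k _ hk
    simp only [Finset.mem_insert, Finset.mem_singleton, not_or] at hk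
    simp only [boldY_mul_inl n i _ _ ht, boldY_mul_inr_of_lt n i _ _ h ht, hj, hk, if_false,
      sub_self]

/-- The scalings by `t` and `t⁻¹` cancel in the pairing, and `f_n`, which adds the row `n` to the
row `\bar n`, leaves one rank one term. -/
theorem halfPairing_boldY_last {n : ℕ} {i : Fin n} (h : i.val + 1 = n) {t : ℂ} (ht : t ≠ 0)
    (g : Matrix (BasisIdx n) (Fin n) ℂ) (b c : Fin n) :
    halfPairing (boldY n i t * g) b c =
      halfPairing g b c + t⁻¹ * (g (.inl i) b * g (.inl i) c) := by
  rw [halfPairing, halfPairing, ← sub_eq_iff_eq_add', ← Finset.sum_sub_distrib,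
    Finset.sum_eq_single i]
  · simp only [boldY_mul_inl n i _ _ ht, boldY_mul_inr_last n i _ _ h ht, if_true,
      show n - 1 - i.val = 0 by omega]
    field_simp
    ring
  · intro k _ hk
    have : ¬ k.val = i.val + 1 := by omega
    simp only [boldY_mul_inl n i _ _ ht, boldY_mul_inr_last n i _ _ h ht, hk, this, if_false,
      sub_self]
  · simp

/-- The value of the variable `Y_{m,x}`, with the convention `Y_{m,0} = 1`. -/
def val {n : ℕ} (c : Fin n → ℤ → ℂ) (m : ℤ) (x : ℕ) : ℂ :=
  if h : 1 ≤ x ∧ x ≤ n then c ⟨x - 1, by omega⟩ m else 1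

/-- The quotient `c_{x-1}^{(m)} / c_x^{(m)}`. -/
noncomputable def ratio {n : ℕ} (c : Fin n → ℤ → ℂ) (m : ℤ) (x : ℕ) : ℂ :=
  val c m (x - 1) / val c m x

theorem val_succ {n : ℕ} (c : Fin n → ℤ → ℂ) (m : ℤ) (i : Fin n) : val c m (i.val + 1) = c i m := by
  have := i.2
  simp [val, show i.val + 1 ≤ n by omega]

/-- The `j`-th row of the upper half of a matrix, with `j` counted from `1`. -/
def upperRow {n : ℕ} (g : Matrix (BasisIdx n) (Fin n) ℂ) (j : ℕ) : Fin n → ℂ :=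
  if h : 1 ≤ j ∧ j ≤ n then g (.inl ⟨j - 1, by omega⟩) else 0

theorem upperRow_succ {n : ℕ} (g : Matrix (BasisIdx n) (Fin n) ℂ) (i : Fin n) :
    upperRow g (i.val + 1) = g (.inl i) := by
  have := i.2
  simp [upperRow, show i.val + 1 ≤ n by omega]

/-- One of the `n` Coxeter factors of `Θ^-`. -/
noncomputable def coxeterFactor (n : ℕ) (c : Fin n → ℤ → ℂ) (p : ℤ) :
    Matrix (BasisIdx n) (BasisIdx n) ℂ :=
  ((List.finRange n).map fun i => boldY n i (c i p)).prod

/-- Induction from the right end of the product, since the rightmost factor acts first. Row `i + 1`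
has already been scaled by `t_{i+1}⁻¹` when the factor `i` scales it by `t_i` and adds row `i`,
which is still untouched. Only the factor with index `n`, which acts before all others, changes the
pairing. -/
theorem prod_drop_boldY {n : ℕ} (hn : 0 < n) {t : Fin n → ℂ} (ht : ∀ i, t i ≠ 0)
    (g : Matrix (BasisIdx n) (Fin n) ℂ) (d : ℕ) (hd : d + 1 ≤ n) :
    let h := (((List.finRange n).drop (n - (d + 1))).map fun i => boldY n i (t i)).prod * g
    (∀ a c : Fin n, h (.inl a) c =
      if a.val < n - (d + 1) then g (.inl a) c
      else if a.val = n - (d + 1) then (t a)⁻¹ * g (.inl a) c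
      else t ⟨a.val - 1, by omega⟩ / t a * g (.inl a) c + g (.inl ⟨a.val - 1, by omega⟩) c) ∧
    ∀ b c : Fin n, halfPairing h b c = halfPairing g b c +
      (t (lastIdx n hn))⁻¹ * (g (.inl (lastIdx n hn)) b * g (.inl (lastIdx n hn)) c) := by
  induction d with
  | zero =>
    have h1 : (List.finRange n).drop (n - (0 + 1)) = [lastIdx n hn] := by
      rw [List.drop_eq_getElem_cons (by simp; omega), List.drop_eq_nil_of_le (by simp; omega)]
      simp [lastIdx]
    intro h
    have h2 : h = boldY n (lastIdx n hn) (t (lastIdx n hn)) * g := by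
      simp only [h, h1, List.map_cons, List.map_nil, List.prod_cons, List.prod_nil, mul_one]
    refine ⟨fun a c => ?_, fun b c => ?_⟩
    · rw [h2, boldY_mul_inl _ _ _ _ (ht _)]
      have h3 : a = lastIdx n hn ↔ a.val = n - (0 + 1) := by simp [Fin.ext_iff, lastIdx]
      have h4 : ¬ a.val = (lastIdx n hn).val + 1 := by
        simp only [lastIdx]
        omega
      by_cases h5 : a = lastIdx n hn
      · rw [if_pos h5, if_neg (by rw [h3.1 h5]; omega), if_pos (h3.1 h5), h5]
      · have h6 := mt h3.2 h5
        rw [if_neg h5, if_neg h4, if_pos (by omega)]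
    · rw [h2, halfPairing_boldY_last (by simp only [lastIdx]; omega) (ht _)]
  | succ d ih =>
    obtain ⟨ih1, ih2⟩ := ih (by omega)
    let i : Fin n := ⟨n - (d + 1 + 1), by omega⟩
    have h1 : (List.finRange n).drop (n - (d + 1 + 1)) = i :: (List.finRange n).drop (n - (d + 1)) := by
      rw [List.drop_eq_getElem_cons (by simp; omega), show n - (d + 1 + 1) + 1 = n - (d + 1) by omega]
      simp [i]
    intro h
    have h2 : h = boldY n i (t i) *
        ((((List.finRange n).drop (n - (d + 1))).map fun i => boldY n i (t i)).prod * g) := by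
      simp only [h, h1, List.map_cons, List.prod_cons, Matrix.mul_assoc]
    refine ⟨fun a c => ?_, fun b c => ?_⟩
    · rw [h2, boldY_mul_inl _ _ _ _ (ht _), ih1, ih1]
      have hi : i.val = n - (d + 1 + 1) := rfl
      have h3 : a = i ↔ a.val = n - (d + 1 + 1) := by simp [Fin.ext_iff, i]
      by_cases h5 : a = i
      · have h6 := h3.1 h5
        rw [if_pos h5, if_pos (by omega), if_neg (by omega), if_pos h6, h5]
      · have h6 := mt h3.2 h5
        rw [if_neg h5]
        by_cases h7 : a.val = i.val + 1
        · have h8 : (⟨a.val - 1, by omega⟩ : Fin n) = i := by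
            simp only [Fin.ext_iff]
            omega
          rw [if_pos h7, if_neg (by omega), if_pos (by omega), if_pos (by omega),
            if_neg (by omega), if_neg (by omega), h8, div_eq_mul_inv, mul_assoc]
        · rw [if_neg h7]
          by_cases h8 : a.val < n - (d + 1 + 1)
          · rw [if_pos (by omega), if_pos h8]
          · rw [if_neg (by omega), if_neg (by omega), if_neg h8, if_neg h6]
    · rw [h2, halfPairing_boldY_of_lt (by simp only [i]; omega) (ht _), ih2]

theorem upperRow_coxeterFactor {n : ℕ} (hn : 0 < n) {c : Fin n → ℤ → ℂ} {p : ℤ}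
    (hc : ∀ i, c i p ≠ 0) (g : Matrix (BasisIdx n) (Fin n) ℂ) (j : ℕ) (hj : j + 1 ≤ n) :
    upperRow (coxeterFactor n c p * g) (j + 1) =
      ratio c p (j + 1) • upperRow g (j + 1) + upperRow g j := by
  have h := (prod_drop_boldY hn hc g (n - 1) (by omega)).1 ⟨j, by omega⟩
  rw [show n - (n - 1 + 1) = 0 by omega, List.drop_zero] at h
  funext b
  have h1 := upperRow_succ (coxeterFactor n c p * g) ⟨j, by omega⟩
  have h2 := upperRow_succ g ⟨j, by omega⟩
  simp only at h1 h2
  rw [h1, coxeterFactor, h b, Pi.add_apply, Pi.smul_apply, h2, ratio,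
    val_succ c p ⟨j, by omega⟩]
  rcases j with _ | j
  · simp [val, upperRow]
  · have h3 := upperRow_succ g ⟨j, by omega⟩
    simp only at h3
    have h4 : val c p (j + 1 + 1 - 1) = c ⟨j, by omega⟩ p := val_succ c p ⟨j, by omega⟩
    rw [h3, h4]
    simp

theorem halfPairing_coxeterFactor {n : ℕ} (hn : 0 < n) {c : Fin n → ℤ → ℂ} {p : ℤ}
    (hc : ∀ i, c i p ≠ 0) (g : Matrix (BasisIdx n) (Fin n) ℂ) (a b : Fin n) :
    halfPairing (coxeterFactor n c p * g) a b = halfPairing g a b +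
      (c (lastIdx n hn) p)⁻¹ * (g (.inl (lastIdx n hn)) a * g (.inl (lastIdx n hn)) b) := by
  have h := (prod_drop_boldY hn hc g (n - 1) (by omega)).2 a b
  rwa [show n - (n - 1 + 1) = 0 by omega, List.drop_zero] at h

/-- The first `n` columns of the product of the last `q` Coxeter factors of `Θ^-`. -/
noncomputable def partialTheta (n : ℕ) (c : Fin n → ℤ → ℂ) : ℕ → Matrix (BasisIdx n) (Fin n) ℂ
  | 0 => (1 : Matrix (BasisIdx n) (BasisIdx n) ℂ).submatrix id Sum.inl
  | q + 1 => coxeterFactor n c (n - q) * partialTheta n c q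

theorem partialTheta_self (n : ℕ) (c : Fin n → ℤ → ℂ) :
    partialTheta n c n = (thetaMinus n c).submatrix id Sum.inl := by
  have key : ∀ q ≤ n, partialTheta n c q =
      (((List.finRange n).drop (n - q)).map fun p : Fin n =>
        coxeterFactor n c ((p.val : ℤ) + 1)).prod *
          (1 : Matrix (BasisIdx n) (BasisIdx n) ℂ).submatrix id Sum.inl := by
    intro q
    induction q with
    | zero =>
      intro _
      rw [List.drop_eq_nil_of_le (by simp)]
      simp [partialTheta]
    | succ q ih =>
      intro hq
      rw [partialTheta, ih (by omega), List.drop_eq_getElem_cons (i := n - (q + 1)) (by simp; omega),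
        show n - (q + 1) + 1 = n - q by omega, List.map_cons, List.prod_cons, Matrix.mul_assoc]
      congr 2
      simp only [List.getElem_finRange, Fin.val_cast]
      omega
  rw [key n le_rfl, Nat.sub_self, List.drop_zero]
  have h1 : thetaMinus n c = ((List.finRange n).map fun p : Fin n =>
        coxeterFactor n c ((p.val : ℤ) + 1)).prod := by
    rw [thetaMinus, List.flatMap_def, List.prod_flatten, List.map_map]
    rfl
  rw [h1]
  ext a b
  simp [Matrix.mul_apply, Matrix.one_apply]

/-- Write `y = z C`; then the determinant is `z_l det C`. The Gram identity gives `z = z' B` with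
`z' Tᵀ = w⁻¹ x`. Column `l` of `B` is `y = x T`, hence `z_l = z' · y = (z' Tᵀ) · x`. -/
theorem det_updateRow_of_gram {n : ℕ} {B C T : Matrix (Fin n) (Fin n) ℂ} {w x y : Fin n → ℂ}
    (hBC : B * C = T.transpose * Matrix.diagonal w * T) (hT : T.det = 1) (hw : ∀ q, w q ≠ 0)
    (l : Fin n) (hB : ∀ b, B b l = y b) (hy : y = Matrix.vecMul x T) :
    (C.updateRow l y).det = (∑ q, (w q)⁻¹ * x q ^ 2) * C.det := by
  have hT' : IsUnit T.transpose.det := by rw [Matrix.det_transpose, hT]; exact isUnit_one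
  let z' := Matrix.vecMul (fun q => (w q)⁻¹ * x q) T.transpose⁻¹
  have hz' : Matrix.vecMul z' T.transpose = fun q => (w q)⁻¹ * x q := by
    rw [Matrix.vecMul_vecMul, Matrix.nonsing_inv_mul _ hT', Matrix.vecMul_one]
  let z := Matrix.vecMul z' B
  have h1 : y = ∑ k, z k • C k := by
    rw [← Matrix.vecMul_eq_sum, Matrix.vecMul_vecMul, hBC, ← Matrix.vecMul_vecMul,
      ← Matrix.vecMul_vecMul, hz', hy]
    congr 1
    funext q
    rw [Matrix.vecMul_diagonal]
    field_simp [hw q]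
  have h2 : z l = ∑ q, (w q)⁻¹ * x q ^ 2 := by
    have h3 : z l = z' ⬝ᵥ y := by
      simp only [z, Matrix.vecMul, dotProduct, hB]
    rw [h3, hy, ← Matrix.mulVec_transpose, Matrix.dotProduct_mulVec, hz', dotProduct]
    refine Finset.sum_congr rfl fun q _ => ?_
    ring
  rw [h1, Matrix.det_updateRow_sum, h2, smul_eq_mul]

/-! ### The minor of `Θ^-` as a sum of squares -/

section

variable {n : ℕ} {c : Fin n → ℤ → ℂ}

theorem val_ne_zero (hc : ∀ (i : Fin n) (p : ℤ), 1 ≤ p → p ≤ n → c i p ≠ 0) {m : ℤ} (h1 : 1 ≤ m)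
    (h2 : m ≤ n) (x : ℕ) : val c m x ≠ 0 := by
  rw [val]
  split_ifs
  · exact hc _ _ h1 h2
  · exact one_ne_zero

theorem val_zero (m : ℤ) : val c m 0 = 1 := by simp [val]

theorem upperRow_zero (g : Matrix (BasisIdx n) (Fin n) ℂ) : upperRow g 0 = 0 := by simp [upperRow]

theorem upperRow_partialTheta_zero (j : ℕ) (b : Fin n) :
    upperRow (partialTheta n c 0) j b = if j = b.val + 1 then 1 else 0 := by
  rw [upperRow]
  split_ifs with h1 h2 h2
  · simp [partialTheta, Matrix.one_apply, h2]
  · simp only [partialTheta, Matrix.submatrix_apply, id, Matrix.one_apply, Sum.inl.injEq,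
      Fin.ext_iff]
    rw [if_neg (by omega)]
  · omega
  · rfl

theorem upperRow_partialTheta_succ
    (hc : ∀ (i : Fin n) (p : ℤ), 1 ≤ p → p ≤ n → c i p ≠ 0) {j q : ℕ}
    (hj : j + 1 ≤ n) (hq : q + 1 ≤ n) :
    upperRow (partialTheta n c (q + 1)) (j + 1) =
      ratio c (n - q) (j + 1) • upperRow (partialTheta n c q) (j + 1) +
        upperRow (partialTheta n c q) j :=
  upperRow_coxeterFactor (by omega) (fun i => hc i _ (by omega) (by omega)) _ j hj

/-- Each Coxeter factor acts on the upper rows by a lower bidiagonal matrix with unit subdiagonal.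
After `q` factors the entries live on `q + 1` diagonals, the outermost of which consists of ones
(`upperRow_partialTheta_eq_one`). -/
theorem upperRow_partialTheta_eq_zero
    (hc : ∀ (i : Fin n) (p : ℤ), 1 ≤ p → p ≤ n → c i p ≠ 0) {q : ℕ}
    (hq : q ≤ n) (j : ℕ) (hj : j ≤ n) (b : Fin n) (h : b.val + 1 + q < j ∨ j < b.val + 1) :
    upperRow (partialTheta n c q) j b = 0 := by
  induction q generalizing j with
  | zero => rw [upperRow_partialTheta_zero, if_neg (by omega)]
  | succ q ih =>
    rcases j with _ | j
    · rw [upperRow_zero, Pi.zero_apply]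
    · rw [upperRow_partialTheta_succ hc hj hq, Pi.add_apply, Pi.smul_apply,
        ih (by omega) _ hj (by omega), ih (by omega) _ (by omega) (by omega), smul_zero, add_zero]

theorem upperRow_partialTheta_eq_one
    (hc : ∀ (i : Fin n) (p : ℤ), 1 ≤ p → p ≤ n → c i p ≠ 0) {q : ℕ}
    (hq : q ≤ n) (j : ℕ) (hj : j ≤ n) (b : Fin n) (h : b.val + 1 + q = j) :
    upperRow (partialTheta n c q) j b = 1 := by
  induction q generalizing j with
  | zero => rw [upperRow_partialTheta_zero, if_pos (by omega)]
  | succ q ih =>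
    rcases j with _ | j
    · omega
    · rw [upperRow_partialTheta_succ hc hj hq, Pi.add_apply, Pi.smul_apply,
        upperRow_partialTheta_eq_zero hc (by omega) _ hj b (by omega),
        ih (by omega) _ (by omega) (by omega), smul_zero, zero_add]

theorem upperRow_partialTheta_diag
    (hc : ∀ (i : Fin n) (p : ℤ), 1 ≤ p → p ≤ n → c i p ≠ 0) {q : ℕ}
    (hq : q ≤ n) (b : Fin n) :
    upperRow (partialTheta n c q) (b.val + 1) b =
      ∏ s ∈ Finset.range q, ratio c (n - s) (b.val + 1) := by
  induction q with
  | zero => rw [upperRow_partialTheta_zero, if_pos rfl, Finset.prod_range_zero]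
  | succ q ih =>
    rw [upperRow_partialTheta_succ hc b.2 hq, Pi.add_apply, Pi.smul_apply, ih (by omega),
      upperRow_partialTheta_eq_zero hc (by omega) b.val (by omega) b (by omega), add_zero,
      Finset.prod_range_succ, smul_eq_mul, mul_comm]

theorem prod_ratio {m : ℤ} (hc : ∀ x, val c m x ≠ 0) (j : ℕ) :
    ∏ x ∈ Finset.range j, ratio c m (x + 1) = (val c m j)⁻¹ := by
  induction j with
  | zero => simp [val_zero]
  | succ j ih =>
    rw [Finset.prod_range_succ, ih, ratio, Nat.add_sub_cancel]
    have := hc j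
    field_simp

/-- The upper half is triangular, and for each superscript the diagonal factors `c_{j-1} / c_j`
telescope over the rows. -/
theorem det_upper_partialTheta
    (hc : ∀ (i : Fin n) (p : ℤ), 1 ≤ p → p ≤ n → c i p ≠ 0) :
    (Matrix.of fun a b : Fin n => partialTheta n c n (.inl a) b).det =
      ∏ r : Fin n, (val c (r.val + 1) n)⁻¹ := by
  have h1 : ∀ a : Fin n, partialTheta n c n (.inl a) = upperRow (partialTheta n c n) (a.val + 1) :=
    fun a => (upperRow_succ _ a).symm
  rw [Matrix.det_of_isLowerTriangular]
  · simp only [Matrix.of_apply, h1, upperRow_partialTheta_diag hc le_rfl]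
    rw [Finset.prod_comm, ← Fin.prod_univ_eq_prod_range
      (fun s => ∏ x : Fin n, ratio c (n - s) (x.val + 1)), ← Equiv.prod_comp Fin.revPerm]
    refine Finset.prod_congr rfl fun s _ => ?_
    have hs := s.2
    have h2 : (n : ℤ) - ((Fin.revPerm s).val : ℤ) = s.val + 1 := by
      simp only [Fin.revPerm_apply, Fin.val_rev]
      omega
    rw [h2, Fin.prod_univ_eq_prod_range (fun x => ratio c (s.val + 1) (x + 1)),
      prod_ratio (val_ne_zero hc (by omega) (by omega))]
  · intro a b hab
    have hab' : a < b := hab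
    rw [Matrix.of_apply, h1, upperRow_partialTheta_eq_zero hc le_rfl _ a.2 b (Or.inr (by omega))]

/-- The lower half of the first `n` columns of the identity vanishes, so the pairing starts at zero
and collects one rank one term per Coxeter factor. -/
theorem halfPairing_partialTheta
    (hc : ∀ (i : Fin n) (p : ℤ), 1 ≤ p → p ≤ n → c i p ≠ 0) (hn : 0 < n) (q : ℕ)
    (hq : q ≤ n) (a b : Fin n) :
    halfPairing (partialTheta n c q) a b = ∑ s ∈ Finset.range q, (val c (n - s) n)⁻¹ *
      (upperRow (partialTheta n c s) n a * upperRow (partialTheta n c s) n b) := by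
  induction q with
  | zero => simp [halfPairing, partialTheta]
  | succ q ih =>
    have h1 : (lastIdx n hn).val + 1 = n := by
      simp only [lastIdx]
      omega
    have h2 := val_succ c (n - q) (lastIdx n hn)
    have h3 := upperRow_succ (partialTheta n c q) (lastIdx n hn)
    rw [h1] at h2 h3
    rw [partialTheta, halfPairing_coxeterFactor hn (fun i => hc i _ (by omega) (by omega)),
      ih (by omega), Finset.sum_range_succ, h2, h3]

/-- The sums `E_r` whose squares, multiplied by `c_n^{(r)}`, are the summands of the minor. -/
noncomputable def elemSum {n : ℕ} (c : Fin n → ℤ → ℂ) : ℕ → ℕ → ℂ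
  | _, 0 => 1
  | 0, _ + 1 => 0
  | j + 1, r + 1 => elemSum c j (r + 1) + ratio c (n - j + r) (j + 1) * elemSum c j r

theorem elemSum_eq_zero {j r : ℕ} (h : j < r) : elemSum c j r = 0 := by
  induction j generalizing r with
  | zero =>
    obtain ⟨r, rfl⟩ : ∃ s, r = s + 1 := ⟨r - 1, by omega⟩
    rw [elemSum]
  | succ j ih =>
    obtain ⟨r, rfl⟩ : ∃ s, r = s + 1 := ⟨r - 1, by omega⟩
    rw [elemSum, ih (by omega), ih (by omega), mul_zero, add_zero]

theorem elemSum_zero_right (j : ℕ) : elemSum c j 0 = 1 := by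
  cases j <;> rw [elemSum]

/-- The row recursion expresses row `j` through row `j + 1` of two consecutive partial products.
Substituting this into the relation for `j` gives the relation for `j + 1`, and the coefficients
combine by the recursion that defines `elemSum`. The relation for `j = n` writes the last row of the
full product through those of the shorter ones. -/
theorem sum_elemSum_upperRow
    (hc : ∀ (i : Fin n) (p : ℤ), 1 ≤ p → p ≤ n → c i p ≠ 0) (j : ℕ) (hj : j ≤ n) :
    ∑ r ∈ Finset.range (j + 1),
      ((-1) ^ r * elemSum c j r) • upperRow (partialTheta n c (j - r)) j = 0 := by
  induction j with
  | zero => simp [upperRow_zero]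
  | succ j ih =>
    have h1 : ∀ r ∈ Finset.range (j + 1),
        ((-1) ^ r * elemSum c j r) • upperRow (partialTheta n c (j - r)) j =
        ((-1) ^ r * elemSum c j r) • upperRow (partialTheta n c (j + 1 - r)) (j + 1) +
        ((-1) ^ (r + 1) * (ratio c (n - j + r) (j + 1) * elemSum c j r)) •
          upperRow (partialTheta n c (j - r)) (j + 1) := by
      intro r hr
      rw [Finset.mem_range] at hr
      have h2 := upperRow_partialTheta_succ hc (j := j) (q := j - r) hj (by omega)
      rw [show j + 1 - r = j - r + 1 by omega, h2,
        show ((n : ℤ) - (j - r : ℕ)) = n - j + r by omega, pow_succ]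
      module
    have h3 := ih (by omega)
    rw [Finset.sum_congr rfl h1, Finset.sum_add_distrib] at h3
    -- The sum is shifted by one index; its new top term is `elemSum c j (j + 1) = 0`.
    have h4 : ∑ r ∈ Finset.range (j + 1),
        ((-1) ^ r * elemSum c j r) • upperRow (partialTheta n c (j + 1 - r)) (j + 1) =
        upperRow (partialTheta n c (j + 1)) (j + 1) + ∑ r ∈ Finset.range (j + 1),
          ((-1) ^ (r + 1) * elemSum c j (r + 1)) •
            upperRow (partialTheta n c (j - r)) (j + 1) := by
      rw [Finset.sum_range_succ', Finset.sum_range_succ _ j, elemSum_eq_zero (Nat.lt_succ_self j),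
        mul_zero, zero_smul, add_zero, pow_zero, elemSum_zero_right, one_mul, one_smul, Nat.sub_zero,
        add_comm]
      congr 1
      refine Finset.sum_congr rfl fun r _ => ?_
      rw [show j + 1 - (r + 1) = j - r by omega]
    rw [h4] at h3
    rw [Finset.sum_range_succ', pow_zero, elemSum_zero_right, one_mul, one_smul, Nat.sub_zero,
      ← h3, add_assoc, ← Finset.sum_add_distrib, add_comm]
    congr 1
    refine Finset.sum_congr rfl fun r _ => ?_
    rw [show j + 1 - (r + 1) = j - r by omega, elemSum]
    module

theorem upperRow_partialTheta_self
    (hc : ∀ (i : Fin n) (p : ℤ), 1 ≤ p → p ≤ n → c i p ≠ 0) :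
    upperRow (partialTheta n c n) n = ∑ r : Fin n, ((-1) ^ r.val * elemSum c n (r.val + 1)) •
      upperRow (partialTheta n c (n - 1 - r.val)) n := by
  have h := sum_elemSum_upperRow hc n le_rfl
  rw [Finset.sum_range_succ', pow_zero, elemSum_zero_right, one_mul, one_smul, Nat.sub_zero] at h
  rw [eq_neg_of_add_eq_zero_right h,
    Fin.sum_univ_eq_sum_range (fun r => ((-1) ^ r * elemSum c n (r + 1)) •
      upperRow (partialTheta n c (n - 1 - r)) n), ← Finset.sum_neg_distrib]
  refine Finset.sum_congr rfl fun r _ => ?_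
  rw [show n - (r + 1) = n - 1 - r by omega, pow_succ]
  module

/-- The minor is `det C` with its last row replaced by the last row of the upper half, so
`det_updateRow_of_gram` applies with `B = Aᵀ D`. The rows of `T` are the last upper rows of the
partial products. -/
theorem prod_sign_mul_det_thetaMinus
    (hc : ∀ (i : Fin n) (p : ℤ), 1 ≤ p → p ≤ n → c i p ≠ 0) (hn : 0 < n) :
    (∏ a : Fin n, (-1 : ℂ) ^ (n - 1 - a.val)) *
        (Matrix.of fun a b : Fin n =>
          thetaMinus n c (if a.val + 1 < n then .inr a else .inl a) (.inl b)).det =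
      ∑ r : Fin n, val c (r.val + 1) n * elemSum c n (r.val + 1) ^ 2 := by
  let g := partialTheta n c n
  let A : Matrix (Fin n) (Fin n) ℂ := Matrix.of fun a b => g (.inl a) b
  let C : Matrix (Fin n) (Fin n) ℂ := Matrix.of fun a b => g (.inr a) b
  let d : Fin n → ℂ := fun a => (-1) ^ (n - 1 - a.val)
  let T : Matrix (Fin n) (Fin n) ℂ :=
    Matrix.of fun r => upperRow (partialTheta n c (n - 1 - r.val)) n
  let w : Fin n → ℂ := fun r => (val c (r.val + 1) n)⁻¹
  let y := upperRow g n
  have hv : ∀ r : Fin n, val c (r.val + 1) n ≠ 0 :=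
    fun r => val_ne_zero hc (by omega) (by have := r.2; omega) n
  have hw : ∀ r, w r ≠ 0 := fun r => inv_ne_zero (hv r)
  have hl : (lastIdx n hn).val + 1 = n := by
    simp only [lastIdx]
    omega
  have hM : (Matrix.of fun a b : Fin n =>
      thetaMinus n c (if a.val + 1 < n then .inr a else .inl a) (.inl b)) =
        C.updateRow (lastIdx n hn) y := by
    ext a b
    have h1 : thetaMinus n c (if a.val + 1 < n then .inr a else .inl a) (.inl b) =
        g (if a.val + 1 < n then .inr a else .inl a) b := by
      simp only [g, partialTheta_self]
      rfl
    rw [Matrix.of_apply, h1, Matrix.updateRow_apply]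
    by_cases ha : a = lastIdx n hn
    · rw [if_pos ha, if_neg (by rw [ha]; omega), ha]
      have := upperRow_succ g (lastIdx n hn)
      rw [hl] at this
      simp only [y, this]
    · have : a.val + 1 < n := by
        have h2 : a.val ≠ n - 1 := fun h => ha (Fin.ext h)
        omega
      rw [if_neg ha, if_pos this]
      rfl
  have hT : T.det = 1 := by
    rw [Matrix.det_of_isUpperTriangular]
    · refine Finset.prod_eq_one fun r _ => ?_
      exact upperRow_partialTheta_eq_one hc (by omega) n le_rfl r (by omega)
    · intro a b hab
      have hab' : b < a := hab
      exact upperRow_partialTheta_eq_zero hc (by omega) n le_rfl b (Or.inl (by omega))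
  have hBC : (A.transpose * Matrix.diagonal d) * C = T.transpose * Matrix.diagonal w * T := by
    ext a b
    have h1 : ((A.transpose * Matrix.diagonal d) * C) a b = halfPairing g a b := by
      rw [Matrix.mul_apply, halfPairing]
      refine Finset.sum_congr rfl fun k _ => ?_
      rw [Matrix.mul_diagonal]
      simp only [A, C, d, Matrix.transpose_apply, Matrix.of_apply]
      ring
    rw [h1, halfPairing_partialTheta hc hn n le_rfl, ← Finset.sum_range_reflect,
      ← Fin.sum_univ_eq_sum_range (fun s => (val c (n - (n - 1 - s : ℕ)) n)⁻¹ *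
      (upperRow (partialTheta n c (n - 1 - s)) n a * upperRow (partialTheta n c (n - 1 - s)) n b)),
      Matrix.mul_apply]
    refine Finset.sum_congr rfl fun k _ => ?_
    rw [Matrix.mul_diagonal, show (n : ℤ) - (n - 1 - k.val : ℕ) = k.val + 1 by omega]
    simp only [T, w, Matrix.transpose_apply, Matrix.of_apply]
    ring
  have hB : ∀ b, (A.transpose * Matrix.diagonal d) b (lastIdx n hn) = y b := by
    intro b
    have := upperRow_succ g (lastIdx n hn)
    rw [hl] at this
    rw [Matrix.mul_diagonal]
    simp only [d, A, Matrix.transpose_apply, Matrix.of_apply, y, this,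
      show n - 1 - (lastIdx n hn).val = 0 by omega, pow_zero, mul_one]
  have hy : y = Matrix.vecMul (fun r : Fin n => (-1) ^ r.val * elemSum c n (r.val + 1)) T := by
    rw [Matrix.vecMul_eq_sum]
    exact upperRow_partialTheta_self hc
  -- Determinants of the Gram identity: `det A · ∏ d · det C = ∏ w`, and `det A = ∏ w`.
  have hdet : (∏ a, d a) * C.det = 1 := by
    have h1 := congrArg Matrix.det hBC
    rw [Matrix.det_mul, Matrix.det_mul, Matrix.det_mul, Matrix.det_mul, Matrix.det_transpose,
      Matrix.det_transpose, hT, Matrix.det_diagonal, Matrix.det_diagonal, one_mul, mul_one,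
      show A.det = ∏ r, w r from det_upper_partialTheta hc, mul_assoc] at h1
    exact mul_left_cancel₀ (Finset.prod_ne_zero_iff.2 fun r _ => hw r) (h1.trans (mul_one _).symm)
  rw [hM, det_updateRow_of_gram hBC hT hw _ hB hy, mul_left_comm, hdet, mul_one]
  refine Finset.sum_congr rfl fun r _ => ?_
  have h1 : ((-1 : ℂ) ^ r.val) ^ 2 = 1 := by rw [← pow_mul, mul_comm, pow_mul, neg_one_sq, one_pow]
  simp only [w, inv_inv, mul_pow, h1, one_mul]

end

/-! ### Evaluation of monomials -/

theorem evalMono_add {n : ℕ} {c : Fin n → ℤ → ℂ} (hc : ∀ i p, c i p ≠ 0) (Y Z : LaurentMonomial n) :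
    evalMono c (Y + Z) = evalMono c Y * evalMono c Z :=
  Finsupp.prod_add_index' (fun _ => zpow_zero _) fun q _ _ => zpow_add₀ (hc q.2 q.1) _ _

theorem evalMono_zero {n : ℕ} (c : Fin n → ℤ → ℂ) : evalMono c 0 = 1 := Finsupp.prod_zero_index

theorem evalMono_sub {n : ℕ} {c : Fin n → ℤ → ℂ} (hc : ∀ i p, c i p ≠ 0) (Y Z : LaurentMonomial n) :
    evalMono c (Y - Z) = evalMono c Y / evalMono c Z := by
  have h0 : evalMono c Z ≠ 0 := Finset.prod_ne_zero_iff.2 fun q _ => zpow_ne_zero _ (hc q.2 q.1)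
  rw [eq_div_iff h0, ← evalMono_add hc, sub_add_cancel]

theorem evalMono_varY {n : ℕ} (c : Fin n → ℤ → ℂ) (m : ℤ) (x : ℕ) :
    evalMono c (varY n m x) = val c m x := by
  rw [varY, val]
  split_ifs
  · rw [evalMono, monoVar, Finsupp.prod_single_index (zpow_zero _), zpow_one]
  · exact evalMono_zero c

theorem evalMono_boxNeg {n : ℕ} {c : Fin n → ℤ → ℂ} (hc : ∀ i p, c i p ≠ 0) (b : ℤ) (x : ℕ) :
    evalMono c (boxNeg n b x) = ratio c (n - x + b) x := by
  rw [boxNeg, evalMono_sub hc, evalMono_varY, evalMono_varY, ratio]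

/-! ### Increasing lists and finite sets -/

/-- The increasing list of the elements of a set in `{1, …, j}`. -/
def subsetList (j : ℕ) (S : Finset ℕ) : List ℕ := (List.range' 1 j).filter (· ∈ S)

theorem mem_subsetList {j x : ℕ} {S : Finset ℕ} :
    x ∈ subsetList j S ↔ (1 ≤ x ∧ x ≤ j) ∧ x ∈ S := by
  simp only [subsetList, List.mem_filter, List.mem_range'_1, decide_eq_true_eq]
  constructor <;> rintro ⟨h1, h2⟩ <;> exact ⟨by omega, h2⟩

theorem pairwise_subsetList (j : ℕ) (S : Finset ℕ) : (subsetList j S).Pairwise (· < ·) :=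
  List.Pairwise.filter _ List.pairwise_lt_range'

theorem subsetList_succ (j : ℕ) (S : Finset ℕ) :
    subsetList (j + 1) S = subsetList j S ++ if j + 1 ∈ S then [j + 1] else [] := by
  rw [subsetList, List.range'_1_concat, List.filter_append, add_comm 1 j]
  congr 1
  by_cases h : j + 1 ∈ S <;> simp [h]

theorem toFinset_subsetList {j : ℕ} {S : Finset ℕ} (hS : S ⊆ Finset.Icc 1 j) :
    (subsetList j S).toFinset = S := by
  ext x
  rw [List.mem_toFinset, mem_subsetList, ← Finset.mem_Icc]
  exact ⟨fun h => h.2, fun h => ⟨hS h, h⟩⟩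

theorem length_subsetList {j : ℕ} {S : Finset ℕ} (hS : S ⊆ Finset.Icc 1 j) :
    (subsetList j S).length = S.card := by
  rw [← List.toFinset_card_of_nodup ((pairwise_subsetList j S).imp (fun h => ne_of_lt h)),
    toFinset_subsetList hS]

theorem subsetList_toFinset {j : ℕ} {l : List ℕ} (hl : l.Pairwise (· < ·))
    (h : ∀ x ∈ l, 1 ≤ x ∧ x ≤ j) : subsetList j l.toFinset = l := by
  have key : ∀ s : List ℕ, s.Pairwise (· < ·) → s.toFinset.sort (· ≤ ·) = s := fun s hs =>
    (List.toFinset_sort (· ≤ ·) (hs.imp (fun h => ne_of_lt h))).2 (hs.imp (fun h => le_of_lt h))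
  rw [← key _ (pairwise_subsetList j _), toFinset_subsetList, key _ hl]
  intro x hx
  exact Finset.mem_Icc.2 (h x (List.mem_toFinset.1 hx))

/-- Split by whether `j + 1` belongs to the subset. If it does, it is the largest letter and has
position `r + 1`, so its box has superscript `n - (j + 1) + (r + 1) = n - j + r`, as in the
recursion. -/
theorem elemSum_eq_sum {n : ℕ} {c : Fin n → ℤ → ℂ} (hc : ∀ i p, c i p ≠ 0) (j r : ℕ) :
    elemSum c j r = ∑ S ∈ Finset.powersetCard r (Finset.Icc 1 j),
      evalMono c (posSum (boxNeg n) 1 (subsetList j S)) := by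
  induction j generalizing r with
  | zero =>
    rcases r with _ | r
    · simp [elemSum, subsetList, posSum, evalMono_zero]
    · rw [elemSum, Finset.powersetCard_eq_empty.2 (by simp), Finset.sum_empty]
  | succ j ih =>
    rcases r with _ | r
    · simp [elemSum, subsetList, posSum, evalMono_zero]
    · have hj : j + 1 ∉ Finset.Icc 1 j := by simp
      have hins : Finset.Icc 1 (j + 1) = insert (j + 1) (Finset.Icc 1 j) := by
        ext x
        simp only [Finset.mem_Icc, Finset.mem_insert]
        omega
      rw [elemSum, ih, ih, hins, Finset.powersetCard_succ_insert hj, Finset.sum_union,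
        Finset.sum_image, Finset.mul_sum]
      · congr 1
        · refine Finset.sum_congr rfl fun S hS => ?_
          have h1 : j + 1 ∉ S := fun h => hj ((Finset.mem_powersetCard.1 hS).1 h)
          rw [subsetList_succ, if_neg h1, List.append_nil]
        · refine Finset.sum_congr rfl fun S hS => ?_
          obtain ⟨h1, h2⟩ := Finset.mem_powersetCard.1 hS
          have h3 : subsetList j (insert (j + 1) S) = subsetList j S := by
            refine List.filter_congr fun x hx => ?_
            rw [List.mem_range'_1] at hx
            have : x ≠ j + 1 := by omega
            simp [this]
          rw [subsetList_succ, if_pos (Finset.mem_insert_self _ _), h3, posSum_append,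
            evalMono_add hc, length_subsetList h1, h2, posSum, posSum, add_zero,
            evalMono_boxNeg hc, mul_comm]
          congr 2
          push_cast
          ring
      · intro S hS S' hS' h
        have h1 : ∀ R ∈ Finset.powersetCard r (Finset.Icc 1 j), j + 1 ∉ R :=
          fun R hR h => hj ((Finset.mem_powersetCard.1 hR).1 h)
        rw [← Finset.erase_insert (h1 S hS), ← Finset.erase_insert (h1 S' hS'), h]
      · rw [Finset.disjoint_left]
        intro S hS hS'
        obtain ⟨R, -, rfl⟩ := Finset.mem_image.1 hS'
        exact hj ((Finset.mem_powersetCard.1 hS).1 (Finset.mem_insert_self _ _))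

/-- The monomial of a set of unbarred letters in terms of the complementary set of barred
letters. -/
theorem posSum_boxPos_compl (n j : ℕ) (U : Finset ℕ) :
    posSum (boxPos n) 1 ((List.range' 1 j).filter (· ∉ U)) =
      varY n (n - j + (subsetList j U).length) j + posSum (boxNeg n) 1 (subsetList j U) := by
  have hlen : ∀ j, ((List.range' 1 j).filter (· ∉ U)).length + (subsetList j U).length = j := by
    intro j
    have := List.length_eq_length_filter_add (l := List.range' 1 j) (· ∈ U)
    rw [List.length_range'] at this
    rw [subsetList]
    simp only [decide_not]
    omega
  induction j with
  | zero => simp [posSum, subsetList, varY]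
  | succ j ih =>
    have h1 := hlen j
    rw [List.range'_1_concat, List.filter_append, posSum_append, ih, subsetList_succ, add_comm 1 j]
    -- If `j + 1 ∈ U`, the box of `\overline{j+1}` turns the leading variable of index `j` into the
    -- one of index `j + 1`; otherwise the box of the unbarred letter `j + 1` does.
    by_cases h : j + 1 ∈ U
    · rw [if_pos h, List.filter_cons_of_neg (by simpa using h), List.filter_nil, posSum_append]
      simp only [posSum, boxNeg, List.length_append, List.length_singleton, Nat.add_sub_cancel]
      push_cast
      rw [show (n : ℤ) - (j + 1) + (1 + (subsetList j U).length) =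
          n - j + (subsetList j U).length by ring,
        show (n : ℤ) - (j + 1) + ((subsetList j U).length + 1) =
          n - j + (subsetList j U).length by ring]
      abel
    · rw [if_neg h, List.filter_cons_of_pos (by simpa using h), List.filter_nil, List.append_nil]
      simp only [posSum, boxPos, Nat.add_sub_cancel]
      push_cast
      rw [show (n : ℤ) - (1 + (List.filter (· ∉ U) (List.range' 1 j)).length) =
          n - (j + 1) + (subsetList j U).length by omega,
        show (n : ℤ) + 1 - (1 + (List.filter (· ∉ U) (List.range' 1 j)).length) =
          n - j + (subsetList j U).length by omega]
      abel

/-- The column with unbarred letters outside `U` and barred letters in `L`. -/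
def columnOfSets (n : ℕ) (U L : Finset ℕ) : Column :=
  ⟨subsetList n (Finset.Icc 1 n \ U), subsetList n L⟩

theorem colMono_columnOfSets {n r : ℕ} {U L : Finset ℕ}
    (hU : U ∈ Finset.powersetCard r (Finset.Icc 1 n)) :
    colMono n (columnOfSets n U L) = varY n r n + posSum (boxNeg n) 1 (subsetList n U) +
      posSum (boxNeg n) 1 (subsetList n L) := by
  obtain ⟨h1, h2⟩ := Finset.mem_powersetCard.1 hU
  have h3 : subsetList n (Finset.Icc 1 n \ U) = (List.range' 1 n).filter (· ∉ U) := by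
    refine List.filter_congr fun x hx => ?_
    rw [List.mem_range'_1] at hx
    have : x ∈ Finset.Icc 1 n := Finset.mem_Icc.2 (by omega)
    simp only [Finset.mem_sdiff, this, true_and]
  rw [colMono, columnOfSets, h3, posSum_boxPos_compl, length_subsetList h1, h2, sub_self, zero_add]

open Classical in
-- A column with `r` barred letters has `n - r` unbarred ones, so passing to the complement of the
-- latter gives two sets of the same size `r`.
theorem sum_columns_length {n r : ℕ} (F : Column → ℂ) :
    ∑ v ∈ (columns n).filter (fun v => v.l.length = r), F v =
      ∑ U ∈ Finset.powersetCard r (Finset.Icc 1 n), ∑ L ∈ Finset.powersetCard r (Finset.Icc 1 n),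
        F (columnOfSets n U L) := by
  rw [← Finset.sum_product']
  have hcard : ∀ l : List ℕ, l.Pairwise (· < ·) → l.toFinset.card = l.length := fun l hl =>
    List.toFinset_card_of_nodup (hl.imp (fun h => ne_of_lt h))
  have hsub : ∀ l : List ℕ, (∀ x ∈ l, 1 ≤ x ∧ x ≤ n) → l.toFinset ⊆ Finset.Icc 1 n :=
    fun l hl x hx => Finset.mem_Icc.2 (hl x (List.mem_toFinset.1 hx))
  have hinv : ∀ v, IsColumn n v →
      columnOfSets n (Finset.Icc 1 n \ v.u.toFinset) v.l.toFinset = v := by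
    rintro v ⟨h1, h2, h3, h4, h5⟩
    rw [columnOfSets, Finset.sdiff_sdiff_eq_self (hsub _ h3), subsetList_toFinset h1 h3,
      subsetList_toFinset h2 h4]
  refine Finset.sum_nbij' (fun v => (Finset.Icc 1 n \ v.u.toFinset, v.l.toFinset))
    (fun p => columnOfSets n p.1 p.2) ?_ ?_ ?_ ?_ ?_
  · intro v hv
    rw [Finset.mem_filter, mem_columns] at hv
    obtain ⟨⟨h1, h2, h3, h4, h5⟩, h6⟩ := hv
    rw [Finset.mem_product, Finset.mem_powersetCard, Finset.mem_powersetCard]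
    refine ⟨⟨Finset.sdiff_subset, ?_⟩, hsub _ h4, (hcard _ h2).trans h6⟩
    rw [Finset.card_sdiff_of_subset (hsub _ h3), hcard _ h1, Nat.card_Icc]
    omega
  · rintro ⟨U, L⟩ hp
    rw [Finset.mem_product, Finset.mem_powersetCard, Finset.mem_powersetCard] at hp
    obtain ⟨⟨h1, h2⟩, h3, h4⟩ := hp
    rw [Finset.mem_filter, mem_columns]
    have h5 := length_subsetList h3
    have h6 := length_subsetList (Finset.sdiff_subset : Finset.Icc 1 n \ U ⊆ Finset.Icc 1 n)
    rw [Finset.card_sdiff_of_subset h1, Nat.card_Icc] at h6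
    have h7 := Finset.card_le_card h1
    rw [Nat.card_Icc] at h7
    refine ⟨⟨pairwise_subsetList _ _, pairwise_subsetList _ _,
      fun x hx => (mem_subsetList.1 hx).1, fun x hx => (mem_subsetList.1 hx).1, ?_⟩, ?_⟩
    · simp only [columnOfSets] at *
      omega
    · simp only [columnOfSets] at *
      omega
  · intro v hv
    exact hinv v (mem_columns.1 (Finset.mem_filter.1 hv).1)
  · rintro ⟨U, L⟩ hp
    rw [Finset.mem_product, Finset.mem_powersetCard, Finset.mem_powersetCard] at hp
    obtain ⟨⟨h1, h2⟩, h3, h4⟩ := hp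
    simp only [columnOfSets, toFinset_subsetList h3, toFinset_subsetList Finset.sdiff_subset,
      Finset.sdiff_sdiff_eq_self h1]
  · intro v hv
    rw [hinv v (mem_columns.1 (Finset.mem_filter.1 hv).1)]

open Classical in
-- Grouped by the number of barred letters, the monomial of a column splits into `c_n^{(r)}` and one
-- factor for each of `U` and `L`, so each group is a square times `c_n^{(r)}`.
theorem sum_evalMono_colMono {n : ℕ} {c : Fin n → ℤ → ℂ} (hc : ∀ i p, c i p ≠ 0) :
    ∑ v ∈ (columns n).filter (fun v => v.l ≠ []), evalMono c (colMono n v) =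
      ∑ r : Fin n, val c (r.val + 1) n * elemSum c n (r.val + 1) ^ 2 := by
  rw [Fin.sum_univ_eq_sum_range (fun r => val c (r + 1) n * elemSum c n (r + 1) ^ 2),
    ← Finset.sum_fiberwise_of_maps_to (s := (columns n).filter (fun v => v.l ≠ []))
      (t := Finset.range n) (g := fun v => v.l.length - 1)]
  · refine Finset.sum_congr rfl fun r _ => ?_
    have h1 : ((columns n).filter (fun v => v.l ≠ [])).filter (fun v => v.l.length - 1 = r) =
        (columns n).filter (fun v => v.l.length = r + 1) := by
      rw [Finset.filter_filter]
      refine Finset.filter_congr fun v _ => ?_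
      rw [← List.length_pos_iff]
      omega
    rw [h1, sum_columns_length (fun v => evalMono c (colMono n v)), sq, elemSum_eq_sum hc,
      Finset.sum_mul_sum, Finset.mul_sum]
    refine Finset.sum_congr rfl fun U hU => ?_
    rw [Finset.mul_sum]
    refine Finset.sum_congr rfl fun L _ => ?_
    rw [colMono_columnOfSets hU, evalMono_add hc, evalMono_add hc, evalMono_varY, mul_assoc]
    push_cast
    rfl
  · intro v hv
    rw [Finset.mem_filter, mem_columns] at hv
    obtain ⟨⟨-, -, -, -, h5⟩, h6⟩ := hv
    rw [← List.length_pos_iff] at h6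
    rw [Finset.mem_range]
    omega

/-! ### Parameters outside `1, …, n` -/

/-- The parameters `c`, set to `1` for superscripts outside `1, …, n`. -/
def truncParam {n : ℕ} (c : Fin n → ℤ → ℂ) : Fin n → ℤ → ℂ :=
  fun i p => if 1 ≤ p ∧ p ≤ n then c i p else 1

theorem truncParam_ne_zero {n : ℕ} {c : Fin n → ℤ → ℂ}
    (hc : ∀ (i : Fin n) (p : ℤ), 1 ≤ p → p ≤ n → c i p ≠ 0) (i : Fin n) (p : ℤ) :
    truncParam c i p ≠ 0 := by
  rw [truncParam]
  split_ifs with h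
  · exact hc i p h.1 h.2
  · exact one_ne_zero

theorem thetaMinus_truncParam {n : ℕ} (c : Fin n → ℤ → ℂ) :
    thetaMinus n (truncParam c) = thetaMinus n c := by
  have h : ∀ i p : Fin n, truncParam c i ((p.val : ℤ) + 1) = c i ((p.val : ℤ) + 1) := by
    intro i p
    have := p.2
    rw [truncParam, if_pos (by omega)]
  simp only [thetaMinus, h]

/-- The exponents which belong to variables `Y_{m,i}` with `1 ≤ m ≤ n`. -/
def mainRange (n : ℕ) : Submodule ℤ (LaurentMonomial n) :=
  Finsupp.supported ℤ ℤ {q | 1 ≤ q.1 ∧ q.1 ≤ n}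

theorem varY_mem_mainRange {n : ℕ} {m : ℤ} (h1 : 1 ≤ m) (h2 : m ≤ n) (x : ℕ) :
    varY n m x ∈ mainRange n := by
  rw [varY]
  split_ifs
  · exact Finsupp.single_mem_supported ℤ _ ⟨h1, h2⟩
  · exact Submodule.zero_mem _

/-- The box of `x` at position `b` has superscript `n - x + b`. In an increasing list `b ≤ x`
persists along the list, so the superscripts stay between `1` and `n`. -/
theorem posSum_boxNeg_mem_mainRange {n : ℕ} {l : List ℕ} (h : ∀ x ∈ l, x ≤ n)
    (hl : l.Pairwise (· < ·)) (b : ℤ) (hb : 1 ≤ b) (hb' : ∀ x ∈ l, b ≤ x) :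
    posSum (boxNeg n) b l ∈ mainRange n := by
  induction l generalizing b with
  | nil => exact Submodule.zero_mem _
  | cons x l ih =>
    have h1 := h x (by simp)
    have h2 := hb' x (by simp)
    rw [List.pairwise_cons] at hl
    refine Submodule.add_mem _ ?_ (ih (fun y hy => h y (by simp [hy])) hl.2 _ (by omega) ?_)
    · exact Submodule.sub_mem _ (varY_mem_mainRange (by omega) (by omega) _)
        (varY_mem_mainRange (by omega) (by omega) _)
    · intro y hy
      have := hl.1 y hy
      omega

theorem evalMono_truncParam {n : ℕ} (c : Fin n → ℤ → ℂ) {Y : LaurentMonomial n}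
    (hY : Y ∈ mainRange n) : evalMono (truncParam c) Y = evalMono c Y := by
  refine Finset.prod_congr rfl fun q hq => ?_
  have := (Finsupp.mem_supported _ _).1 hY (Finset.mem_coe.2 hq)
  simp only [truncParam, if_pos (show 1 ≤ q.1 ∧ q.1 ≤ n from this)]

theorem colMono_mem_mainRange {n : ℕ} {v : Column} (hv : IsColumn n v) (hl : v.l ≠ []) :
    colMono n v ∈ mainRange n := by
  obtain ⟨h1, h2, h3, h4, h5⟩ := hv
  have h6 := List.length_pos_iff.2 hl
  have hbox : ∀ S : Finset ℕ, posSum (boxNeg n) 1 (subsetList n S) ∈ mainRange n := fun S =>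
    posSum_boxNeg_mem_mainRange (fun x hx => (mem_subsetList.1 hx).1.2) (pairwise_subsetList _ _) 1
      le_rfl fun x hx => by
        have := (mem_subsetList.1 hx).1.1
        omega
  have hsub : v.u.toFinset ⊆ Finset.Icc 1 n :=
    fun x hx => Finset.mem_Icc.2 (h3 x (List.mem_toFinset.1 hx))
  have hv : columnOfSets n (Finset.Icc 1 n \ v.u.toFinset) v.l.toFinset = v := by
    rw [columnOfSets, Finset.sdiff_sdiff_eq_self hsub, subsetList_toFinset h1 h3,
      subsetList_toFinset h2 h4]
  rw [← hv, colMono_columnOfSets (r := v.l.length)]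
  · exact Submodule.add_mem _ (Submodule.add_mem _
      (varY_mem_mainRange (by omega) (by omega) _) (hbox _)) (hbox _)
  · rw [Finset.mem_powersetCard, Finset.card_sdiff_of_subset hsub, Nat.card_Icc,
      List.toFinset_card_of_nodup (h1.imp (fun h => ne_of_lt h))]
    exact ⟨Finset.sdiff_subset, by omega⟩

theorem generalizedMinor_thetaMinus {n : ℕ} (hn : 0 < n) {u : List (Fin n)}
    (hred : IsReducedWord n u)
    (hu : weylOf n u = weylOf n (longestWord n ++ [lastIdx n hn])) {c : Fin n → ℤ → ℂ}
    (hc : ∀ (i : Fin n) (p : ℤ), 1 ≤ p → p ≤ n → c i p ≠ 0) :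
    generalizedMinor n (lastIdx n hn) u [] (thetaMinus n c) =
      ∑ b ∈ Finset.univ.erase (highestColumn n),
        (rectMultiplicity b : ℂ) * evalMono c (colMono n b.val) := by
  classical
  -- Evaluation is multiplicative only if all parameters are nonzero, which is known for
  -- superscripts `1, …, n` only. Neither side depends on the others: the monomial `Y_{0,n}` of the
  -- highest weight vector is excluded from the sum.
  have hc' := truncParam_ne_zero hc
  have h1 : ∀ b ∈ Finset.univ.erase (highestColumn n),
      (rectMultiplicity b : ℂ) * evalMono c (colMono n b.val) =
        (rectMultiplicity b : ℂ) * evalMono (truncParam c) (colMono n b.val) := by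
    intro b hb
    rw [Finset.mem_erase, Ne, eq_highestColumn_iff] at hb
    rw [evalMono_truncParam c (colMono_mem_mainRange b.2.1 hb.1)]
  rw [Finset.sum_congr rfl h1]
  rw [generalizedMinor_eq_det hn hred hu, ← thetaMinus_truncParam c,
    prod_sign_mul_det_thetaMinus (fun i p _ _ => hc' i p) hn, ← sum_evalMono_colMono hc',
    ← sum_rectMultiplicity n (evalMono (truncParam c))]

end TypeC

open TypeC in
theorem mainTheorem3 (n : ℕ) (hn : 0 < n) :
    -- every column in `𝓑` has a well-defined rectification in `B(Λ_n)`
    (∀ v : Column, IsColumn n v → ∃! b : AdmissibleColumn n, IsRect v b) ∧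
    -- there is a unique embedding of crystals `B(Λ_n) → 𝒴(p)` with `u_{Λ_n} ↦ c_n^{(0)}`
    (∃! m : AdmissibleColumn n → LaurentMonomial n,
      IsCrystalEmbedding (columnCrystal n) (monomialCrystal n) m ∧
        m (highestColumn n) = monoVar n 0 (lastIdx n hn)) ∧
    ∀ m : AdmissibleColumn n → LaurentMonomial n,
      IsCrystalEmbedding (columnCrystal n) (monomialCrystal n) m →
      m (highestColumn n) = monoVar n 0 (lastIdx n hn) →
      -- any reduced word `u` of the Weyl group element `w_0 s_n`
      ∀ u : List (Fin n), IsReducedWord n u →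
        weylOf n u = weylOf n (longestWord n ++ [lastIdx n hn]) →
      -- parameters `c_i^{(p)} ∈ ℂ^×`, `1 ≤ i, p ≤ n`
      ∀ c : Fin n → ℤ → ℂ, (∀ (i : Fin n) (p : ℤ), 1 ≤ p → p ≤ n → c i p ≠ 0) →
        generalizedMinor n (lastIdx n hn) u [] (thetaMinus n c) =
          ∑ b ∈ Finset.univ.erase (highestColumn n),
            (rectMultiplicity b : ℂ) * evalMono c (m b) := by
  refine ⟨fun v hv => existsUnique_isRect hv,
    ⟨fun b => colMono n b.val, ⟨isCrystalEmbedding_colMono n, colMono_highestColumn hn⟩,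
      fun m hm => hm.1.eq_colMono hm.2⟩, ?_⟩
  intro m hm h0 u hred hu c hc
  rw [hm.eq_colMono h0]
  exact generalizedMinor_thetaMinus hn hred hu hc
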